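/- Let $G$ be a finite connected 1-dimensional cell complex (a graph; loops and multiple edges allowed) in which no vertex has degree $2$ and which has at least one branched vertex, i.e. a vertex of degree $\ge 3$ (equivalently: $G$ carries its natural cell structure and is homeomorphic neither to an interval nor to a circle). A free vertex is a vertex of degree $1$; a free edge is an edge with a free endpoint. Fix a characteristic map $[0,1]\to G$ of each edge, hence a positive orientation of each edge; each edge thus gives two oriented edges. Let $n\ge 0$ and let $\mathrm{Conf}_n(G)=\{(x_1,\dots,x_n)\in G^n : x_i\ne x_j \text{ for } i\neq j\}$ with the subspace topology. For $A\subseteq \mathrm{Conf}_n(G)$, an identifying function on $A$ is a continuous map $f:A\to G$ with $f(x)\neq x_j$ for all $x=(x_1,\dots,x_n)\in A$ and all $j$. A $k$-face $F$ associates to each edge $e$ an ordered tuple $F(\bar e)$ of indices from $\{1,\dots,n\}$, to each branched vertex $v$ at most one index $F(v)$, and to exactly $k$ oriented edges $e$ whose head $v_e$ is a branched vertex an index $F(e)$, such that each index occurs exactly once in total and such that, for each branched vertex $v$, there is at most one index of the form $F(v)$ or $F(e)$ with $v_e=v$. The face $F$ determines an embedded cube $[0,1]^k\to\mathrm{Conf}_n(G)$,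 with one coordinate $s_e$ for each oriented edge $e$ such that $F(e)$ exists, as follows. The token $F(v)$ is at $v$. On each edge lie, in this order along its positive orientation, the token of the negatively oriented edge (if any), the tokens of the tuple $F(\bar e)$, and the token of the positively oriented edge (if any). All gaps between consecutive tokens, and between an end of the edge and the nearest token, are equal, except that the gap between the token $F(e)$ and the end $v_e$ is $(1-s_e)$ times the common gap; so $s_e=1$ puts this token at $v_e$. The subspace $K_n(G)\subseteq \mathrm{Conf}_n(G)$ is the union of these cubes; its vertices ($0$-skeleton) are the configurations given by the $0$-faces, in which the tokens on each edge are evenly spaced. Let $A\subseteq K_n(G)$ contain the $0$-skeleton of $K_n(G)$. An identifying function $f$ on $A$ is called extendable if there are no free edge $e$, branched endpoint $v$ of $e$, and vertex $F$ of $K_n(G)$ such that $F(v)$ exists, $F(\bar e)$ is empty, and $f(F)\in e$. Then: 1. An identifying function on $K_n(G)$ extends to an identifying function on $\mathrm{Conf}_n(G)$ if and only if it is extendable. 2. More generally, if $A\subseteq K_n(G)$ contains the $0$-skeleton and an identifying function on $A$ extends to an identifying function on $\mathrm{Conf}_n(G)$, then it is extendable. 3. In particular, if $G$ has no free vertices,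 then every identifying function on $K_n(G)$ extends to an identifying function on $\mathrm{Conf}_n(G)$. -/

import Mathlib

open Set Topology

/-- The combinatorial data of a 1-dimensional cell complex with vertex set `V` and edge set `E`
(loops and multiple edges allowed). Each edge carries a fixed positive orientation, from `src e`
to `tgt e`. -/
structure CellGraph (V E : Type*) where
  src : E → V
  tgt : E → V

namespace CellGraph

variable {V E : Type*} (G : CellGraph V E)

/-- The underlying set of the cell complex: the disjoint union of its open cells. -/
inductive Point (G : CellGraph V E) : Type _
  | vertex (v : V) : Point G
  | interior (e : E) (t : Ioo (0 : ℝ) 1) : Point G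

open Classical in
/-- The characteristic map of the edge `e`, which runs from `src e` at time `0` to `tgt e` at
time `1` (and is constant outside `[0, 1]`). -/
noncomputable def edgePoint (e : E) (t : ℝ) : G.Point :=
  if h : t ∈ Ioo (0 : ℝ) 1 then .interior e ⟨t, h⟩
  else if t ≤ 0 then .vertex (G.src e) else .vertex (G.tgt e)

/-- The cell complex topology: a set is open if and only if its preimage under the characteristic
map `[0, 1] → G` of every edge is open. -/
noncomputable instance : TopologicalSpace G.Point :=
  ⨆ e : E, TopologicalSpace.coinduced (fun t : unitInterval => G.edgePoint e t) inferInstance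

/-- The closed edge `e` as a subset of the graph. -/
def closedEdge (e : E) : Set G.Point := G.edgePoint e '' Icc 0 1

/-- Oriented edges: `(e, true)` is `e` with its positive orientation, `(e, false)` is `e` with the
opposite one. -/
abbrev OrientedEdge (_ : CellGraph V E) : Type _ := E × Bool

/-- The endpoint towards which an oriented edge is pointing. -/
def head (o : G.OrientedEdge) : V := if o.2 then G.tgt o.1 else G.src o.1

/-- The degree of a vertex; a loop counts twice. -/
noncomputable def degree (v : V) : ℕ := Nat.card {o : G.OrientedEdge // G.head o = v}

def IsBranched (v : V) : Prop := 3 ≤ G.degree v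

def IsFree (v : V) : Prop := G.degree v = 1

def IsEndpoint (v : V) (e : E) : Prop := G.src e = v ∨ G.tgt e = v

end CellGraph

/-- The `n`-th ordered configuration space of `X`, with the topology induced from `X ^ n`. -/
def Conf (n : ℕ) (X : Type*) : Type _ := {x : Fin n → X // Function.Injective x}

instance (n : ℕ) (X : Type*) [TopologicalSpace X] : TopologicalSpace (Conf n X) :=
  inferInstanceAs (TopologicalSpace {x : Fin n → X // Function.Injective x})

namespace CellGraph

variable {V E : Type*} {G : CellGraph V E} {n : ℕ}

/-- The places to which a face can associate indices: the entries of the tuples at the (positively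
oriented) edges, the vertices, and the oriented edges. -/
abbrev Slot (G : CellGraph V E) (n : ℕ) (onEdge : E → List (Fin n)) : Type _ :=
  (Σ e : E, Fin (onEdge e).length) ⊕ V ⊕ G.OrientedEdge

/-- The index (if any) at a given place. -/
def slotLabel (onEdge : E → List (Fin n)) (atVertex : V → Option (Fin n))
    (moving : G.OrientedEdge → Option (Fin n)) : G.Slot n onEdge → Option (Fin n)
  | .inl c => some ((onEdge c.1).get c.2)
  | .inr (.inl v) => atVertex v
  | .inr (.inr o) => moving o

/-- The faces of the combinatorial model of `Conf n G`: elements of the graded poset `P_n(G)`. -/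
structure Face (G : CellGraph V E) (n : ℕ) where
  /-- the ordered tuple of indices at each positively oriented edge -/
  onEdge : E → List (Fin n)
  /-- the index, if any, at each vertex -/
  atVertex : V → Option (Fin n)
  /-- the index, if any, at each oriented edge: a token that can move from the interior of the
  edge to its head -/
  moving : G.OrientedEdge → Option (Fin n)
  /-- only branched vertices carry an index -/
  atVertex_branched : ∀ v, (atVertex v).isSome → G.IsBranched v
  /-- only oriented edges pointing to branched vertices carry an index -/
  moving_branched : ∀ o, (moving o).isSome → G.IsBranched (G.head o)
  /-- each index occurs exactly once -/
  occurs_once : ∀ i : Fin n, ∃! c : G.Slot n onEdge, slotLabel onEdge atVertex moving c = some i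
  /-- for each vertex `v`, at most one index is associated to `v` or to the oriented edges with
  head `v` -/
  atVertex_eq_none : ∀ o, (moving o).isSome → atVertex (G.head o) = none
  moving_unique : ∀ o o', (moving o).isSome → (moving o').isSome → G.head o = G.head o' → o = o'

namespace Face

/-- The dimension of a face. -/
noncomputable def dim (F : G.Face n) : ℕ := Nat.card {o : G.OrientedEdge // (F.moving o).isSome}

/-- The cube `[0, 1]^k` of a `k`-face, with one coordinate for each moving token. Coordinate `0`
means that the token is stationary in the interior of its edge (the face `F_e^-`), coordinate `1`
means that it is at the head of the oriented edge (the face `F_e^+`). -/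
abbrev Cube (F : G.Face n) : Type _ := {o : G.OrientedEdge // (F.moving o).isSome} → unitInterval

/-- The distance from the head of `o` to the moving token on `o`, measured in units of the spacing
of the tokens on that edge (`1` if there is no such token). -/
def gap (F : G.Face n) (s : F.Cube) (o : G.OrientedEdge) : ℝ :=
  if h : (F.moving o).isSome then 1 - s ⟨o, h⟩ else 1

/-- The distance from the head of `o` to the nearest stationary token in the interior of that edge,
in the same units. -/
def margin (F : G.Face n) (s : F.Cube) (o : G.OrientedEdge) : ℝ :=
  if (F.moving o).isSome then F.gap s o + 1 else 1

/-- The length of the edge `e` in the same units. -/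
def units (F : G.Face n) (s : F.Cube) (e : E) : ℝ :=
  F.margin s (e, false) + (F.onEdge e).length + F.margin s (e, true) - 1

/-- The location in `G` of the token at a given place. On each edge, consecutive tokens are equally
spaced; so is the gap between an outermost token and the end of the edge, except that it is scaled
by `1 - s` if the token is moving to that end with parameter `s`. -/
noncomputable def slotPoint (F : G.Face n) (s : F.Cube) : G.Slot n F.onEdge → G.Point
  | .inl c => G.edgePoint c.1 ((F.margin s (c.1, false) + (c.2 : ℕ)) / F.units s c.1)
  | .inr (.inl v) => .vertex v
  | .inr (.inr (e, false)) => G.edgePoint e (F.gap s (e, false) / F.units s e)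
  | .inr (.inr (e, true)) => G.edgePoint e (1 - F.gap s (e, true) / F.units s e)

/-- The label function of a face. -/
def label (F : G.Face n) : G.Slot n F.onEdge → Option (Fin n) :=
  slotLabel F.onEdge F.atVertex F.moving

/-- The unique place at which the index `i` occurs. -/
noncomputable def slotOf (F : G.Face n) (i : Fin n) : G.Slot n F.onEdge :=
  (F.occurs_once i).choose

theorem label_slotOf (F : G.Face n) (i : Fin n) : F.label (F.slotOf i) = some i :=
  (F.occurs_once i).choose_spec.1

theorem gap_nonneg (F : G.Face n) (s : F.Cube) (o) : 0 ≤ F.gap s o := by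
  unfold gap
  split_ifs with h
  · linarith [(s ⟨o, h⟩).2.2]
  · norm_num

theorem margin_of_isSome (F : G.Face n) (s : F.Cube) {o} (h : (F.moving o).isSome) :
    F.margin s o = F.gap s o + 1 := by simp [margin, h]

theorem one_le_margin (F : G.Face n) (s : F.Cube) (o) : 1 ≤ F.margin s o := by
  unfold margin
  split_ifs
  · linarith [F.gap_nonneg s o]
  · rfl

theorem units_pos (F : G.Face n) (s : F.Cube) (e) : 0 < F.units s e := by
  unfold units
  have := F.one_le_margin s (e, false)
  have := F.one_le_margin s (e, true)
  have : (0 : ℝ) ≤ (F.onEdge e).length := Nat.cast_nonneg _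
  linarith

theorem edgePoint_interior {e : E} {t : ℝ} (h : t ∈ Ioo (0 : ℝ) 1) :
    G.edgePoint e t = .interior e ⟨t, h⟩ := by
  unfold edgePoint; rw [dif_pos h]

/-- A stationary token on an edge lies in its interior. -/
theorem slotPoint_inl (F : G.Face n) (s : F.Cube) (c) : ∃ h,
    F.slotPoint s (.inl c) =
      .interior c.1 ⟨(F.margin s (c.1, false) + (c.2 : ℕ)) / F.units s c.1, h⟩ := by
  have hu := F.units_pos s c.1
  have h1 := F.one_le_margin s (c.1, false)
  have h2 := F.one_le_margin s (c.1, true)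
  have h3 : ((c.2 : ℕ) : ℝ) + 1 ≤ (F.onEdge c.1).length := by exact_mod_cast c.2.2
  have h4 : (0 : ℝ) ≤ (c.2 : ℕ) := Nat.cast_nonneg _
  have h : (F.margin s (c.1, false) + (c.2 : ℕ)) / F.units s c.1 ∈ Ioo (0 : ℝ) 1 := by
    refine ⟨by positivity, ?_⟩
    rw [div_lt_one hu, units]; linarith
  exact ⟨h, edgePoint_interior h⟩

/-- The coordinate of a moving token on its edge. -/
noncomputable def movingCoord (F : G.Face n) (s : F.Cube) (o : G.OrientedEdge) : ℝ :=
  if o.2 then 1 - F.gap s o / F.units s o.1 else F.gap s o / F.units s o.1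

/-- A moving token is at the head of its oriented edge or in the interior of the edge. -/
theorem slotPoint_moving (F : G.Face n) (s : F.Cube) (o) (ho : (F.moving o).isSome) :
    F.slotPoint s (.inr (.inr o)) = .vertex (G.head o) ∨
    ∃ h, F.slotPoint s (.inr (.inr o)) = .interior o.1 ⟨F.movingCoord s o, h⟩ := by
  obtain ⟨e, b⟩ := o
  have hu := F.units_pos s e
  have h0 := F.gap_nonneg s (e, b)
  have h1 := F.one_le_margin s (e, false)
  have h2 := F.one_le_margin s (e, true)
  have h4 : (0 : ℝ) ≤ (F.onEdge e).length := Nat.cast_nonneg _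
  have h3 := F.margin_of_isSome s ho
  have hlt : F.gap s (e, b) / F.units s e < 1 := by
    rw [div_lt_one hu, units]
    cases b <;> linarith
  rcases h0.eq_or_lt with h | h
  · left
    cases b <;> simp [slotPoint, ← h, edgePoint, head]
  · right
    have hp : 0 < F.gap s (e, b) / F.units s e := div_pos h hu
    have hm : F.movingCoord s (e, b) ∈ Ioo (0 : ℝ) 1 := by
      cases b <;> simp only [movingCoord, mem_Ioo] <;> constructor <;> simp <;> linarith
    refine ⟨hm, ?_⟩
    rw [← edgePoint_interior hm]
    cases b <;> simp [slotPoint, movingCoord]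

theorem coord_ne (F : G.Face n) (s : F.Cube) (o : G.OrientedEdge) (ho : (F.moving o).isSome)
    (k : Fin (F.onEdge o.1).length) :
    (F.margin s (o.1, false) + (k : ℕ)) / F.units s o.1 ≠ F.movingCoord s o := by
  obtain ⟨e, b⟩ := o
  have hu := F.units_pos s e
  have h3 := F.margin_of_isSome s ho
  have hk : ((k : ℕ) : ℝ) + 1 ≤ (F.onEdge e).length := by exact_mod_cast k.2
  have hk0 : (0 : ℝ) ≤ (k : ℕ) := Nat.cast_nonneg _
  intro h
  cases b
  · simp only [movingCoord, Bool.false_eq_true, if_false] at h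
    rw [div_left_inj' hu.ne'] at h
    linarith
  · simp only [movingCoord, if_true] at h
    rw [eq_sub_iff_add_eq, ← add_div, div_eq_one_iff_eq hu.ne', units] at h
    simp only at hk hk0 h
    linarith

theorem movingCoord_ne (F : G.Face n) (s : F.Cube) (e : E) (h0 : (F.moving (e, false)).isSome)
    (h1 : (F.moving (e, true)).isSome) :
    F.movingCoord s (e, false) ≠ F.movingCoord s (e, true) := by
  have hu := F.units_pos s e
  have h3 := F.margin_of_isSome s h0
  have h4 := F.margin_of_isSome s h1
  have h5 : (0 : ℝ) ≤ (F.onEdge e).length := Nat.cast_nonneg _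
  intro h
  simp only [movingCoord, Bool.false_eq_true, if_false, if_true] at h
  rw [eq_sub_iff_add_eq, ← add_div, div_eq_one_iff_eq hu.ne', units] at h
  linarith

theorem inl_ne_moving (F : G.Face n) (s : F.Cube) (c o) (ho : (F.moving o).isSome) :
    F.slotPoint s (.inl c) ≠ F.slotPoint s (.inr (.inr o)) := by
  intro h
  obtain ⟨h1, e1⟩ := F.slotPoint_inl s c
  rcases F.slotPoint_moving s o ho with e2 | ⟨h2, e2⟩
  · rw [e1, e2] at h; cases h
  · rw [e1, e2] at h
    obtain ⟨e, k⟩ := c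
    obtain ⟨e', b⟩ := o
    simp only [Point.interior.injEq, Subtype.mk.injEq] at h
    obtain ⟨rfl, h⟩ := h
    exact F.coord_ne s (e, b) ho k h

theorem vertex_ne_moving (F : G.Face n) (s : F.Cube) (v o) (hv : (F.atVertex v).isSome)
    (ho : (F.moving o).isSome) :
    F.slotPoint s (.inr (.inl v)) ≠ F.slotPoint s (.inr (.inr o)) := by
  intro h
  rcases F.slotPoint_moving s o ho with e2 | ⟨h2, e2⟩
  · rw [e2] at h
    simp only [slotPoint, Point.vertex.injEq] at h
    subst h
    simp [F.atVertex_eq_none o ho] at hv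
  · rw [e2] at h; cases h

theorem slotPoint_inj (F : G.Face n) (s : F.Cube) (c c') (hc : (F.label c).isSome)
    (hc' : (F.label c').isSome) (h : F.slotPoint s c = F.slotPoint s c') : c = c' := by
  rcases c with c | v | o <;> rcases c' with c' | v' | o'
  · obtain ⟨h1, e1⟩ := F.slotPoint_inl s c
    obtain ⟨h2, e2⟩ := F.slotPoint_inl s c'
    rw [e1, e2] at h
    obtain ⟨e, k⟩ := c
    obtain ⟨e', k'⟩ := c'
    simp only [Point.interior.injEq, Subtype.mk.injEq] at h
    obtain ⟨rfl, h⟩ := h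
    rw [div_left_inj' (F.units_pos s e).ne', add_right_inj, Nat.cast_inj] at h
    rw [Fin.ext h]
  · obtain ⟨h1, e1⟩ := F.slotPoint_inl s c
    rw [e1] at h; cases h
  · exact absurd h (F.inl_ne_moving s c o' hc')
  · obtain ⟨h1, e1⟩ := F.slotPoint_inl s c'
    rw [e1] at h; cases h
  · simp only [slotPoint, Point.vertex.injEq] at h
    rw [h]
  · exact absurd h (F.vertex_ne_moving s v o' hc hc')
  · exact absurd h.symm (F.inl_ne_moving s c' o hc)
  · exact absurd h.symm (F.vertex_ne_moving s v' o hc' hc)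
  · have hc : (F.moving o).isSome := hc
    have hc' : (F.moving o').isSome := hc'
    congr 2
    rcases F.slotPoint_moving s o hc with e1 | ⟨h1, e1⟩ <;>
    rcases F.slotPoint_moving s o' hc' with e2 | ⟨h2, e2⟩ <;> rw [e1, e2] at h
    · exact F.moving_unique o o' hc hc' (by simpa using h)
    · cases h
    · cases h
    · obtain ⟨e, b⟩ := o
      obtain ⟨e', b'⟩ := o'
      simp only [Point.interior.injEq, Subtype.mk.injEq] at h
      obtain ⟨rfl, h⟩ := h
      cases b <;> cases b'
      · rfl
      · exact absurd h (F.movingCoord_ne s e hc hc')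
      · exact absurd h.symm (F.movingCoord_ne s e hc' hc)
      · rfl

/-- The characteristic map of the cell of the face `F`: the embedding of the cube of `F` into the
configuration space. -/
noncomputable def cellMap (F : G.Face n) (s : F.Cube) : Conf n G.Point :=
  ⟨fun i => F.slotPoint s (F.slotOf i), fun i j h => by
    have := F.slotPoint_inj s _ _ (by simp [label_slotOf]) (by simp [label_slotOf]) h
    have h2 := congrArg F.label this
    simpa [label_slotOf] using h2⟩

end Face

/-- A vertex of the cube complex `K_n(G)`, that is, a face of dimension `0`, as a configuration:
the tokens on each edge are evenly spaced. -/
noncomputable def Face.vertexConf (F : G.Face n) : Conf n G.Point := F.cellMap fun _ => 0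

/-- The cube complex `K_n(G)`, embedded in the configuration space: the union of its cells. -/
def cubeComplex (G : CellGraph V E) (n : ℕ) : Set (Conf n G.Point) :=
  {x | ∃ (F : G.Face n) (s : F.Cube), F.cellMap s = x}

/-- The `0`-skeleton of `K_n(G)`. -/
def zeroSkeleton (G : CellGraph V E) (n : ℕ) : Set (Conf n G.Point) :=
  {x | ∃ F : G.Face n, F.dim = 0 ∧ F.vertexConf = x}

theorem zeroSkeleton_subset (G : CellGraph V E) (n : ℕ) :
    G.zeroSkeleton n ⊆ G.cubeComplex n := by
  rintro x ⟨F, -, rfl⟩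
  exact ⟨F, _, rfl⟩

end CellGraph

/-- A partially defined identifying function, with domain `A ⊆ Conf n X`: a continuous function
whose value at a configuration is never one of its tokens. -/
def IsIdentifyingOn {n : ℕ} {X : Type*} [TopologicalSpace X] (A : Set (Conf n X)) (f : A → X) :
    Prop :=
  Continuous f ∧ ∀ (x : A) (j : Fin n), f x ≠ x.1.1 j

/-- An identifying function on the whole configuration space. -/
def IsIdentifying {n : ℕ} {X : Type*} [TopologicalSpace X] (g : Conf n X → X) : Prop :=
  Continuous g ∧ ∀ (x : Conf n X) (j : Fin n), g x ≠ x.1 j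

/-- `f` is the restriction to `A` of an identifying function on `Conf n X`. -/
def ExtendsToConf {n : ℕ} {X : Type*} [TopologicalSpace X] (A : Set (Conf n X)) (f : A → X) :
    Prop :=
  ∃ g : Conf n X → X, IsIdentifying g ∧ ∀ x : A, g x.1 = f x

namespace CellGraph

variable {V E : Type*} {G : CellGraph V E} {n : ℕ}

/-- `f` is extendable if there are no free edge `e` (with a free endpoint `u`), branched endpoint
`v` of `e`, and vertex `F` of `K_n(G)` such that `F` occupies `v`, has no token on `e`, and is sent
into `e` by `f`. -/
def IsExtendable (A : Set (Conf n G.Point)) (hA : G.zeroSkeleton n ⊆ A) (f : A → G.Point) : Prop :=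
  ¬ ∃ (e : E) (u v : V) (F : G.Face n) (hF : F.dim = 0),
    G.IsEndpoint u e ∧ G.IsFree u ∧ G.IsEndpoint v e ∧ G.IsBranched v ∧
    (F.atVertex v).isSome ∧ F.onEdge e = [] ∧
    f ⟨F.vertexConf, hA ⟨F, hF, rfl⟩⟩ ∈ G.closedEdge e

end CellGraph

/-! An extension is built from a retraction `r` of the configuration space onto the cube complex
together with piecewise affine maps `T_x` of the graph that fix all vertices and carry the tokens of
`r(x)` to those of `x`: put `g(x) = T_x(f(r(x)))`. On the cube complex both `r` and `T_x` are the
identity, so `g` extends `f`.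

The constructions take place on lifts, where each token carries a coordinate in `E × [0,1]`. The
projection of lifts to configurations is proper, hence a quotient map (`Lift.isQuotientMap_conf`),
so it suffices to define everything continuously on lifts and to check independence of the lift. The
ambiguity concerns only tokens at branched vertices, because a free vertex is the end of just one
edge. The retraction `Lift.spread` keeps the order of the tokens on each edge and spaces them
evenly, except that the end gap at `o` is `depth / max depth others` if the head of `o` is branched.
The depth vanishes if a token is at that end, and `others` is the product of the depths of the
competing ends at the same vertex, so at most one end per vertex has a short gap. Independence of
the lift is `Lift.conf_spread_congr`; that `spread` retracts onto the cube complex follows from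
`Lift.conf_spread_mem`, `IsGap.spread_lift` and `exists_lift_of_mem`.

The map `T_x` degenerates in one situation only: `x` has a token at a free vertex, `r` moves that
token inwards, and `T_x` collapses the segment behind it to the vertex. Hence `g` is identifying
unless `f(r(x))` is trapped in such a segment (`Lift.chart_transport_ne`,
`extendsToConf_of_not_trapped`).

Extendability excludes traps. A trapped value cannot cross the last token, so by the intermediate
value theorem it stays trapped when gaps change (`IsGap.trapped_iff`). The token nearest to the
branched end is moved to the branched vertex and from then on counted on another edge there. By
induction only the last token remains on the free edge; moving it to the branched vertex as well
gives a vertex of the complex that violates extendability (`not_trapped_one`).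

Conversely, if an extension existed for a non-extendable function, the token at the branched vertex
could be pushed along the empty free edge up to its free end, and the value ahead of it would have
to collide with it (`isExtendable_of_extendsToConf`). -/

namespace CellGraph

variable {V E : Type*} (G : CellGraph V E)

/-! ### Edge coordinates, the cell topology and lifted configurations -/

/-- The characteristic maps of all edges, assembled into one map. -/
noncomputable def chart (p : E × unitInterval) : G.Point := G.edgePoint p.1 p.2

/-- The end of the edge `o.1` at which the oriented edge `o` has its head. -/
def endOf (o : E × Bool) : E × unitInterval := (o.1, if o.2 then 1 else 0)

@[simp] theorem endOf_fst (o : E × Bool) : (endOf o).1 = o.1 := rfl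

theorem chart_endOf (o : G.OrientedEdge) : G.chart (endOf o) = .vertex (G.head o) := by
  obtain ⟨e, b⟩ := o
  cases b <;> simp [chart, endOf, edgePoint, head]

theorem chart_interior {p : E × unitInterval} (h : (p.2 : ℝ) ∈ Ioo (0 : ℝ) 1) :
    G.chart p = .interior p.1 ⟨p.2, h⟩ := by
  simp only [chart, edgePoint, dif_pos h]

theorem eq_endOf_or_interior (p : E × unitInterval) :
    (∃ b, p = endOf (p.1, b)) ∨ (p.2 : ℝ) ∈ Ioo (0 : ℝ) 1 := by
  obtain ⟨e, t⟩ := p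
  rcases t.2.1.eq_or_lt with h | h
  · exact .inl ⟨false, by ext <;> simp [endOf, ← h]⟩
  rcases t.2.2.eq_or_lt with h' | h'
  · exact .inl ⟨true, by ext <;> simp [endOf, h']⟩
  · exact .inr ⟨h, h'⟩

theorem endOf_injective : Function.Injective (endOf : E × Bool → E × unitInterval) := by
  rintro ⟨e, b⟩ ⟨e', b'⟩ h
  cases b <;> cases b' <;> simp_all [endOf]

theorem endOf_not_interior (o : E × Bool) : ((endOf o).2 : ℝ) ∉ Ioo (0 : ℝ) 1 := by
  obtain ⟨e, b⟩ := o
  cases b <;> simp [endOf]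

theorem chart_eq_chart {p p' : E × unitInterval} (h : G.chart p = G.chart p') :
    p = p' ∨ ∃ o o', p = endOf o ∧ p' = endOf o' ∧ G.head o = G.head o' := by
  rcases eq_endOf_or_interior p with ⟨b, hp⟩ | hp <;>
  rcases eq_endOf_or_interior p' with ⟨b', hp'⟩ | hp'
  · rw [hp, hp', chart_endOf, chart_endOf] at h
    exact .inr ⟨_, _, hp, hp', by simpa using h⟩
  · rw [hp, chart_endOf, chart_interior _ hp'] at h; cases h
  · rw [hp', chart_endOf, chart_interior _ hp] at h; cases h
  · rw [chart_interior _ hp, chart_interior _ hp'] at h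
    simp only [Point.interior.injEq, Subtype.mk.injEq] at h
    exact .inl (Prod.ext h.1 (Subtype.ext h.2))

theorem chart_eq_of_interior {p p' : E × unitInterval} (hp : (p.2 : ℝ) ∈ Ioo (0 : ℝ) 1)
    (h : G.chart p = G.chart p') : p = p' := by
  rcases G.chart_eq_chart h with h | ⟨o, o', rfl, -, -⟩
  · exact h
  · exact absurd hp (endOf_not_interior o)

theorem continuous_edgePoint (e : E) : Continuous fun t : unitInterval => G.edgePoint e t :=
  continuous_iff_coinduced_le.2 (le_iSup (fun e : E => TopologicalSpace.coinduced
    (fun t : unitInterval => G.edgePoint e t) inferInstance) e)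

theorem continuous_point_iff {X : Type*} [TopologicalSpace X] {f : G.Point → X} :
    Continuous f ↔ ∀ e, Continuous fun t : unitInterval => f (G.edgePoint e t) := by
  refine continuous_iSup_dom.trans (forall_congr' fun e => ?_)
  exact continuous_coinduced_dom

theorem isClosed_point_iff {s : Set G.Point} :
    IsClosed s ↔ ∀ e, IsClosed {t : unitInterval | G.edgePoint e t ∈ s} := by
  refine isClosed_iSup_iff.trans (forall_congr' fun e => ?_)
  exact isClosed_coinduced

theorem isOpen_point_iff {s : Set G.Point} :
    IsOpen s ↔ ∀ e, IsOpen {t : unitInterval | G.edgePoint e t ∈ s} := by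
  refine isOpen_iSup_iff.trans (forall_congr' fun e => ?_)
  exact isOpen_coinduced

section Discrete

variable [TopologicalSpace E]

theorem continuous_chart [DiscreteTopology E] : Continuous G.chart :=
  continuous_prod_of_discrete_left.2 fun e => G.continuous_edgePoint e

/-- Interior points of an edge have a single preimage under the chart, so the trace of the image of
`C` on an edge is the slice of `C` there, up to a subset of the two ends. -/
theorem isClosedMap_chart : IsClosedMap G.chart := by
  intro C hC
  rw [isClosed_point_iff]
  intro e
  have h1 : IsClosed {t : unitInterval | (e, t) ∈ C} := hC.preimage (by fun_prop)
  have h2 : IsClosed ({t : unitInterval | G.edgePoint e t ∈ G.chart '' C} ∩ {0, 1}) :=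
    (Set.Finite.subset (by simp) inter_subset_right).isClosed
  convert h1.union h2 using 1
  ext t
  constructor
  · intro ht
    rcases eq_endOf_or_interior (e, t) with ⟨b, hb⟩ | hi
    · refine .inr ⟨ht, ?_⟩
      have := congrArg Prod.snd hb
      simp only [endOf] at this
      cases b <;> simp_all
    · obtain ⟨p, hp, hpt⟩ := ht
      have := G.chart_eq_of_interior hi hpt.symm
      subst this
      exact .inl hp
  · rintro (ht | ht)
    · exact ⟨_, ht, rfl⟩
    · exact ht.1

/-- Points in the image are closed because the chart is a closed map, so fibres are closed in the
compact space `E × [0,1]`. -/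
theorem isProperMap_chart [DiscreteTopology E] [Finite E] : IsProperMap G.chart := by
  refine isProperMap_iff_isClosedMap_and_compact_fibers.2
    ⟨G.continuous_chart, G.isClosedMap_chart, fun y => IsClosed.isCompact ?_⟩
  by_cases hy : ∃ p, G.chart p = y
  · obtain ⟨p, rfl⟩ := hy
    have : IsClosed {G.chart p} := by
      rw [← image_singleton]
      exact G.isClosedMap_chart _ isClosed_singleton
    exact this.preimage G.continuous_chart
  · convert isClosed_empty
    ext p
    simp only [mem_preimage, mem_singleton_iff, mem_empty_iff_false, iff_false]
    exact fun h => hy ⟨p, h⟩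

end Discrete

theorem chart_surjective (hV : ∀ v, ∃ o, G.head o = v) : Function.Surjective G.chart := by
  rintro (v | ⟨e, t⟩)
  · obtain ⟨o, rfl⟩ := hV v
    exact ⟨_, G.chart_endOf o⟩
  · exact ⟨(e, ⟨t, t.2.1.le, t.2.2.le⟩), G.chart_interior t.2⟩

/-- Configurations whose tokens are equipped with coordinates on an edge. -/
def Lift (n : ℕ) : Type _ := {z : Fin n → E × unitInterval // Function.Injective (G.chart ∘ z)}

variable {G} {n : ℕ}

instance [TopologicalSpace E] : TopologicalSpace (G.Lift n) :=
  inferInstanceAs (TopologicalSpace {z : Fin n → E × unitInterval //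
    Function.Injective (G.chart ∘ z)})

/-- The configuration underlying a lift. -/
noncomputable def Lift.conf (z : G.Lift n) : Conf n G.Point := ⟨G.chart ∘ z.1, z.2⟩

theorem Lift.conf_surjective (hV : ∀ v, ∃ o, G.head o = v) :
    Function.Surjective (Lift.conf : G.Lift n → _) := by
  intro x
  choose z hz using fun i => G.chart_surjective hV (x.1 i)
  have : G.chart ∘ z = x.1 := funext hz
  exact ⟨⟨z, this ▸ x.2⟩, Subtype.ext this⟩

/-- Properness, unlike being a quotient map, passes to products and to restrictions to full
preimages; lifts are the full preimage of the injective tuples. -/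
theorem Lift.isProperMap_conf [TopologicalSpace E] [DiscreteTopology E] [Finite E] :
    IsProperMap (Lift.conf : G.Lift n → _) := by
  have h : IsProperMap fun (z : Fin n → E × unitInterval) i => G.chart (z i) :=
    IsProperMap.pi_map fun _ => G.isProperMap_chart
  exact h.restrictPreimage {x | Function.Injective x}

theorem Lift.isQuotientMap_conf [TopologicalSpace E] [DiscreteTopology E] [Finite E]
    (hV : ∀ v, ∃ o, G.head o = v) : IsQuotientMap (Lift.conf : G.Lift n → _) :=
  Lift.isProperMap_conf.isClosedMap.isQuotientMap Lift.isProperMap_conf.continuous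
    (Lift.conf_surjective hV)

/-- A map on a subset of a product of the configuration space with the graph is continuous if it is
continuous in coordinates. -/
theorem continuous_of_lift [TopologicalSpace E] [DiscreteTopology E] [Finite E]
    (hV : ∀ v, ∃ o, G.head o = v) {X : Type*} [TopologicalSpace X]
    (S : Set (Conf n G.Point × G.Point)) (f : S → X)
    (hf : Continuous fun w : Prod.map Lift.conf G.chart ⁻¹' S => f ⟨_, w.2⟩) : Continuous f := by
  have hp : IsProperMap (Prod.map (Lift.conf : G.Lift n → _) G.chart) :=
    Lift.isProperMap_conf.prodMap G.isProperMap_chart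
  have hq := hp.restrictPreimage S
  refine (hq.isClosedMap.isQuotientMap hq.continuous ?_).continuous_iff.2 hf
  exact Set.restrictPreimage_surjective _
    (Function.Surjective.prodMap (Lift.conf_surjective hV) (G.chart_surjective hV))

theorem exists_head_of_degree {v : V} (h : G.degree v ≠ 0) : ∃ o, G.head o = v := by
  by_contra! hc
  refine h ?_
  rw [degree, Nat.card_eq_zero]
  exact .inl ⟨fun o => hc o.1 o.2⟩

theorem degree_pos_of_head [Finite E] (o : G.OrientedEdge) : 0 < G.degree (G.head o) := by
  have : Nonempty {o' : G.OrientedEdge // G.head o' = G.head o} := ⟨⟨o, rfl⟩⟩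
  exact Nat.card_pos

theorem IsFree.eq_of_head {v : V} (h : G.IsFree v) {o o' : G.OrientedEdge} (ho : G.head o = v)
    (ho' : G.head o' = v) : o = o' := by
  obtain ⟨hs, -⟩ := Nat.card_eq_one_iff_unique.1 h
  exact congrArg Subtype.val (Subsingleton.elim (⟨o, ho⟩ : {o // G.head o = v}) ⟨o', ho'⟩)

theorem IsBranched.exists_ne [Finite E] {v : V} (h : G.IsBranched v) (o : G.OrientedEdge) :
    ∃ o', G.head o' = v ∧ o' ≠ o := by
  by_contra! hc
  have : Subsingleton {o' : G.OrientedEdge // G.head o' = v} :=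
    ⟨fun a b => Subtype.ext ((hc a.1 a.2).trans (hc b.1 b.2).symm)⟩
  have h1 : G.degree v ≤ 1 := Finite.card_le_one_iff_subsingleton.2 this
  have h2 : 3 ≤ G.degree v := h
  omega

theorem IsFree.not_isBranched {v : V} (h : G.IsFree v) : ¬ G.IsBranched v := by
  have h1 : G.degree v = 1 := h
  simp [IsBranched, h1]

/-- An isolated vertex is clopen, hence by connectedness the whole graph, which leaves no room for a
branched vertex. -/
theorem degree_ne_zero [Finite E] [ConnectedSpace G.Point] (hb : ∃ v, G.IsBranched v) (v : V) :
    G.degree v ≠ 0 := by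
  intro h
  have hv : ∀ e b, G.head (e, b) ≠ v := fun e b hc => (G.degree_pos_of_head (e, b)).ne' (hc ▸ h)
  have hS : ∀ e, {t : unitInterval | G.edgePoint e t ∈ ({.vertex v} : Set G.Point)} = ∅ := by
    intro e
    ext t
    simp only [mem_singleton_iff, mem_ofPred_eq, mem_empty_iff_false, iff_false]
    change G.chart (e, t) ≠ _
    rcases eq_endOf_or_interior (e, t) with ⟨b, hb⟩ | hi
    · rw [hb, chart_endOf]
      simpa using hv e b
    · rw [chart_interior _ hi]; simp
  have hc : IsClopen ({.vertex v} : Set G.Point) :=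
    ⟨G.isClosed_point_iff.2 fun e => by rw [hS]; exact isClosed_empty,
      G.isOpen_point_iff.2 fun e => by rw [hS]; exact isOpen_empty⟩
  have huniv := hc.eq_univ (singleton_nonempty _)
  obtain ⟨w, hw⟩ := hb
  have : (.vertex w : G.Point) ∈ ({.vertex v} : Set G.Point) := huniv ▸ mem_univ _
  simp only [mem_singleton_iff, Point.vertex.injEq] at this
  subst this
  have : 3 ≤ G.degree w := hw
  omega

theorem isFree_or_isBranched [Finite E] (hdeg : ∀ v, G.degree v ≠ 2) (o : G.OrientedEdge) :
    G.IsFree (G.head o) ∨ G.IsBranched (G.head o) := by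
  have := G.degree_pos_of_head o
  have := hdeg (G.head o)
  unfold IsFree IsBranched
  omega

/-- The other end of a free edge is branched. -/
theorem IsFree.isBranched_flip [Finite E] [ConnectedSpace G.Point] (hdeg : ∀ v, G.degree v ≠ 2)
    (hb : ∃ v, G.IsBranched v) {e : E} {b : Bool} (h : G.IsFree (G.head (e, b))) :
    G.IsBranched (G.head (e, !b)) := by
  refine (isFree_or_isBranched hdeg (e, !b)).resolve_left fun h' => ?_
  -- With both ends free, no other edge meets `e`; the closed edge is clopen and therefore
  -- everything, although it contains no branched vertex.
  have hend : ∀ b', G.IsFree (G.head (e, b')) := by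
    intro b'
    cases b <;> cases b' <;> assumption
  have hS : ∀ e', {t : unitInterval | G.edgePoint e' t ∈ G.chart '' {p | p.1 = e}} =
      {t | e' = e} := by
    intro e'
    ext t
    simp only [mem_ofPred_eq]
    constructor
    · rintro ⟨p, hp, hpt⟩
      rcases G.chart_eq_chart (p' := (e', t)) hpt with h | ⟨o, o', rfl, h2, h3⟩
      · rw [← show p.1 = e from hp, h]
      · obtain ⟨e1, b1⟩ := o
        have : e1 = e := hp
        subst this
        have h4 := (hend b1).eq_of_head rfl h3.symm
        rw [← h4] at h2
        exact congrArg Prod.fst h2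
    · intro h
      exact ⟨(e', t), h, rfl⟩
  have hc : IsClopen (G.chart '' {p | p.1 = e}) :=
    ⟨G.isClosed_point_iff.2 fun e => by rw [hS]; exact isClosed_const,
      G.isOpen_point_iff.2 fun e => by rw [hS]; exact isOpen_const⟩
  have huniv := hc.eq_univ ⟨_, (e, 0), rfl, rfl⟩
  obtain ⟨w, hw⟩ := hb
  obtain ⟨p, hp, hpw⟩ : (.vertex w : G.Point) ∈ G.chart '' {p | p.1 = e} := huniv ▸ mem_univ _
  rcases eq_endOf_or_interior p with ⟨b', hb'⟩ | hi
  · rw [hb', chart_endOf, show p.1 = e from hp] at hpw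
    simp only [Point.vertex.injEq] at hpw
    exact (hend b').not_isBranched (hpw ▸ hw)
  · rw [chart_interior _ hi] at hpw; cases hpw

/-- A loop contributes two oriented edges to the degree of its vertex, so it has no free end. -/
theorem IsFree.head_flip_ne {e : E} {b : Bool} (h : G.IsFree (G.head (e, b))) :
    G.head (e, !b) ≠ G.head (e, b) := by
  intro hc
  have := h.eq_of_head rfl hc
  simp at this

end CellGraph

/-! ### Arrangements of tokens with prescribed end gaps -/

namespace CellGraph

/-- The distance of a point of an edge from the end `1` (for `true`) or `0` (for `false`). -/
def edist (b : Bool) (t : unitInterval) : unitInterval := if b then unitInterval.symm t else t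

theorem continuous_edist (b : Bool) : Continuous (edist b) := by
  cases b
  · exact continuous_id
  · exact unitInterval.continuous_symm

theorem coe_edist_not (b : Bool) (t : unitInterval) : (edist (!b) t : ℝ) = 1 - edist b t := by
  cases b <;> simp [edist]

theorem edist_injective (b : Bool) : Function.Injective (edist b) := by
  cases b
  · exact fun _ _ h => h
  · exact unitInterval.symm_bijective.injective

theorem edist_endOf {E : Type*} (o : E × Bool) : edist o.2 (endOf o).2 = 0 := by
  obtain ⟨e, b⟩ := o
  cases b <;> simp [edist, endOf]

theorem edist_not_endOf {E : Type*} (e : E) (b : Bool) : edist (!b) (endOf (e, b)).2 = 1 := by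
  cases b <;> simp [edist, endOf]

theorem eq_endOf_of_edist {E : Type*} {o : E × Bool} {p : E × unitInterval} (h1 : p.1 = o.1)
    (h2 : edist o.2 p.2 = 0) : p = endOf o :=
  Prod.ext h1 (edist_injective o.2 (h2.trans (edist_endOf o).symm))

/-- A distribution of tokens to edges, together with their order along each edge. -/
@[ext] structure Arr (E : Type*) (n : ℕ) where
  edge : Fin n → E
  count : E → ℕ
  rank : Fin n → ℕ
  rank_lt : ∀ i, rank i < count (edge i)
  rank_inj : ∀ i j, edge i = edge j → rank i = rank j → i = j
  rank_surj : ∀ e k, k < count e → ∃ i, edge i = e ∧ rank i = k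

variable {V E : Type*} {G : CellGraph V E} {n : ℕ}

/-- Admissible sizes of the gaps at the ends of the edges. -/
structure IsGap (G : CellGraph V E) (A : Arr E n) (γ : G.OrientedEdge → ℝ) : Prop where
  nonneg : ∀ o, 0 ≤ γ o
  le_one : ∀ o, γ o ≤ 1
  branched : ∀ o, γ o < 1 → G.IsBranched (G.head o)
  unique : ∀ o o', γ o < 1 → γ o' < 1 → G.head o = G.head o' → o = o'
  count_pos : ∀ o, γ o < 1 → 0 < A.count o.1
  two_le : ∀ e, γ (e, false) < 1 → γ (e, true) < 1 → 2 ≤ A.count e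

namespace Arr

variable (A : Arr E n)

/-- The rank of a token, counted from the indicated end of its edge. -/
def rankFrom (b : Bool) (i : Fin n) : ℕ :=
  if b then A.count (A.edge i) - 1 - A.rank i else A.rank i

theorem rankFrom_not (b : Bool) (i : Fin n) :
    A.rankFrom (!b) i + A.rankFrom b i + 1 = A.count (A.edge i) := by
  have := A.rank_lt i
  cases b <;> simp [rankFrom] <;> omega

theorem rankFrom_inj (b : Bool) {i j : Fin n} (h : A.edge i = A.edge j)
    (h' : A.rankFrom b i = A.rankFrom b j) : i = j := by
  refine A.rank_inj i j h ?_
  have h1 := A.rank_lt i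
  have h2 := A.rank_lt j
  cases b <;> simp only [rankFrom, if_true, Bool.false_eq_true, if_false] at h'
  · exact h'
  · rw [h] at h' h1
    omega

theorem rankFrom_surj (b : Bool) {e : E} {k : ℕ} (h : k < A.count e) :
    ∃ i, A.edge i = e ∧ A.rankFrom b i = k := by
  cases b
  · exact A.rank_surj e k h
  · obtain ⟨i, rfl, hi⟩ := A.rank_surj e (A.count e - 1 - k) (by omega)
    refine ⟨i, rfl, ?_⟩
    simp only [rankFrom, if_true]
    omega

/-- The length of an edge in units of the spacing of its tokens. -/
def total (γ : E × Bool → ℝ) (e : E) : ℝ := γ (e, false) + γ (e, true) + A.count e - 1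

/-- Evenly spaced tokens, except for the prescribed gaps at the ends of the edges. -/
noncomputable def place (γ : E × Bool → ℝ) (i : Fin n) : E × unitInterval :=
  (A.edge i, projIcc 0 1 zero_le_one ((γ (A.edge i, false) + A.rank i) / A.total γ (A.edge i)))

@[simp] theorem place_fst (γ : E × Bool → ℝ) (i : Fin n) : (A.place γ i).1 = A.edge i := rfl

end Arr

namespace IsGap

variable {A : Arr E n} {γ : G.OrientedEdge → ℝ}

/-- Each gap below `1` is paid for by a token on the edge, and two such gaps by two different
tokens. -/
theorem one_le_total (h : IsGap G A γ) (e : E) : 1 ≤ A.total γ e := by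
  have h1 := h.nonneg (e, false)
  have h2 := h.nonneg (e, true)
  unfold Arr.total
  rcases (h.le_one (e, false)).lt_or_eq with h3 | h3
  · rcases (h.le_one (e, true)).lt_or_eq with h4 | h4
    · have : (2 : ℝ) ≤ A.count e := by exact_mod_cast h.two_le e h3 h4
      linarith
    · have : (1 : ℝ) ≤ A.count e := by exact_mod_cast h.count_pos _ h3
      linarith
  · rcases (h.le_one (e, true)).lt_or_eq with h4 | h4
    · have : (1 : ℝ) ≤ A.count e := by exact_mod_cast h.count_pos _ h4
      linarith
    · have : (0 : ℝ) ≤ A.count e := Nat.cast_nonneg _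
      linarith

theorem total_pos (h : IsGap G A γ) (e : E) : 0 < A.total γ e :=
  zero_lt_one.trans_le (h.one_le_total e)

/-- Admissible gaps put the quotient into `[0,1]`, so the projection in `place` is inactive and the
formula is symmetric in the two ends. -/
theorem edist_place (h : IsGap G A γ) (b : Bool) (i : Fin n) :
    (edist b (A.place γ i).2 : ℝ) =
      (γ (A.edge i, b) + A.rankFrom b i) / A.total γ (A.edge i) := by
  have hU := h.total_pos (A.edge i)
  have h1 := h.nonneg (A.edge i, false)
  have h2 := h.nonneg (A.edge i, true)
  have h3 : ((A.rankFrom true i : ℕ) : ℝ) + A.rank i + 1 = A.count (A.edge i) := by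
    exact_mod_cast A.rankFrom_not false i
  have h4 : (0 : ℝ) ≤ A.rankFrom true i := Nat.cast_nonneg _
  have h5 : (γ (A.edge i, false) + A.rank i) / A.total γ (A.edge i) ∈ Icc (0 : ℝ) 1 := by
    refine ⟨by positivity, (div_le_one hU).2 ?_⟩
    unfold Arr.total
    linarith
  have h6 : ((A.place γ i).2 : ℝ) =
      (γ (A.edge i, false) + A.rank i) / A.total γ (A.edge i) := by
    rw [Arr.place, projIcc_of_mem _ h5]
  cases b
  · exact h6
  · simp only [edist, if_true, unitInterval.coe_symm_eq, h6]
    rw [eq_div_iff hU.ne', sub_mul, div_mul_cancel₀ _ hU.ne', Arr.total]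
    linarith

theorem edist_place_lt (h : IsGap G A γ) (b : Bool) {i j : Fin n} (hij : A.edge i = A.edge j) :
    edist b (A.place γ i).2 < edist b (A.place γ j).2 ↔ A.rankFrom b i < A.rankFrom b j := by
  rw [← Subtype.coe_lt_coe, h.edist_place, h.edist_place, hij,
    div_lt_div_iff_of_pos_right (h.total_pos _)]
  simp

theorem place_eq_endOf (h : IsGap G A γ) {i : Fin n} {o : E × Bool} (hi : A.place γ i = endOf o) :
    A.edge i = o.1 ∧ γ o = 0 ∧ A.rankFrom o.2 i = 0 := by
  have h0 : A.edge i = o.1 := congrArg Prod.fst hi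
  have h1 := h.edist_place o.2 i
  rw [hi, edist_endOf, h0] at h1
  have h2 := h.total_pos o.1
  have h3 := h.nonneg o
  have h4 : (0 : ℝ) ≤ A.rankFrom o.2 i := Nat.cast_nonneg _
  have h5 : γ (o.1, o.2) + A.rankFrom o.2 i = 0 := by
    rcases div_eq_zero_iff.1 h1.symm with h | h
    · exact h
    · exact absurd h h2.ne'
  have h6 : γ (o.1, o.2) = 0 := by linarith [h.nonneg (o.1, o.2)]
  refine ⟨h0, h6, ?_⟩
  rw [h6, zero_add] at h5
  exact_mod_cast h5

/-- On one edge the ranks separate tokens. Two tokens at one vertex would both have gap `0`, so they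
would be at the same end by uniqueness of the short gap, both with rank `0`. -/
theorem chart_place_injective (h : IsGap G A γ) : Function.Injective (G.chart ∘ A.place γ) := by
  intro i j hij
  rcases G.chart_eq_chart hij with hp | ⟨o, o', hi, hj, ho⟩
  · have he : A.edge i = A.edge j := congrArg Prod.fst hp
    refine A.rank_inj i j he ?_
    have h1 := h.edist_place_lt false he
    have h2 := h.edist_place_lt false he.symm
    rw [hp] at h1 h2
    simp only [lt_irrefl, false_iff, not_lt] at h1 h2
    exact le_antisymm h2 h1
  · obtain ⟨h1, h2, h3⟩ := h.place_eq_endOf hi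
    obtain ⟨h4, h5, h6⟩ := h.place_eq_endOf hj
    have := h.unique o o' (by linarith) (by linarith) ho
    subst this
    exact A.rankFrom_inj o.2 (h1.trans h4.symm) (h3.trans h6.symm)

/-- The lifted configuration with given arrangement and gaps. -/
noncomputable def lift (h : IsGap G A γ) : G.Lift n := ⟨A.place γ, h.chart_place_injective⟩

end IsGap

/-! ### The arrangement and the end gaps of a lifted configuration -/

namespace Lift

variable (z : G.Lift n)

theorem eq_of_fst_snd {i j : Fin n} (h : (z.1 i).1 = (z.1 j).1) (h' : (z.1 i).2 = (z.1 j).2) :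
    i = j := z.2 (congrArg G.chart (Prod.ext h h'))

open Classical in
/-- The number of tokens on an edge. -/
noncomputable def tokenCount (e : E) : ℕ := (Finset.univ.filter fun j => (z.1 j).1 = e).card

open Classical in
/-- The number of tokens on the same edge with a smaller coordinate. -/
noncomputable def tokenRank (i : Fin n) : ℕ :=
  (Finset.univ.filter fun j => (z.1 j).1 = (z.1 i).1 ∧ (z.1 j).2 < (z.1 i).2).card

theorem tokenRank_lt_tokenCount (i : Fin n) : z.tokenRank i < z.tokenCount (z.1 i).1 := by
  classical
  refine Finset.card_lt_card ⟨fun j => ?_, fun hs => ?_⟩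
  · simp only [Finset.mem_filter]
    tauto
  · have := hs (show i ∈ _ by simp)
    simp at this

theorem tokenRank_lt_of_lt {i j : Fin n} (hij : (z.1 i).1 = (z.1 j).1)
    (h : (z.1 i).2 < (z.1 j).2) : z.tokenRank i < z.tokenRank j := by
  classical
  refine Finset.card_lt_card ⟨fun k => ?_, fun hs => ?_⟩
  · simp only [Finset.mem_filter, hij]
    exact fun hk => ⟨hk.1, hk.2.1, hk.2.2.trans h⟩
  · have := hs (show i ∈ _ by simp [hij, h])
    simp at this

theorem tokenRank_inj {i j : Fin n} (hij : (z.1 i).1 = (z.1 j).1)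
    (h : z.tokenRank i = z.tokenRank j) : i = j := by
  rcases lt_trichotomy (z.1 i).2 (z.1 j).2 with h' | h' | h'
  · exact absurd h (z.tokenRank_lt_of_lt hij h').ne
  · exact z.eq_of_fst_snd hij h'
  · exact absurd h (z.tokenRank_lt_of_lt hij.symm h').ne'

/-- Pigeonhole: ranks are injective on the tokens of `e` and bounded by their number, hence fill the
whole range. -/
theorem exists_tokenRank_eq {e : E} {k : ℕ} (hk : k < z.tokenCount e) :
    ∃ i, (z.1 i).1 = e ∧ z.tokenRank i = k := by
  classical
  have h : (Finset.univ.filter fun j => (z.1 j).1 = e).image z.tokenRank =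
      Finset.range (z.tokenCount e) := by
    refine Finset.eq_of_subset_of_card_le (fun k hk => ?_) ?_
    · obtain ⟨i, hi, rfl⟩ := Finset.mem_image.1 hk
      rw [Finset.mem_filter] at hi
      exact Finset.mem_range.2 (hi.2 ▸ z.tokenRank_lt_tokenCount i)
    · rw [Finset.card_range, Finset.card_image_of_injOn]
      · exact le_rfl
      · intro i hi j hj hij
        simp only [Finset.coe_filter, Finset.mem_univ, true_and, mem_ofPred_eq] at hi hj
        exact z.tokenRank_inj (hi.trans hj.symm) hij
  obtain ⟨i, hi, hik⟩ := Finset.mem_image.1 (h ▸ Finset.mem_range.2 hk)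
  exact ⟨i, (Finset.mem_filter.1 hi).2, hik⟩

/-- The combinatorial arrangement of a lifted configuration. -/
noncomputable def arr : Arr E n where
  edge i := (z.1 i).1
  count := z.tokenCount
  rank := z.tokenRank
  rank_lt := z.tokenRank_lt_tokenCount
  rank_inj _ _ := z.tokenRank_inj
  rank_surj _ _ := z.exists_tokenRank_eq

theorem arr_edge (i : Fin n) : z.arr.edge i = (z.1 i).1 := rfl

theorem rank_lt_iff {i j : Fin n} (hij : (z.1 i).1 = (z.1 j).1) :
    z.arr.rank i < z.arr.rank j ↔ (z.1 i).2 < (z.1 j).2 := by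
  refine ⟨fun h => ?_, z.tokenRank_lt_of_lt hij⟩
  by_contra hc
  rcases (not_lt.1 hc).lt_or_eq with h' | h'
  · exact absurd h (z.tokenRank_lt_of_lt hij.symm h').not_gt
  · rw [z.eq_of_fst_snd hij h'.symm] at h
    exact lt_irrefl _ h

open Classical in
/-- The distance from the head of `o` to the next token on the edge behind the token `i`, or `1`. -/
noncomputable def next (o : G.OrientedEdge) (i : Fin n) : unitInterval :=
  Finset.univ.inf fun j => if (z.1 j).1 = (z.1 i).1 ∧
    edist o.2 (z.1 i).2 < edist o.2 (z.1 j).2 then edist o.2 (z.1 j).2 else 1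

/-- The distance of the token `i` from the head of `o` relative to the gap behind it, truncated. -/
noncomputable def ratio (o : G.OrientedEdge) (i : Fin n) : ℝ :=
  edist o.2 (z.1 i).2 / max (edist o.2 (z.1 i).2 : ℝ) (z.next o i - edist o.2 (z.1 i).2)

open Classical in
/-- A measure of how close the tokens on `o` are to the head of `o`: `0` if a token is there. -/
noncomputable def depth (o : G.OrientedEdge) : ℝ :=
  ∏ i, if (z.1 i).1 = o.1 then z.ratio o i else 1

open Classical in
/-- A measure of how close the tokens on the other oriented edges with the same head are. -/
noncomputable def others [Fintype E] (o : G.OrientedEdge) : ℝ :=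
  ∏ o', if G.head o' = G.head o ∧ o' ≠ o then z.depth o' else 1

open Classical in
/-- The gap that is left between the head of `o` and the nearest token on `o`, in units of the
spacing on that edge, when the configuration is retracted to the cube complex. -/
noncomputable def gap [Fintype E] (o : G.OrientedEdge) : ℝ :=
  if G.IsBranched (G.head o) then z.depth o / max (z.depth o) (z.others o) else 1

theorem next_le {o : G.OrientedEdge} {i j : Fin n} (h : (z.1 j).1 = (z.1 i).1)
    (h' : edist o.2 (z.1 i).2 < edist o.2 (z.1 j).2) : z.next o i ≤ edist o.2 (z.1 j).2 := by
  refine (Finset.inf_le (Finset.mem_univ j)).trans ?_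
  simp [h, h']

theorem le_next {o : G.OrientedEdge} {i : Fin n} {t : unitInterval}
    (h : ∀ j, (z.1 j).1 = (z.1 i).1 → edist o.2 (z.1 i).2 < edist o.2 (z.1 j).2 →
      t ≤ edist o.2 (z.1 j).2) : t ≤ z.next o i := by
  refine Finset.le_inf fun j _ => ?_
  split_ifs with hj
  · exact h j hj.1 hj.2
  · exact unitInterval.le_one'

theorem ratio_nonneg (o : G.OrientedEdge) (i : Fin n) : 0 ≤ z.ratio o i :=
  div_nonneg (edist o.2 (z.1 i).2).2.1 (le_max_of_le_left (edist o.2 (z.1 i).2).2.1)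

theorem ratio_le_one (o : G.OrientedEdge) (i : Fin n) : z.ratio o i ≤ 1 :=
  div_le_one_of_le₀ (le_max_left _ _) (le_max_of_le_left (edist o.2 (z.1 i).2).2.1)

theorem ratio_eq_zero_iff (o : G.OrientedEdge) (i : Fin n) :
    z.ratio o i = 0 ↔ edist o.2 (z.1 i).2 = 0 := by
  constructor
  · intro h
    by_contra hc
    have h0 : (0 : ℝ) < edist o.2 (z.1 i).2 := by
      exact_mod_cast unitInterval.pos_iff_ne_zero.2 hc
    exact (div_pos h0 (lt_max_of_lt_left h0)).ne' h
  · intro h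
    simp [ratio, h]

theorem depth_nonneg (o : G.OrientedEdge) : 0 ≤ z.depth o := by
  refine Finset.prod_nonneg fun i _ => ?_
  split_ifs
  · exact z.ratio_nonneg o i
  · exact zero_le_one

theorem depth_le_one (o : G.OrientedEdge) : z.depth o ≤ 1 := by
  refine Finset.prod_le_one (fun i _ => ?_) fun i _ => ?_ <;> split_ifs
  · exact z.ratio_nonneg o i
  · exact zero_le_one
  · exact z.ratio_le_one o i
  · exact le_rfl

theorem depth_eq_zero_iff (o : G.OrientedEdge) : z.depth o = 0 ↔ ∃ i, z.1 i = endOf o := by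
  classical
  rw [depth, Finset.prod_eq_zero_iff]
  constructor
  · rintro ⟨i, -, hi⟩
    split_ifs at hi with h
    · exact ⟨i, eq_endOf_of_edist h ((z.ratio_eq_zero_iff o i).1 hi)⟩
    · exact absurd hi one_ne_zero
  · rintro ⟨i, hi⟩
    refine ⟨i, Finset.mem_univ _, ?_⟩
    rw [if_pos (by rw [hi, endOf_fst]), ratio_eq_zero_iff, hi, edist_endOf]

theorem exists_ratio_lt {o : G.OrientedEdge} (h : z.depth o < 1) :
    ∃ i, (z.1 i).1 = o.1 ∧ z.ratio o i < 1 := by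
  by_contra! hc
  refine h.ne (Finset.prod_eq_one fun i _ => ?_)
  split_ifs with hi
  · exact le_antisymm (z.ratio_le_one o i) (hc i hi)
  · rfl

theorem lt_next {o : G.OrientedEdge} {i : Fin n} (h : edist o.2 (z.1 i).2 < 1) :
    edist o.2 (z.1 i).2 < z.next o i := by
  classical
  refine (Finset.lt_inf_iff h).2 fun j _ => ?_
  split_ifs with hj
  · exact hj.2
  · exact h

theorem lt_next_sub {o : G.OrientedEdge} {i : Fin n} (h : z.ratio o i < 1) :
    (edist o.2 (z.1 i).2 : ℝ) < z.next o i - edist o.2 (z.1 i).2 := by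
  by_contra! hc
  -- For a token at the head itself the quotient cannot be evaluated as `1`; there the positivity of
  -- `next` gives the contradiction.
  rcases eq_or_ne (edist o.2 (z.1 i).2) 0 with h0 | h0
  · have h1 := z.lt_next (o := o) (i := i) (h0 ▸ zero_lt_one)
    rw [h0] at hc h1
    have h2 : (0 : ℝ) < z.next o i := h1
    simp only [Icc.coe_zero] at hc
    linarith
  · refine h.ne ?_
    rw [ratio, max_eq_left hc, div_self]
    exact fun h => h0 (Subtype.ext h)

/-- Two tokens cannot be at the same vertex. -/
theorem eq_of_endOf {i j : Fin n} {o o' : G.OrientedEdge} (hi : z.1 i = endOf o)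
    (hj : z.1 j = endOf o') (h : G.head o = G.head o') : i = j ∧ o = o' := by
  have : i = j := z.2 (by simp [hi, hj, chart_endOf, h])
  subst this
  exact ⟨rfl, endOf_injective (hi.symm.trans hj)⟩

theorem next_eq_one {o : G.OrientedEdge} {i : Fin n}
    (h : ∀ j, (z.1 j).1 = (z.1 i).1 → edist o.2 (z.1 j).2 ≤ edist o.2 (z.1 i).2) : z.next o i = 1 :=
  le_antisymm unitInterval.le_one' (z.le_next fun j h1 h2 => absurd h2 (not_lt.2 (h j h1)))

section Fintype

variable [Fintype E]

theorem others_nonneg (o : G.OrientedEdge) : 0 ≤ z.others o := by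
  refine Finset.prod_nonneg fun i _ => ?_
  split_ifs
  · exact z.depth_nonneg i
  · exact zero_le_one

theorem others_le_one (o : G.OrientedEdge) : z.others o ≤ 1 := by
  refine Finset.prod_le_one (fun i _ => ?_) fun i _ => ?_ <;> split_ifs
  · exact z.depth_nonneg i
  · exact zero_le_one
  · exact z.depth_le_one i
  · exact le_rfl

/-- A product of factors in `[0,1]` is bounded by each factor. This lets two ends at a vertex
compete for the short gap. -/
theorem others_le_depth {o o' : G.OrientedEdge} (h : G.head o' = G.head o) (h' : o' ≠ o) :
    z.others o ≤ z.depth o' := by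
  classical
  rw [others, ← Finset.mul_prod_erase _ _ (Finset.mem_univ o'), if_pos ⟨h, h'⟩]
  refine mul_le_of_le_one_right (z.depth_nonneg o') ?_
  refine Finset.prod_le_one (fun i _ => ?_) fun i _ => ?_ <;> split_ifs
  · exact z.depth_nonneg i
  · exact zero_le_one
  · exact z.depth_le_one i
  · exact le_rfl

theorem others_eq_zero_iff (o : G.OrientedEdge) :
    z.others o = 0 ↔ ∃ o', G.head o' = G.head o ∧ o' ≠ o ∧ ∃ i, z.1 i = endOf o' := by
  classical
  rw [others, Finset.prod_eq_zero_iff]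
  constructor
  · rintro ⟨o', -, h⟩
    split_ifs at h with h'
    · exact ⟨o', h'.1, h'.2, (z.depth_eq_zero_iff o').1 h⟩
    · exact absurd h one_ne_zero
  · rintro ⟨o', h1, h2, h3⟩
    exact ⟨o', Finset.mem_univ _, by rw [if_pos ⟨h1, h2⟩, (z.depth_eq_zero_iff o').2 h3]⟩

/-- If both numbers vanished, two different ends at one vertex would be occupied. The denominator of
the gap is therefore never zero. -/
theorem max_pos (o : G.OrientedEdge) : 0 < max (z.depth o) (z.others o) := by
  by_contra! hc
  have h1 : z.depth o = 0 := le_antisymm ((le_max_left _ _).trans hc) (z.depth_nonneg o)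
  have h2 : z.others o = 0 := le_antisymm ((le_max_right _ _).trans hc) (z.others_nonneg o)
  obtain ⟨i, hi⟩ := (z.depth_eq_zero_iff o).1 h1
  obtain ⟨o', h3, h4, j, hj⟩ := (z.others_eq_zero_iff o).1 h2
  exact h4 (z.eq_of_endOf hj hi h3).2

theorem gap_nonneg (o : G.OrientedEdge) : 0 ≤ z.gap o := by
  unfold gap
  split_ifs
  · exact div_nonneg (z.depth_nonneg o) (z.max_pos o).le
  · exact zero_le_one

theorem gap_le_one (o : G.OrientedEdge) : z.gap o ≤ 1 := by
  unfold gap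
  split_ifs
  · exact (div_le_one (z.max_pos o)).2 (le_max_left _ _)
  · exact le_rfl

theorem gap_lt_one {o : G.OrientedEdge} (h : z.gap o < 1) :
    G.IsBranched (G.head o) ∧ z.depth o < z.others o := by
  unfold gap at h
  split_ifs at h with hb
  · refine ⟨hb, ?_⟩
    by_contra! hc
    have := z.max_pos o
    rw [max_eq_left hc] at h this
    exact h.ne (div_self this.ne')
  · exact absurd h (lt_irrefl _)

theorem gap_eq_zero_iff {o : G.OrientedEdge} (hb : G.IsBranched (G.head o)) :
    z.gap o = 0 ↔ ∃ i, z.1 i = endOf o := by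
  rw [gap, if_pos hb, div_eq_zero_iff, or_iff_left (z.max_pos o).ne', depth_eq_zero_iff]

/-- Short gaps at two ends `o`, `o'` of a vertex would give the cycle `depth o < others o ≤ depth o'
< others o' ≤ depth o`. -/
theorem isGap_gap : IsGap G z.arr z.gap where
  nonneg := z.gap_nonneg
  le_one := z.gap_le_one
  branched o h := (z.gap_lt_one h).1
  unique o o' h h' ho := by
    by_contra hne
    have h1 := (z.gap_lt_one h).2.trans_le (z.others_le_depth ho.symm (Ne.symm hne))
    have h2 := (z.gap_lt_one h').2.trans_le (z.others_le_depth ho hne)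
    exact lt_asymm h1 h2
  count_pos o h := by
    obtain ⟨i, hi, -⟩ := z.exists_ratio_lt ((z.gap_lt_one h).2.trans_le (z.others_le_one o))
    have := z.arr.rank_lt i
    rw [arr_edge, hi] at this
    omega
  two_le e h h' := by
    obtain ⟨i, hi, hri⟩ := z.exists_ratio_lt ((z.gap_lt_one h).2.trans_le (z.others_le_one _))
    obtain ⟨j, hj, hrj⟩ := z.exists_ratio_lt ((z.gap_lt_one h').2.trans_le (z.others_le_one _))
    simp only at hi hj
    by_contra hc
    have huniq : ∀ k, (z.1 k).1 = e → k = i := by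
      intro k hk
      have h1 := z.arr.rank_lt k
      have h2 := z.arr.rank_lt i
      refine z.arr.rank_inj k i (hk.trans hi.symm) ?_
      rw [arr_edge, hk] at h1
      rw [arr_edge, hi] at h2
      omega
    have := huniq j hj
    subst this
    -- A single token on the edge would have to be closer to each end than to the other one.
    have h1 := z.lt_next_sub hri
    have h2 := z.lt_next_sub hrj
    rw [z.next_eq_one fun k hk => by rw [huniq k (hk.trans hj)]] at h1 h2
    simp [edist] at h1 h2
    linarith

/-- The retraction to the cube complex, in coordinates. -/
noncomputable def spread : G.Lift n := z.isGap_gap.lift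

theorem spread_fst (i : Fin n) : (z.spread.1 i).1 = (z.1 i).1 := rfl

theorem spread_lt_iff {i j : Fin n} (hij : (z.1 i).1 = (z.1 j).1) :
    (z.spread.1 i).2 < (z.spread.1 j).2 ↔ (z.1 i).2 < (z.1 j).2 :=
  (z.isGap_gap.edist_place_lt false hij).trans (z.rank_lt_iff hij)

end Fintype

end Lift

end CellGraph

/-! ### Recovering the gaps: evenly spaced lifts are fixed by `spread` -/

namespace CellGraph

variable {V E : Type*} {G : CellGraph V E} {n : ℕ}

namespace IsGap

variable {A : Arr E n} {γ : G.OrientedEdge → ℝ}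

theorem arr_lift (h : IsGap G A γ) : h.lift.arr = A := by
  classical
  refine Arr.ext rfl (funext fun e => ?_) (funext fun i => ?_)
  · change h.lift.tokenCount e = _
    rw [← Finset.card_range (A.count e), Lift.tokenCount]
    refine Finset.card_bij (fun i _ => A.rank i) (fun i hi => ?_) (fun i hi j hj hij => ?_)
      fun k hk => ?_
    · have hi : A.edge i = e := (Finset.mem_filter.1 hi).2
      exact Finset.mem_range.2 (hi ▸ A.rank_lt i)
    · have hi : A.edge i = e := (Finset.mem_filter.1 hi).2
      have hj : A.edge j = e := (Finset.mem_filter.1 hj).2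
      exact A.rank_inj i j (hi.trans hj.symm) hij
    · obtain ⟨i, hi, hik⟩ := A.rank_surj e k (Finset.mem_range.1 hk)
      exact ⟨i, Finset.mem_filter.2 ⟨Finset.mem_univ _, hi⟩, hik⟩
  · have key : ∀ j, j ∈ (Finset.univ.filter fun j => (h.lift.1 j).1 = (h.lift.1 i).1 ∧
        (h.lift.1 j).2 < (h.lift.1 i).2) ↔ A.edge j = A.edge i ∧ A.rank j < A.rank i := by
      intro j
      rw [Finset.mem_filter]
      refine (and_iff_right (Finset.mem_univ _)).trans (and_congr_right fun he => ?_)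
      exact h.edist_place_lt false he
    change h.lift.tokenRank i = _
    rw [← Finset.card_range (A.rank i), Lift.tokenRank]
    refine Finset.card_bij (fun i _ => A.rank i) (fun j hj => ?_) (fun j hj k hk hjk => ?_)
      fun k hk => ?_
    · exact Finset.mem_range.2 ((key j).1 hj).2
    · exact A.rank_inj j k (((key j).1 hj).1.trans ((key k).1 hk).1.symm) hjk
    · have hk := Finset.mem_range.1 hk
      obtain ⟨j, hj, rfl⟩ := A.rank_surj (A.edge i) k (hk.trans (A.rank_lt i))
      exact ⟨j, (key j).2 ⟨hj, hk⟩, rfl⟩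

theorem edist_lift (h : IsGap G A γ) (b : Bool) (i : Fin n) :
    (edist b (h.lift.1 i).2 : ℝ) =
      (γ (A.edge i, b) + A.rankFrom b i) / A.total γ (A.edge i) := h.edist_place b i

/-- A token that is not the first one is at least one unit away from the head, while the gap behind
it is at most one unit, so the truncation applies. -/
theorem ratio_lift_of_ne (h : IsGap G A γ) {o : G.OrientedEdge} {i : Fin n} (hi : A.edge i = o.1)
    (hr : A.rankFrom o.2 i ≠ 0) : h.lift.ratio o i = 1 := by
  obtain ⟨e, b⟩ := o
  obtain rfl : A.edge i = e := hi
  have hU := h.total_pos (A.edge i)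
  have hd := h.edist_lift b i
  have h1 : (1 : ℝ) ≤ A.rankFrom b i := by exact_mod_cast Nat.one_le_iff_ne_zero.2 hr
  have h2 := h.nonneg (A.edge i, b)
  have h3 : 1 / A.total γ (A.edge i) ≤ edist b (h.lift.1 i).2 := by
    rw [hd]; gcongr; linarith
  have h4 : (h.lift.next (A.edge i, b) i : ℝ) ≤ edist b (h.lift.1 i).2 + 1 / A.total γ (A.edge i) := by
    -- Behind the last token there is only the gap at the opposite end, which is at most one unit;
    -- `next` is bounded by `1` there.
    by_cases hl : A.rankFrom (!b) i = 0
    · have h5 := h.edist_lift (!b) i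
      rw [coe_edist_not, hl, Nat.cast_zero, add_zero] at h5
      have h6 : γ (A.edge i, !b) / A.total γ (A.edge i) ≤ 1 / A.total γ (A.edge i) := by
        gcongr; exact h.le_one _
      have h7 := (h.lift.next (A.edge i, b) i).2.2
      linarith
    · have h5 := A.rankFrom_not b i
      obtain ⟨j, hj, hjr⟩ := A.rankFrom_surj b (e := A.edge i) (k := A.rankFrom b i + 1) (by omega)
      have h6 := h.edist_lift b j
      rw [hj, hjr, Nat.cast_add_one, ← add_assoc, add_div, ← hd] at h6
      rw [← h6]
      refine h.lift.next_le (o := (A.edge i, b)) hj ((h.edist_place_lt b hj.symm).2 ?_)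
      omega
  have h8 : 0 < 1 / A.total γ (A.edge i) := by positivity
  have h9 : (h.lift.next (A.edge i, b) i : ℝ) - edist b (h.lift.1 i).2 ≤ edist b (h.lift.1 i).2 := by
    linarith
  rw [Lift.ratio]
  simp only
  rw [max_eq_left h9, div_self (by linarith)]

/-- The first token is `γ o` units from the head and normally has one unit behind it. If it is the
only token, the gap behind it is that at the opposite end, and `two_le` prevents both from being
short. -/
theorem ratio_lift_of_eq (h : IsGap G A γ) {o : G.OrientedEdge} {i : Fin n} (hi : A.edge i = o.1)
    (hr : A.rankFrom o.2 i = 0) : h.lift.ratio o i = γ o := by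
  obtain ⟨e, b⟩ := o
  obtain rfl : A.edge i = e := hi
  have hU := h.total_pos (A.edge i)
  have hd := h.edist_lift b i
  have h1 := h.le_one (A.edge i, b)
  have h2 := h.nonneg (A.edge i, b)
  have hn := A.rankFrom_not b i
  simp only at hr
  rw [hr, Nat.cast_zero, add_zero] at hd
  rw [hr] at hn
  rw [Lift.ratio]
  simp only
  by_cases hl : A.rankFrom (!b) i = 0
  · have h5 : h.lift.next (A.edge i, b) i = 1 := by
      refine h.lift.next_eq_one fun j hj => ?_
      have hj : A.edge j = A.edge i := hj
      have h6 := A.rankFrom_not b j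
      rw [hj, ← hn, hl] at h6
      rw [A.rankFrom_inj b hj (by omega)]
    have h6 := h.edist_lift (!b) i
    rw [coe_edist_not, hl, Nat.cast_zero, add_zero] at h6
    rw [h5, Icc.coe_one, h6, hd, max_div_div_right hU.le, div_div_div_cancel_right₀ hU.ne']
    have h7 := h.le_one (A.edge i, !b)
    rcases h1.lt_or_eq with h8 | h8
    · rcases h7.lt_or_eq with h9 | h9
      · have : 2 ≤ A.count (A.edge i) := by
          cases b
          · exact h.two_le _ h8 h9
          · exact h.two_le _ h9 h8
        omega
      · rw [h9, max_eq_right h1, div_one]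
    · rw [h8, max_eq_left h7, div_one]
  · obtain ⟨j, hj, hjr⟩ := A.rankFrom_surj b (e := A.edge i) (k := 1) (by omega)
    have h6 := h.edist_lift b j
    rw [hj, hjr] at h6
    have h7 : h.lift.next (A.edge i, b) i = edist b (h.lift.1 j).2 := by
      refine le_antisymm (h.lift.next_le (o := (A.edge i, b)) hj
        ((h.edist_place_lt b hj.symm).2 (by omega))) (h.lift.le_next fun k hk hk' => ?_)
      have hk : A.edge k = A.edge i := hk
      have h8 := (h.edist_place_lt b hk.symm).1 hk'
      by_contra! hc
      have h9 := (h.edist_place_lt b (hk.trans hj.symm)).1 hc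
      omega
    rw [h7, h6, hd, ← sub_div, add_sub_cancel_left, max_div_div_right hU.le,
      div_div_div_cancel_right₀ hU.ne', Nat.cast_one, max_eq_right h1, div_one]

/-- All factors except that of the first token are `1`; on an edge without tokens admissibility
forces a full gap. -/
theorem depth_lift (h : IsGap G A γ) (o : G.OrientedEdge) : h.lift.depth o = γ o := by
  classical
  by_cases h0 : A.count o.1 = 0
  · have h1 : γ o = 1 := by
      by_contra hc
      have := h.count_pos o (lt_of_le_of_ne (h.le_one o) hc)
      omega
    rw [h1]
    refine Finset.prod_eq_one fun i _ => if_neg fun hi => ?_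
    have hi : A.edge i = o.1 := hi
    have := A.rank_lt i
    rw [hi] at this
    omega
  · obtain ⟨i, hi, hir⟩ := A.rankFrom_surj o.2 (Nat.pos_of_ne_zero h0)
    rw [Lift.depth, Finset.prod_eq_single i]
    · rw [if_pos (show (h.lift.1 i).1 = o.1 from hi), h.ratio_lift_of_eq hi hir]
    · intro j _ hj
      split_ifs with hj'
      · have hj' : A.edge j = o.1 := hj'
        refine h.ratio_lift_of_ne hj' fun hr => hj ?_
        exact A.rankFrom_inj o.2 (hj'.trans hi.symm) (hr.trans hir.symm)
      · rfl
    · exact fun hc => absurd (Finset.mem_univ i) hc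

variable [Fintype E]

/-- If `γ o` is short, all competing ends have full gaps and `others` is `1`. If `γ o = 1`, the
maximum in the denominator is `1` in any case. -/
theorem gap_lift (h : IsGap G A γ) : h.lift.gap = γ := by
  funext o
  rcases (h.le_one o).lt_or_eq with h1 | h1
  · have h2 : h.lift.others o = 1 := by
      refine Finset.prod_eq_one fun o' _ => ?_
      split_ifs with h'
      · rw [h.depth_lift]
        by_contra hc
        exact h'.2 (h.unique o' o (lt_of_le_of_ne (h.le_one o') hc) h1 h'.1)
      · rfl
    rw [Lift.gap, if_pos (h.branched o h1), h2, h.depth_lift, max_eq_right h1.le, div_one]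
  · rw [h1, Lift.gap]
    split_ifs
    · rw [h.depth_lift, h1, max_eq_left (h.lift.others_le_one o), div_one]
    · rfl

theorem spread_lift (h : IsGap G A γ) : h.lift.spread = h.lift := by
  refine Subtype.ext ?_
  change h.lift.arr.place h.lift.gap = A.place γ
  rw [h.arr_lift, h.gap_lift]

end IsGap

namespace Lift

variable (z : G.Lift n)

theorem rankFrom_lt_iff (b : Bool) {i j : Fin n} (hij : (z.1 i).1 = (z.1 j).1) :
    z.arr.rankFrom b i < z.arr.rankFrom b j ↔ edist b (z.1 i).2 < edist b (z.1 j).2 := by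
  cases b
  · exact z.rank_lt_iff hij
  · have h1 := z.arr.rank_lt i
    have h2 := z.arr.rank_lt j
    rw [arr_edge] at h1 h2
    simp only [Arr.rankFrom, edist, if_true, unitInterval.symm_lt_symm, ← z.rank_lt_iff hij.symm]
    rw [arr_edge, arr_edge, hij]
    rw [hij] at h1
    omega

theorem rankFrom_eq_zero_of_endOf {i : Fin n} {o : G.OrientedEdge} (hi : z.1 i = endOf o) :
    z.arr.rankFrom o.2 i = 0 := by
  by_contra hc
  have h1 := z.arr.rankFrom_not o.2 i
  obtain ⟨j, hj, hjr⟩ := z.arr.rankFrom_surj o.2 (e := z.arr.edge i) (k := 0) (by omega)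
  have := (z.rankFrom_lt_iff o.2 hj).1 (by omega)
  rw [hi, edist_endOf] at this
  exact absurd this (not_lt.2 unitInterval.nonneg')

variable [Fintype E]

theorem edist_spread (b : Bool) (i : Fin n) : (edist b (z.spread.1 i).2 : ℝ) =
    (z.gap ((z.1 i).1, b) + z.arr.rankFrom b i) / z.arr.total z.gap (z.1 i).1 :=
  z.isGap_gap.edist_place b i

/-- Tokens at branched vertices are not moved. -/
theorem spread_eq_of_endOf {i : Fin n} {o : G.OrientedEdge} (hi : z.1 i = endOf o)
    (hb : G.IsBranched (G.head o)) : z.spread.1 i = z.1 i := by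
  rw [hi]
  refine eq_endOf_of_edist ?_ (Subtype.ext ?_)
  · rw [spread_fst, hi, endOf_fst]
  · have h1 := congrArg Prod.fst hi
    rw [edist_spread, z.rankFrom_eq_zero_of_endOf hi, h1, endOf_fst, Prod.mk.eta,
      (z.gap_eq_zero_iff hb).2 ⟨i, hi⟩]
    simp

/-- Only tokens at branched vertices end up at vertices. -/
theorem of_spread_eq_endOf {i : Fin n} {o : G.OrientedEdge} (hi : z.spread.1 i = endOf o) :
    G.IsBranched (G.head o) ∧ z.1 i = endOf o := by
  obtain ⟨h1, h2, h3⟩ := z.isGap_gap.place_eq_endOf hi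
  have hb : G.IsBranched (G.head o) := z.isGap_gap.branched o (by linarith)
  obtain ⟨j, hj⟩ := (z.gap_eq_zero_iff hb).1 h2
  have h4 := z.rankFrom_eq_zero_of_endOf hj
  have := z.arr.rankFrom_inj o.2 (i := i) (j := j)
    (h1.trans (congrArg Prod.fst hj).symm) (h3.trans h4.symm)
  exact ⟨hb, this ▸ hj⟩

end Lift

end CellGraph

/-! ### Continuity of `spread` -/

namespace CellGraph

variable {V E : Type*} {G : CellGraph V E} {n : ℕ}

theorem continuous_ite_of_isClopen {X Y : Type*} [TopologicalSpace X] [TopologicalSpace Y]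
    {p : X → Prop} [∀ x, Decidable (p x)] (hp : IsClopen {x | p x}) {f g : X → Y}
    (hf : Continuous f) (hg : Continuous g) : Continuous fun x => if p x then f x else g x :=
  Continuous.if (by simp [hp.frontier_eq]) hf hg

namespace Lift

section Continuity

variable [TopologicalSpace E]

theorem continuous_token (i : Fin n) : Continuous fun z : G.Lift n => z.1 i :=
  (continuous_apply i).comp continuous_subtype_val

theorem continuous_edist_token (b : Bool) (i : Fin n) :
    Continuous fun z : G.Lift n => edist b (z.1 i).2 :=
  (continuous_edist b).comp (continuous_snd.comp (continuous_token i))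

variable [DiscreteTopology E]

theorem isClopen_fst_eq (i : Fin n) (e : E) : IsClopen {z : G.Lift n | (z.1 i).1 = e} :=
  (isClopen_discrete {e}).preimage (continuous_fst.comp (continuous_token i))

theorem isClopen_fst_eq_fst (i j : Fin n) : IsClopen {z : G.Lift n | (z.1 i).1 = (z.1 j).1} :=
  (isClopen_discrete {p : E × E | p.1 = p.2}).preimage
    ((continuous_fst.comp (continuous_token i)).prodMk (continuous_fst.comp (continuous_token j)))

/-- Tokens on one edge never coincide, so the strict and the weak inequality agree there: the order
of the tokens is locally constant. -/
theorem isClopen_edist_lt (b : Bool) (i j : Fin n) : IsClopen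
    {z : G.Lift n | (z.1 j).1 = (z.1 i).1 ∧ edist b (z.1 i).2 < edist b (z.1 j).2} := by
  have ho : IsOpen {z : G.Lift n | edist b (z.1 i).2 < edist b (z.1 j).2} :=
    isOpen_lt (continuous_edist_token b i) (continuous_edist_token b j)
  have hc : IsClosed {z : G.Lift n | edist b (z.1 i).2 ≤ edist b (z.1 j).2} :=
    isClosed_le (continuous_edist_token b i) (continuous_edist_token b j)
  refine ⟨?_, (isClopen_fst_eq_fst j i).2.inter ho⟩
  by_cases hij : i = j
  · subst hij
    convert isClosed_empty
    ext z
    simp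
  · convert (isClopen_fst_eq_fst (G := G) j i).1.inter hc using 1
    ext z
    refine and_congr_right fun h => ⟨le_of_lt, fun h' => lt_of_le_of_ne h' fun hc => hij ?_⟩
    exact z.eq_of_fst_snd h.symm (edist_injective b hc)

theorem continuous_next (o : G.OrientedEdge) (i : Fin n) :
    Continuous fun z : G.Lift n => z.next o i := by
  classical
  refine Continuous.finset_inf_apply fun j _ => ?_
  exact continuous_ite_of_isClopen (isClopen_edist_lt o.2 i j) (continuous_edist_token o.2 j)
    continuous_const

theorem continuous_ratio (o : G.OrientedEdge) (i : Fin n) :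
    Continuous fun z : G.Lift n => z.ratio o i := by
  have h1 : Continuous fun z : G.Lift n => (edist o.2 (z.1 i).2 : ℝ) :=
    continuous_subtype_val.comp (continuous_edist_token o.2 i)
  have h2 : Continuous fun z : G.Lift n => (z.next o i : ℝ) :=
    continuous_subtype_val.comp (continuous_next o i)
  refine h1.div (h1.max (h2.sub h1)) fun z => ?_
  -- The denominator is positive: either the distance to the head is, or the gap behind a token at
  -- the head is.
  rcases eq_or_ne (edist o.2 (z.1 i).2) 0 with h0 | h0
  · have h3 := z.lt_next (o := o) (i := i) (h0 ▸ zero_lt_one)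
    have h4 : (edist o.2 (z.1 i).2 : ℝ) < z.next o i := h3
    exact (lt_max_of_lt_right (sub_pos.2 h4)).ne'
  · have h4 : (0 : ℝ) < edist o.2 (z.1 i).2 := unitInterval.pos_iff_ne_zero.2 h0
    exact (lt_max_of_lt_left h4).ne'

theorem continuous_depth (o : G.OrientedEdge) : Continuous fun z : G.Lift n => z.depth o := by
  classical
  refine continuous_finsetProd _ fun i _ => ?_
  exact continuous_ite_of_isClopen (isClopen_fst_eq i o.1) (continuous_ratio o i) continuous_const

theorem continuous_tokenCount (e : E) : Continuous fun z : G.Lift n => (z.tokenCount e : ℝ) := by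
  classical
  simp only [tokenCount, Finset.natCast_card_filter]
  refine continuous_finsetSum _ fun i _ => ?_
  exact continuous_ite_of_isClopen (isClopen_fst_eq i e) continuous_const continuous_const

theorem continuous_tokenRank (i : Fin n) : Continuous fun z : G.Lift n => (z.tokenRank i : ℝ) := by
  classical
  simp only [tokenRank, Finset.natCast_card_filter]
  refine continuous_finsetSum _ fun j _ => ?_
  refine continuous_ite_of_isClopen ?_ continuous_const continuous_const
  convert isClopen_edist_lt (G := G) false j i using 3
  exact and_congr_left' eq_comm

theorem continuous_at_fst {Y : Type*} [TopologicalSpace Y] {F : E → G.Lift n → Y}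
    (hF : ∀ e, Continuous (F e)) (i : Fin n) : Continuous fun z : G.Lift n => F (z.1 i).1 z := by
  have : Continuous fun p : E × G.Lift n => F p.1 p.2 := continuous_prod_of_discrete_left.2 hF
  exact this.comp ((continuous_fst.comp (continuous_token i)).prodMk continuous_id)

variable [Fintype E]

theorem continuous_gap (o : G.OrientedEdge) : Continuous fun z : G.Lift n => z.gap o := by
  classical
  have h : Continuous fun z : G.Lift n => z.others o := by
    refine continuous_finsetProd _ fun o' _ => ?_
    exact Continuous.if_const _ (continuous_depth o') continuous_const
  exact Continuous.if_const _ ((continuous_depth o).div ((continuous_depth o).max h)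
    fun z => (z.max_pos o).ne') continuous_const

theorem continuous_spread : Continuous fun z : G.Lift n => z.spread := by
  have ht (e : E) : Continuous fun z : G.Lift n => z.arr.total z.gap e :=
    (((continuous_gap _).add (continuous_gap _)).add (continuous_tokenCount e)).sub
      continuous_const
  refine Continuous.subtype_mk (continuous_pi fun i => ?_) _
  refine (continuous_fst.comp (continuous_token i)).prodMk (continuous_projIcc.comp ?_)
  exact Continuous.div ((continuous_at_fst (fun e => continuous_gap (e, false)) i).add
    (continuous_tokenRank i)) (continuous_at_fst (F := fun e z => z.arr.total z.gap e) ht i)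
    fun z => (z.isGap_gap.total_pos _).ne'

end Continuity

/-! ### Independence of the choice of lift -/

section Congr

variable {z z' : G.Lift n}

theorem eq_or_endOf (h : z.conf = z'.conf) (i : Fin n) :
    z.1 i = z'.1 i ∨
      ∃ o o', z.1 i = endOf o ∧ z'.1 i = endOf o' ∧ G.head o = G.head o' :=
  G.chart_eq_chart (congrFun (congrArg Subtype.val h) i)

theorem eq_of_interior (h : z.conf = z'.conf) {i : Fin n} (hi : ((z.1 i).2 : ℝ) ∈ Ioo (0 : ℝ) 1) :
    z.1 i = z'.1 i := G.chart_eq_of_interior hi (congrFun (congrArg Subtype.val h) i)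

theorem edist_endOf_eq (b : Bool) (o : E × Bool) :
    edist b (endOf o).2 = 0 ∨ edist b (endOf o).2 = 1 := by
  obtain ⟨e, b'⟩ := o
  cases b <;> cases b' <;> simp [edist, endOf]

/-- A token with ambiguous coordinates is at an end of an edge. It is either not behind `i` or at
distance `1`, so it contributes the default value of the infimum. -/
theorem next_congr (h : z.conf = z'.conf) {i : Fin n} (hi : z.1 i = z'.1 i) (o : G.OrientedEdge) :
    z.next o i = z'.next o i := by
  classical
  have key : ∀ (p : E × unitInterval) (o' : E × Bool),
      (if (endOf o').1 = p.1 ∧ edist o.2 p.2 < edist o.2 (endOf o').2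
        then edist o.2 (endOf o').2 else 1) = 1 := by
    intro p o'
    split_ifs with hc
    · rcases edist_endOf_eq o.2 o' with h0 | h0
      · rw [h0] at hc
        exact absurd hc.2 (not_lt.2 unitInterval.nonneg')
      · exact h0
    · rfl
  refine Finset.inf_congr rfl fun j _ => ?_
  rw [hi]
  rcases eq_or_endOf h j with hj | ⟨o1, o2, hj, hj', -⟩
  · rw [hj]
  · rw [hj, hj', key, key]

theorem ratio_congr (h : z.conf = z'.conf) {i : Fin n} (hi : z.1 i = z'.1 i)
    (o : G.OrientedEdge) : z.ratio o i = z'.ratio o i := by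
  rw [ratio, ratio, next_congr h hi, hi]

theorem ratio_eq_one {o : G.OrientedEdge} {i : Fin n} (hi : edist o.2 (z.1 i).2 = 1) :
    z.ratio o i = 1 := by
  have := (z.next o i).2.2
  rw [ratio, hi, Icc.coe_one, max_eq_left (by linarith), div_one]

/-- With nobody at the head of `o`, ambiguous tokens are off the edge or at its far end, and in both
cases contribute the factor `1`. -/
theorem depth_congr (h : z.conf = z'.conf) (o : G.OrientedEdge)
    (ho : ∀ i, z.conf.1 i ≠ .vertex (G.head o)) : z.depth o = z'.depth o := by
  classical
  have ho' : ∀ i, z'.conf.1 i ≠ .vertex (G.head o) := h ▸ ho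
  have key : ∀ (w : G.Lift n) (i : Fin n) (o' : E × Bool),
      (∀ i, w.conf.1 i ≠ .vertex (G.head o)) → w.1 i = endOf o' →
      (if (w.1 i).1 = o.1 then w.ratio o i else 1) = 1 := by
    intro w i o' hw hi
    split_ifs with h1
    · refine ratio_eq_one ?_
      rcases edist_endOf_eq o.2 o' with h0 | h0
      · refine absurd ?_ (hw i)
        rw [← G.chart_endOf, ← eq_endOf_of_edist h1 (hi ▸ h0)]
        rfl
      · rw [hi, h0]
    · rfl
  refine Finset.prod_congr rfl fun i _ => ?_
  rcases eq_or_endOf h i with hi | ⟨o1, o2, hi, hi', -⟩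
  · rw [hi, ratio_congr h hi]
  · rw [key z i o1 ho hi, key z' i o2 ho' hi']

open Classical in
/-- The number of tokens at an end of an edge. -/
noncomputable def ends (z : G.Lift n) (o : G.OrientedEdge) : ℕ :=
  (Finset.univ.filter fun j => z.1 j = endOf o).card

theorem ends_eq_one {o : G.OrientedEdge} {i : Fin n} (hi : z.1 i = endOf o) : z.ends o = 1 := by
  classical
  rw [ends, Finset.card_eq_one]
  refine ⟨i, Finset.ext fun j => ?_⟩
  simp only [Finset.mem_filter, Finset.mem_univ, true_and, Finset.mem_singleton]
  refine ⟨fun hj => (z.eq_of_endOf hj hi rfl).1, fun hj => hj ▸ hi⟩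

theorem ends_eq_zero {o : G.OrientedEdge} (h : ∀ i, z.1 i ≠ endOf o) : z.ends o = 0 := by
  classical
  rw [ends, Finset.card_eq_zero, Finset.filter_eq_empty_iff]
  exact fun i _ => h i

open Classical in
/-- The number of tokens in the interior of an edge. -/
noncomputable def innerCount (z : G.Lift n) (e : E) : ℕ :=
  (Finset.univ.filter fun j => (z.1 j).1 = e ∧ ((z.1 j).2 : ℝ) ∈ Ioo (0 : ℝ) 1).card

open Classical in
/-- The number of tokens in the interior of an edge and to the left of a given point. -/
noncomputable def innerRank (z : G.Lift n) (p : E × unitInterval) : ℕ :=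
  (Finset.univ.filter fun j => ((z.1 j).1 = p.1 ∧ ((z.1 j).2 : ℝ) ∈ Ioo (0 : ℝ) 1) ∧
    (z.1 j).2 < p.2).card

theorem inner_iff (h : z.conf = z'.conf) (e : E) (j : Fin n) :
    ((z.1 j).1 = e ∧ ((z.1 j).2 : ℝ) ∈ Ioo (0 : ℝ) 1) ↔
      ((z'.1 j).1 = e ∧ ((z'.1 j).2 : ℝ) ∈ Ioo (0 : ℝ) 1) := by
  constructor
  · intro hj
    rwa [← eq_of_interior h hj.2]
  · intro hj
    rwa [← eq_of_interior h.symm hj.2]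

theorem innerCount_congr (h : z.conf = z'.conf) (e : E) : z.innerCount e = z'.innerCount e := by
  classical
  rw [innerCount, innerCount]
  congr 1
  exact Finset.filter_congr fun j _ => inner_iff h e j

theorem innerRank_congr (h : z.conf = z'.conf) (p : E × unitInterval) :
    z.innerRank p = z'.innerRank p := by
  classical
  rw [innerRank, innerRank]
  congr 1
  refine Finset.filter_congr fun j _ => ?_
  constructor
  · intro hj
    rwa [← eq_of_interior h hj.1.2]
  · intro hj
    rwa [← eq_of_interior h.symm hj.1.2]

/-- Separates the part that depends on the configuration alone from the two end contributions that
depend on the lift. -/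
theorem tokenCount_eq (z : G.Lift n) (e : E) :
    z.tokenCount e = z.innerCount e + z.ends (e, false) + z.ends (e, true) := by
  classical
  simp only [tokenCount, innerCount, ends, Finset.card_filter]
  rw [← Finset.sum_add_distrib, ← Finset.sum_add_distrib]
  refine Finset.sum_congr rfl fun j _ => ?_
  rcases eq_endOf_or_interior (z.1 j) with ⟨b, hb⟩ | hi
  · rw [hb]
    generalize (z.1 j).1 = e'
    by_cases he : e' = e
    · subst he
      cases b <;> simp [endOf]
    · simp [endOf, he]
  · have h0 : z.1 j ≠ endOf (e, false) := fun hc => endOf_not_interior _ (hc ▸ hi)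
    have h1 : z.1 j ≠ endOf (e, true) := fun hc => endOf_not_interior _ (hc ▸ hi)
    simp [h0, h1, hi.1, hi.2]

theorem tokenRank_eq (z : G.Lift n) {i : Fin n} (h : 0 < (z.1 i).2) :
    z.tokenRank i = z.innerRank (z.1 i) + z.ends ((z.1 i).1, false) := by
  classical
  simp only [tokenRank, innerRank, ends, Finset.card_filter]
  rw [← Finset.sum_add_distrib]
  refine Finset.sum_congr rfl fun j _ => ?_
  rcases eq_endOf_or_interior (z.1 j) with ⟨b, hb⟩ | hi
  · rw [hb]
    generalize (z.1 j).1 = e'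
    by_cases he : e' = (z.1 i).1
    · subst he
      cases b
      · simp [endOf, h]
      · simp [endOf, not_lt.2 unitInterval.le_one']
    · simp [endOf, he]
  · have h0 : z.1 j ≠ endOf ((z.1 i).1, false) := fun hc => endOf_not_interior _ (hc ▸ hi)
    simp [h0, hi.1, hi.2]

/-- If the coordinates of a token differ, then the token is at a branched vertex. -/
theorem exists_endOf_of_ne (hfb : ∀ o, G.IsFree (G.head o) ∨ G.IsBranched (G.head o))
    (h : z.conf = z'.conf) {i : Fin n} (hi : z.1 i ≠ z'.1 i) :
    ∃ o o', z.1 i = endOf o ∧ z'.1 i = endOf o' ∧ G.head o = G.head o' ∧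
      G.IsBranched (G.head o) := by
  obtain ⟨o, o', h1, h2, h3⟩ := (eq_or_endOf h i).resolve_left hi
  refine ⟨o, o', h1, h2, h3, (hfb o).resolve_left fun hf => hi ?_⟩
  rw [h1, h2, hf.eq_of_head rfl h3.symm]

variable [Fintype E]

/-- The sum of the gap at an end of an edge and the number of tokens there does not depend on the
choice of coordinates. -/
theorem gap_add_ends_congr (hfb : ∀ o, G.IsFree (G.head o) ∨ G.IsBranched (G.head o))
    (h : z.conf = z'.conf) (o : G.OrientedEdge) :
    z.gap o + z.ends o = z'.gap o + z'.ends o := by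
  rcases hfb o with hf | hb
  -- A free vertex is the end of a single edge, so tokens there have unambiguous coordinates.
  · have hnb := hf.not_isBranched
    have key : ∀ w w' : G.Lift n, w.conf = w'.conf → ∀ j, w.1 j = endOf o → w'.1 j = endOf o := by
      intro w w' hw j hj
      rcases eq_or_endOf hw j with hj' | ⟨o1, o2, h1, h2, h3⟩
      · exact hj' ▸ hj
      · have h4 : o1 = o := endOf_injective (h1.symm.trans hj)
        subst h4
        rw [h2, hf.eq_of_head rfl h3.symm]
    have : z.ends o = z'.ends o := by
      classical
      rw [ends, ends]
      congr 1
      exact Finset.filter_congr fun j _ => ⟨key z z' h j, key z' z h.symm j⟩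
    rw [gap, gap, if_neg hnb, if_neg hnb, this]
  · by_cases hocc : ∃ k, z.conf.1 k = .vertex (G.head o)
    · have key : ∀ w : G.Lift n, (∃ k, w.conf.1 k = .vertex (G.head o)) →
          w.gap o + w.ends o = 1 := by
        rintro w ⟨k, hk⟩
        by_cases hko : ∃ i, w.1 i = endOf o
        · obtain ⟨i, hi⟩ := hko
          rw [(w.gap_eq_zero_iff hb).2 ⟨i, hi⟩, ends_eq_one hi]
          simp
        · have h0 : w.others o = 0 := by
            rw [others_eq_zero_iff]
            have hk' : G.chart (w.1 k) = .vertex (G.head o) := hk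
            rw [← chart_endOf] at hk'
            rcases G.chart_eq_chart hk' with h1 | ⟨o1, o2, h1, h2, h3⟩
            · exact absurd ⟨k, h1⟩ hko
            · have := endOf_injective h2
              subst this
              refine ⟨o1, h3, fun hc => hko ⟨k, hc ▸ h1⟩, k, h1⟩
          have h1 := w.max_pos o
          rw [h0, max_eq_left (w.depth_nonneg o)] at h1
          push Not at hko
          rw [ends_eq_zero hko, gap, if_pos hb, h0, max_eq_left h1.le, div_self h1.ne']
          simp
      rw [key z hocc, key z' (h ▸ hocc)]
    · push Not at hocc
      have key : ∀ w : G.Lift n, (∀ k, w.conf.1 k ≠ .vertex (G.head o)) → w.ends o = 0 := by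
        intro w hw
        refine ends_eq_zero fun i hi => hw i ?_
        rw [← chart_endOf, ← hi]
        rfl
      have h1 : z.others o = z'.others o := by
        refine Finset.prod_congr rfl fun o' _ => ?_
        split_ifs with ho'
        · exact depth_congr h o' (ho'.1 ▸ hocc)
        · rfl
      rw [key z hocc, key z' (h ▸ hocc), gap, gap, h1, depth_congr h o hocc]

theorem total_congr (hfb : ∀ o, G.IsFree (G.head o) ∨ G.IsBranched (G.head o))
    (h : z.conf = z'.conf) (e : E) : z.arr.total z.gap e = z'.arr.total z'.gap e := by
  have h1 := gap_add_ends_congr hfb h (e, false)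
  have h2 := gap_add_ends_congr hfb h (e, true)
  have h3 := innerCount_congr h e
  have h4 : (z.arr.count e : ℝ) = z.innerCount e + z.ends (e, false) + z.ends (e, true) := by
    exact_mod_cast z.tokenCount_eq e
  have h5 : (z'.arr.count e : ℝ) = z'.innerCount e + z'.ends (e, false) + z'.ends (e, true) := by
    exact_mod_cast z'.tokenCount_eq e
  rw [Arr.total, Arr.total, h4, h5, h3]
  linarith

/-- Numerator and denominator of the new position depend only on interior counts and on sums of gap
and end count. A token at the left end has rank `0` instead of the general rank formula and is
treated separately. -/
theorem spread_congr (hfb : ∀ o, G.IsFree (G.head o) ∨ G.IsBranched (G.head o))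
    (h : z.conf = z'.conf) {i : Fin n} (hi : z.1 i = z'.1 i) : z.spread.1 i = z'.spread.1 i := by
  have hedge : (z.1 i).1 = (z'.1 i).1 := congrArg Prod.fst hi
  refine Prod.ext hedge (Subtype.ext ?_)
  refine (z.edist_spread false i).trans (Eq.trans ?_ (z'.edist_spread false i).symm)
  rw [total_congr hfb h, ← hedge]
  congr 1
  have h1 := gap_add_ends_congr hfb h ((z.1 i).1, false)
  rcases eq_or_ne (z.1 i).2 0 with h0 | h0
  · have h2 : z.1 i = endOf ((z.1 i).1, false) := eq_endOf_of_edist rfl h0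
    have h3 : z'.1 i = endOf ((z.1 i).1, false) := hi ▸ h2
    have h4 := z.rankFrom_eq_zero_of_endOf h2
    have h5 := z'.rankFrom_eq_zero_of_endOf h3
    rw [ends_eq_one h2, ends_eq_one h3] at h1
    simp only at h4 h5
    rw [h4, h5]
    linarith
  · have h2 : (z.arr.rankFrom false i : ℝ) =
        z.innerRank (z.1 i) + z.ends ((z.1 i).1, false) := by
      exact_mod_cast z.tokenRank_eq (unitInterval.pos_iff_ne_zero.2 h0)
    have h3 : (z'.arr.rankFrom false i : ℝ) =
        z'.innerRank (z'.1 i) + z'.ends ((z'.1 i).1, false) := by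
      exact_mod_cast z'.tokenRank_eq (unitInterval.pos_iff_ne_zero.2 (hi ▸ h0))
    rw [h2, h3, ← hi, innerRank_congr h]
    linarith

/-- Tokens whose coordinates differ sit at branched vertices, where `spread` moves nothing. -/
theorem conf_spread_congr (hfb : ∀ o, G.IsFree (G.head o) ∨ G.IsBranched (G.head o))
    (h : z.conf = z'.conf) : z.spread.conf = z'.spread.conf := by
  refine Subtype.ext (funext fun i => ?_)
  change G.chart (z.spread.1 i) = G.chart (z'.spread.1 i)
  by_cases hi : z.1 i = z'.1 i
  · rw [spread_congr hfb h hi]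
  · obtain ⟨o, o', h1, h2, h3, h4⟩ := exists_endOf_of_ne hfb h hi
    rw [z.spread_eq_of_endOf h1 h4, z'.spread_eq_of_endOf h2 (h3 ▸ h4), h1, h2, chart_endOf,
      chart_endOf, h3]

/-- A lift of a configuration that has a fixed lift is fixed. -/
theorem spread_eq_of_conf_eq (hfb : ∀ o, G.IsFree (G.head o) ∨ G.IsBranched (G.head o))
    (h : z.conf = z'.conf) (hz : z.spread = z) : z'.spread = z' := by
  have h1 : z'.spread.conf = z'.conf := by
    rw [← conf_spread_congr hfb h, hz, h]
  refine Subtype.ext (funext fun i => ?_)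
  rcases eq_or_endOf h1 i with hi | ⟨o, o', h2, h3, h4⟩
  · exact hi
  · obtain ⟨h5, -⟩ := z'.of_spread_eq_endOf h2
    exact z'.spread_eq_of_endOf h3 (h4 ▸ h5)

end Congr

end Lift

end CellGraph

/-! ### Evenly spaced configurations lie in the cube complex -/

namespace CellGraph

variable {V E : Type*} {G : CellGraph V E} {n : ℕ}

open Classical in
/-- The first token on the edge `o.1`, seen from the head of `o`. -/
noncomputable def Arr.first (A : Arr E n) (o : E × Bool) : Option (Fin n) :=
  if h : 0 < A.count o.1 then some (A.rankFrom_surj o.2 h).choose else none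

theorem Arr.first_eq_some (A : Arr E n) {o : E × Bool} {i : Fin n} :
    A.first o = some i ↔ A.edge i = o.1 ∧ A.rankFrom o.2 i = 0 := by
  unfold Arr.first
  split_ifs with h
  · obtain ⟨h1, h2⟩ := (A.rankFrom_surj o.2 h).choose_spec
    rw [Option.some_inj]
    constructor
    · rintro rfl
      exact ⟨h1, h2⟩
    · exact fun ⟨h3, h4⟩ => A.rankFrom_inj o.2 (h1.trans h3.symm) (h2.trans h4.symm)
  · simp only [false_iff, not_and]
    intro h1
    have := A.rank_lt i
    rw [h1] at this
    omega

namespace IsGap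

variable {A : Arr E n} {γ : G.OrientedEdge → ℝ}

open Classical in
/-- `1` if the first token on `o.1`, seen from the head of `o`, is not stationary. -/
noncomputable def slack (γ : E × Bool → ℝ) (o : E × Bool) : ℕ := if γ o < 1 then 1 else 0

theorem slack_add_le (h : IsGap G A γ) (e : E) :
    slack γ (e, false) + slack γ (e, true) ≤ A.count e := by
  unfold slack
  split_ifs with h1 h2 h2
  · exact h.two_le e h1 h2
  · exact h.count_pos _ h1
  · exact h.count_pos _ h2
  · exact Nat.zero_le _

/-- A token that is first from both ends is alone on its edge, and a lone token cannot serve two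
short gaps. -/
theorem eq_of_first (h : IsGap G A γ) {o o' : G.OrientedEdge} {i : Fin n} (h1 : γ o < 1)
    (h2 : γ o' < 1) (h3 : A.first o = some i) (h4 : A.first o' = some i) : o = o' := by
  rw [A.first_eq_some] at h3 h4
  obtain ⟨e, b⟩ := o
  obtain ⟨e', b'⟩ := o'
  obtain ⟨rfl, h5⟩ := h3
  obtain ⟨rfl, h6⟩ := h4
  have h7 := A.rankFrom_not b i
  cases b <;> cases b'
  · rfl
  · have := h.two_le _ h1 h2
    simp only [Bool.not_false] at h5 h6 h7
    omega
  · have := h.two_le _ h2 h1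
    simp only [Bool.not_true] at h5 h6 h7
    omega
  · rfl

/-- The stationary tokens in the interior of an edge. -/
noncomputable def inner (A : Arr E n) (γ : E × Bool → ℝ) (e : E) : List (Fin n) :=
  List.ofFn fun k : Fin (A.count e - slack γ (e, false) - slack γ (e, true)) =>
    (A.rank_surj e (k + slack γ (e, false)) (by omega)).choose

theorem length_inner (A : Arr E n) (γ : E × Bool → ℝ) (e : E) :
    (inner A γ e).length = A.count e - slack γ (e, false) - slack γ (e, true) :=
  List.length_ofFn

theorem get_inner (A : Arr E n) (γ : E × Bool → ℝ) (e : E) (k : Fin (inner A γ e).length) (i : Fin n) :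
    (inner A γ e).get k = i ↔ A.edge i = e ∧ A.rank i = k + slack γ (e, false) := by
  have hk : (k : ℕ) < A.count e - slack γ (e, false) - slack γ (e, true) :=
    length_inner A γ e ▸ k.2
  obtain ⟨h1, h2⟩ := (A.rank_surj e (k + slack γ (e, false)) (by omega)).choose_spec
  have h3 : (inner A γ e).get k =
      (A.rank_surj e (k + slack γ (e, false)) (by omega)).choose := List.get_ofFn _ _
  rw [h3]
  constructor
  · rintro rfl
    exact ⟨h1, h2⟩
  · exact fun ⟨h4, h5⟩ => A.rank_inj _ _ (h1.trans h4.symm) (h2.trans h5.symm)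

open Classical in
/-- The token at a vertex. -/
noncomputable def vertexToken (G : CellGraph V E) (A : Arr E n) (γ : G.OrientedEdge → ℝ) (v : V) :
    Option (Fin n) :=
  if h : ∃ o, G.head o = v ∧ γ o = 0 then A.first h.choose else none

theorem vertexToken_eq_some (h : IsGap G A γ) {v : V} {i : Fin n} :
    vertexToken G A γ v = some i ↔ ∃ o, G.head o = v ∧ γ o = 0 ∧ A.first o = some i := by
  unfold vertexToken
  split_ifs with hv
  · obtain ⟨h1, h2⟩ := hv.choose_spec
    constructor
    · exact fun h3 => ⟨_, h1, h2, h3⟩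
    · rintro ⟨o, h3, h4, h5⟩
      rw [h.unique hv.choose o (by linarith) (by linarith) (h1.trans h3.symm)]
      exact h5
  · simp only [false_iff]
    exact fun ⟨o, h3, h4, _⟩ => hv ⟨o, h3, h4⟩

open Classical in
/-- The token that moves towards the head of an oriented edge. -/
noncomputable def movingToken (A : Arr E n) (γ : E × Bool → ℝ) (o : E × Bool) :
    Option (Fin n) := if 0 < γ o ∧ γ o < 1 then A.first o else none

theorem movingToken_eq_some {o : E × Bool} {γ : E × Bool → ℝ} {i : Fin n} :
    movingToken A γ o = some i ↔ (0 < γ o ∧ γ o < 1) ∧ A.first o = some i := by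
  unfold movingToken
  split_ifs with h <;> simp [h]

theorem isSome_movingToken (h : IsGap G A γ) {o : G.OrientedEdge} :
    (movingToken A γ o).isSome ↔ 0 < γ o ∧ γ o < 1 := by
  rw [Option.isSome_iff_exists]
  constructor
  · rintro ⟨i, hi⟩
    exact (movingToken_eq_some.1 hi).1
  · intro ho
    obtain ⟨i, hi⟩ := A.rankFrom_surj o.2 (h.count_pos o ho.2)
    exact ⟨i, movingToken_eq_some.2 ⟨ho, A.first_eq_some.2 hi⟩⟩

theorem not_inner_of_first {e : E} {k : ℕ} {i : Fin n} {o : E × Bool} {γ : E × Bool → ℝ}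
    (hk : k < A.count e - slack γ (e, false) - slack γ (e, true))
    (h1 : A.edge i = e) (h2 : A.rank i = k + slack γ (e, false)) (h3 : A.first o = some i)
    (h4 : γ o < 1) : False := by
  obtain ⟨e', b⟩ := o
  obtain ⟨h5, h6⟩ := A.first_eq_some.1 h3
  obtain rfl : A.edge i = e' := h5
  subst h1
  have h7 : slack γ (A.edge i, b) = 1 := by simp [slack, h4]
  cases b
  · simp only [Arr.rankFrom, Bool.false_eq_true, if_false] at h6
    omega
  · simp only [Arr.rankFrom, if_true] at h6
    omega

/-- The face of the cube complex with a given arrangement and gaps. -/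
noncomputable def face (h : IsGap G A γ) : G.Face n where
  onEdge := inner A γ
  atVertex := vertexToken G A γ
  moving := movingToken A γ
  atVertex_branched v hv := by
    obtain ⟨i, hi⟩ := Option.isSome_iff_exists.1 hv
    obtain ⟨o, rfl, h1, -⟩ := h.vertexToken_eq_some.1 hi
    exact h.branched o (by linarith)
  moving_branched o ho := h.branched o (h.isSome_movingToken.1 ho).2
  atVertex_eq_none o ho := by
    by_contra hc
    obtain ⟨i, hi⟩ := Option.ne_none_iff_exists'.1 hc
    obtain ⟨o', h1, h2, -⟩ := h.vertexToken_eq_some.1 hi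
    have h3 := h.isSome_movingToken.1 ho
    have := h.unique o o' h3.2 (by linarith) h1.symm
    subst this
    linarith
  moving_unique o o' ho ho' hoo' :=
    h.unique o o' (h.isSome_movingToken.1 ho).2 (h.isSome_movingToken.1 ho').2 hoo'
  occurs_once i := by
    refine existsUnique_of_exists_of_unique ?_ ?_
    -- A first token at a short gap is at a vertex or moving, according to whether the gap is `0`.
    -- All other tokens are stationary, with their position in the tuple shifted by `slack`.
    · by_cases hi : ∃ b, A.rankFrom b i = 0 ∧ γ (A.edge i, b) < 1
      · obtain ⟨b, h1, h2⟩ := hi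
        have h3 : A.first (A.edge i, b) = some i := A.first_eq_some.2 ⟨rfl, h1⟩
        rcases (h.nonneg (A.edge i, b)).eq_or_lt with h0 | h0
        · exact ⟨.inr (.inl _), h.vertexToken_eq_some.2 ⟨_, rfl, h0.symm, h3⟩⟩
        · exact ⟨.inr (.inr (A.edge i, b)), movingToken_eq_some.2 ⟨⟨h0, h2⟩, h3⟩⟩
      · push Not at hi
        have h1 := A.rank_lt i
        have h2 : slack γ (A.edge i, false) ≤ A.rank i := by
          unfold slack
          split_ifs with hs
          · by_contra hc
            exact absurd hs (not_lt.2 (hi false (by simp only [Arr.rankFrom]; simp; omega)))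
          · omega
        have h3 : slack γ (A.edge i, true) < A.count (A.edge i) - A.rank i := by
          unfold slack
          split_ifs with hs
          · by_contra hc
            exact absurd hs (not_lt.2 (hi true (by simp only [Arr.rankFrom]; simp; omega)))
          · omega
        refine ⟨.inl ⟨A.edge i, ⟨A.rank i - slack γ (A.edge i, false), ?_⟩⟩, ?_⟩
        · rw [length_inner]
          omega
        · refine congrArg some ((get_inner A γ _ _ i).2 ⟨rfl, ?_⟩)
          simp only
          omega
    · have inl : ∀ (e : E) (k : Fin (inner A γ e).length),
          some ((inner A γ e).get k) = some i → A.edge i = e ∧ A.rank i = k + slack γ (e, false) :=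
        fun e k hk => (get_inner A γ e k i).1 (Option.some_inj.1 hk)
      have hlt : ∀ (e : E) (k : Fin (inner A γ e).length),
          (k : ℕ) < A.count e - slack γ (e, false) - slack γ (e, true) :=
        fun e k => length_inner A γ e ▸ k.2
      rintro (⟨e, k⟩ | v | o) (⟨e', k'⟩ | v' | o') hc hc'
      · obtain ⟨rfl, h2⟩ := inl e k hc
        obtain ⟨rfl, h4⟩ := inl e' k' hc'
        obtain rfl : k = k' := Fin.ext (by omega)
        rfl
      · obtain ⟨h1, h2⟩ := inl e k hc
        obtain ⟨o, -, h3, h4⟩ := h.vertexToken_eq_some.1 hc'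
        exact (not_inner_of_first (hlt e k) h1 h2 h4 (by linarith)).elim
      · obtain ⟨h1, h2⟩ := inl e k hc
        obtain ⟨h3, h4⟩ := movingToken_eq_some.1 hc'
        exact (not_inner_of_first (hlt e k) h1 h2 h4 h3.2).elim
      · obtain ⟨h1, h2⟩ := inl e' k' hc'
        obtain ⟨o, -, h3, h4⟩ := h.vertexToken_eq_some.1 hc
        exact (not_inner_of_first (hlt e' k') h1 h2 h4 (by linarith)).elim
      · obtain ⟨o, rfl, h3, h4⟩ := h.vertexToken_eq_some.1 hc
        obtain ⟨o', rfl, h5, h6⟩ := h.vertexToken_eq_some.1 hc'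
        rw [h.eq_of_first (by linarith) (by linarith) h4 h6]
      · obtain ⟨o, rfl, h3, h4⟩ := h.vertexToken_eq_some.1 hc
        obtain ⟨h5, h6⟩ := movingToken_eq_some.1 hc'
        have := h.eq_of_first (by linarith) h5.2 h4 h6
        subst this
        linarith
      · obtain ⟨h1, h2⟩ := inl e' k' hc'
        obtain ⟨h3, h4⟩ := movingToken_eq_some.1 hc
        exact (not_inner_of_first (hlt e' k') h1 h2 h4 h3.2).elim
      · obtain ⟨o', rfl, h3, h4⟩ := h.vertexToken_eq_some.1 hc'
        obtain ⟨h5, h6⟩ := movingToken_eq_some.1 hc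
        have := h.eq_of_first (by linarith) h5.2 h4 h6
        subst this
        linarith
      · obtain ⟨h3, h4⟩ := movingToken_eq_some.1 hc
        obtain ⟨h5, h6⟩ := movingToken_eq_some.1 hc'
        rw [h.eq_of_first h3.2 h5.2 h4 h6]

/-- The coordinates of the configuration with given gaps in the cube of the face. -/
noncomputable def cube (h : IsGap G A γ) : h.face.Cube := fun o =>
  ⟨1 - γ o.1, by linarith [h.le_one o.1], by linarith [h.nonneg o.1]⟩

theorem gap_face (h : IsGap G A γ) (o : G.OrientedEdge) (ho : (h.face.moving o).isSome) :
    h.face.gap h.cube o = γ o := by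
  rw [Face.gap, dif_pos ho]
  simp [cube]

/-- The margin skips a nonstationary first token. For `γ o = 0` that token is at the vertex and the
unit up to the next token or end is counted by `slack`. -/
theorem margin_face (h : IsGap G A γ) (o : G.OrientedEdge) :
    h.face.margin h.cube o = γ o + slack γ o := by
  unfold Face.margin
  split_ifs with ho
  · have h1 := h.isSome_movingToken.1 ho
    rw [h.gap_face o ho, slack, if_pos h1.2, Nat.cast_one]
  · have h1 : ¬ (0 < γ o ∧ γ o < 1) := fun hc => ho (h.isSome_movingToken.2 hc)
    rcases (h.nonneg o).eq_or_lt with h2 | h2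
    · simp [slack, ← h2]
    · have h3 : ¬ γ o < 1 := fun hc => h1 ⟨h2, hc⟩
      rw [slack, if_neg h3, le_antisymm (h.le_one o) (not_lt.1 h3)]
      simp

theorem units_face (h : IsGap G A γ) (e : E) : h.face.units h.cube e = A.total γ e := by
  have h1 := h.slack_add_le e
  have h2 : ((h.face.onEdge e).length : ℝ) =
      A.count e - slack γ (e, false) - slack γ (e, true) := by
    rw [show (h.face.onEdge e).length = _ from length_inner A γ e, Nat.cast_sub (by omega),
      Nat.cast_sub (by omega)]
  rw [Face.units, h.margin_face, h.margin_face, h2, Arr.total]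
  ring

theorem chart_place (h : IsGap G A γ) (i : Fin n) : G.chart (A.place γ i) =
    G.edgePoint (A.edge i) ((γ (A.edge i, false) + A.rank i) / A.total γ (A.edge i)) := by
  rw [chart]
  congr 1
  exact h.edist_place false i

theorem slotPoint_face (h : IsGap G A γ) (c : G.Slot n h.face.onEdge) (i : Fin n)
    (hc : h.face.label c = some i) : h.face.slotPoint h.cube c = G.chart (A.place γ i) := by
  have hb : ∀ b, A.rankFrom b i = 0 → (edist b (A.place γ i).2 : ℝ) =
      γ (A.edge i, b) / A.total γ (A.edge i) := by
    intro b hb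
    rw [h.edist_place, hb, Nat.cast_zero, add_zero]
  rcases c with ⟨e, k⟩ | v | ⟨e, b⟩
  · obtain ⟨rfl, h2⟩ := (get_inner A γ e k i).1 (Option.some_inj.1 hc)
    rw [h.chart_place, h2]
    change G.edgePoint _ ((h.face.margin h.cube _ + (k : ℕ)) / h.face.units h.cube _) = _
    rw [h.margin_face, h.units_face]
    congr 2
    push_cast
    ring
  · obtain ⟨o, rfl, h3, h4⟩ := h.vertexToken_eq_some.1 hc
    obtain ⟨h5, h6⟩ := A.first_eq_some.1 h4
    have h7 := hb o.2 h6
    rw [h5, show γ (o.1, o.2) = 0 from h3, zero_div] at h7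
    rw [eq_endOf_of_edist (o := o) h5 (Subtype.ext h7), chart_endOf]
    rfl
  · have ho : (h.face.moving (e, b)).isSome := Option.isSome_iff_exists.2 ⟨i, hc⟩
    obtain ⟨h3, h4⟩ := movingToken_eq_some.1 hc
    obtain ⟨rfl, h6⟩ := A.first_eq_some.1 h4
    have h7 := hb b h6
    cases b
    · change G.edgePoint _ (h.face.gap h.cube _ / h.face.units h.cube _) = _
      rw [h.gap_face _ ho, h.units_face, ← h7]
      rfl
    · change G.edgePoint _ (1 - h.face.gap h.cube _ / h.face.units h.cube _) = _
      rw [h.gap_face _ ho, h.units_face, ← h7]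
      simp [edist, chart]

theorem cellMap_face (h : IsGap G A γ) : h.face.cellMap h.cube = h.lift.conf :=
  Subtype.ext (funext fun i => h.slotPoint_face _ i (h.face.label_slotOf i))

theorem conf_lift_mem (h : IsGap G A γ) : h.lift.conf ∈ G.cubeComplex n :=
  ⟨h.face, h.cube, h.cellMap_face⟩

/-- If all gaps are `0` or `1`, then the face is a vertex. -/
theorem dim_face (h : IsGap G A γ) (h01 : ∀ o, γ o = 0 ∨ γ o = 1) : h.face.dim = 0 := by
  rw [Face.dim, Nat.card_eq_zero]
  refine .inl ⟨fun o => ?_⟩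
  have := h.isSome_movingToken.1 o.2
  rcases h01 o.1 with h1 | h1 <;> linarith

theorem vertexConf_face (h : IsGap G A γ) (h01 : ∀ o, γ o = 0 ∨ γ o = 1) :
    h.face.vertexConf = h.lift.conf := by
  rw [← h.cellMap_face, Face.vertexConf]
  congr 1
  funext o
  have := h.isSome_movingToken.1 o.2
  rcases h01 o.1 with h1 | h1 <;> linarith

end IsGap

theorem Lift.conf_spread_mem [Fintype E] (z : G.Lift n) : z.spread.conf ∈ G.cubeComplex n :=
  z.isGap_gap.conf_lift_mem

end CellGraph

/-! ### Points of the cubes have lifts fixed by `spread` -/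

namespace CellGraph

variable {V E : Type*} {G : CellGraph V E} {n : ℕ}

namespace Face

variable (F : G.Face n) (s : F.Cube) (ov : V → G.OrientedEdge)

theorem slotOf_eq {c : G.Slot n F.onEdge} {i : Fin n} (h : F.label c = some i) :
    F.slotOf i = c := (F.occurs_once i).unique (F.label_slotOf i) h

open Classical in
/-- The token that moves towards the head of `o` or is at the head of `o`, where the tokens at a
vertex `v` are assigned to the oriented edge `ov v`. -/
noncomputable def outer (o : G.OrientedEdge) : Option (Fin n) :=
  if (F.moving o).isSome then F.moving o
  else if o = ov (G.head o) then F.atVertex (G.head o) else none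

theorem outer_of_moving {o : G.OrientedEdge} {i : Fin n} (h : F.moving o = some i) :
    F.outer ov o = some i := by
  rw [outer, if_pos (by rw [h]; rfl), h]

theorem outer_of_vertex (hov : ∀ v, G.head (ov v) = v) {v : V} {i : Fin n}
    (h : F.atVertex v = some i) : F.outer ov (ov v) = some i := by
  have h1 : ¬ (F.moving (ov v)).isSome := fun hc => by
    have := F.atVertex_eq_none _ hc
    rw [hov, h] at this
    exact absurd this (by simp)
  rw [outer, if_neg h1, hov, if_pos rfl, h]

theorem of_outer {o : G.OrientedEdge} {i : Fin n} (h : F.outer ov o = some i) :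
    F.moving o = some i ∨
      (F.moving o = none ∧ o = ov (G.head o) ∧ F.atVertex (G.head o) = some i) := by
  unfold outer at h
  split_ifs at h with h1 h2
  · exact .inl h
  · exact .inr ⟨Option.not_isSome_iff_eq_none.1 h1, h2, h⟩

/-- `1` if there is an outer token on `o`. -/
noncomputable def outerCount (o : G.OrientedEdge) : ℕ := if (F.outer ov o).isSome then 1 else 0

theorem outerCount_eq_one {o : G.OrientedEdge} {i : Fin n} (h : F.outer ov o = some i) :
    F.outerCount ov o = 1 := by
  rw [outerCount, if_pos (by rw [h]; rfl)]

theorem exists_outer {o : G.OrientedEdge} (h : F.outerCount ov o ≠ 0) :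
    ∃ i, F.outer ov o = some i := by
  refine Option.isSome_iff_exists.1 ?_
  by_contra hc
  exact h (if_neg hc)

theorem outerCount_le (o : G.OrientedEdge) : F.outerCount ov o ≤ 1 := by
  unfold outerCount
  split_ifs <;> simp

/-- The number of tokens on an edge. -/
noncomputable def edgeCount (e : E) : ℕ :=
  F.outerCount ov (e, false) + (F.onEdge e).length + F.outerCount ov (e, true)

/-- The rank of the outer token on `o`. -/
noncomputable def outerRank (o : G.OrientedEdge) : ℕ := if o.2 then F.edgeCount ov o.1 - 1 else 0

/-- The edge to which a slot is assigned. -/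
def slotEdge : G.Slot n F.onEdge → E
  | .inl c => c.1
  | .inr (.inl v) => (ov v).1
  | .inr (.inr o) => o.1

/-- The rank of the token in a slot on its edge. -/
noncomputable def slotRank : G.Slot n F.onEdge → ℕ
  | .inl c => F.outerCount ov (c.1, false) + c.2
  | .inr (.inl v) => F.outerRank ov (ov v)
  | .inr (.inr o) => F.outerRank ov o

theorem slot_cases (hov : ∀ v, G.head (ov v) = v) {c : G.Slot n F.onEdge} {i : Fin n}
    (h : F.label c = some i) :
    (∃ (e : E) (k : Fin (F.onEdge e).length), c = .inl ⟨e, k⟩ ∧ F.slotEdge ov c = e ∧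
      F.slotRank ov c = F.outerCount ov (e, false) + k) ∨
    ∃ o, F.outer ov o = some i ∧ F.slotEdge ov c = o.1 ∧ F.slotRank ov c = F.outerRank ov o := by
  rcases c with ⟨e, k⟩ | v | o
  · exact .inl ⟨e, k, rfl, rfl, rfl⟩
  · exact .inr ⟨ov v, F.outer_of_vertex ov hov h, rfl, rfl⟩
  · exact .inr ⟨o, F.outer_of_moving ov h, rfl, rfl⟩

theorem slot_of_outer {o : G.OrientedEdge} {i : Fin n} (h : F.outer ov o = some i) :
    F.slotEdge ov (F.slotOf i) = o.1 ∧ F.slotRank ov (F.slotOf i) = F.outerRank ov o := by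
  rcases F.of_outer ov h with h | ⟨-, h1, h2⟩
  · rw [F.slotOf_eq (c := .inr (.inr o)) h]
    exact ⟨rfl, rfl⟩
  · rw [F.slotOf_eq (c := .inr (.inl (G.head o))) h2]
    simp only [slotEdge, slotRank, ← h1]
    exact ⟨trivial, trivial⟩

theorem edgeCount_pos {o : G.OrientedEdge} {i : Fin n} (h : F.outer ov o = some i) :
    0 < F.edgeCount ov o.1 := by
  have h1 := F.outerCount_eq_one ov h
  obtain ⟨e, b⟩ := o
  cases b <;> simp only [edgeCount] <;> omega

/-- The arrangement of the tokens of a face. -/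
noncomputable def toArr (hov : ∀ v, G.head (ov v) = v) : Arr E n where
  edge i := F.slotEdge ov (F.slotOf i)
  count := F.edgeCount ov
  rank i := F.slotRank ov (F.slotOf i)
  rank_lt i := by
    rcases F.slot_cases ov hov (F.label_slotOf i) with ⟨e, k, -, h1, h2⟩ | ⟨o, h, h1, h2⟩
    · rw [h1, h2, edgeCount]
      omega
    · rw [h1, h2, outerRank]
      have := F.edgeCount_pos ov h
      split_ifs <;> omega
  rank_inj i j he hr := by
    -- Outer tokens have the first or the last rank of their edge, strictly outside the ranks of the
    -- stationary tokens.
    have houter : ∀ {o e} {k : Fin (F.onEdge e).length} {i : Fin n}, F.outer ov o = some i →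
        e = o.1 → F.outerCount ov (e, false) + k = F.outerRank ov o → False := by
      rintro ⟨e, b⟩ e' k i h1 rfl h2
      have h3 := F.outerCount_eq_one ov h1
      cases b
      · simp only [outerRank, Bool.false_eq_true, if_false] at h2
        omega
      · simp only [outerRank, if_true, edgeCount] at h2
        omega
    rcases F.slot_cases ov hov (F.label_slotOf i) with ⟨e, k, h0, h1, h2⟩ | ⟨o, h0, h1, h2⟩ <;>
    rcases F.slot_cases ov hov (F.label_slotOf j) with ⟨e', k', h3, h4, h5⟩ | ⟨o', h3, h4, h5⟩ <;>
    rw [h1, h4] at he <;> rw [h2, h5] at hr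
    · subst he
      have : k = k' := Fin.ext (by omega)
      subst this
      have h6 := congrArg F.label (h0.trans h3.symm)
      rw [F.label_slotOf, F.label_slotOf] at h6
      exact Option.some_inj.1 h6
    · exact (houter h3 he hr).elim
    · exact (houter h0 he.symm hr.symm).elim
    · obtain ⟨e, b⟩ := o
      obtain ⟨e', b'⟩ := o'
      obtain rfl : e = e' := he
      have h6 := F.outerCount_eq_one ov h0
      have h7 := F.outerCount_eq_one ov h3
      by_cases hb : b = b'
      · subst hb
        exact Option.some_inj.1 (h0.symm.trans h3)
      · exfalso
        cases b <;> cases b' <;>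
          simp only [outerRank, edgeCount, if_true, Bool.false_eq_true, if_false] at hr h6 h7 <;>
          first | exact hb rfl | omega
  rank_surj e k hk := by
    have h1 := F.outerCount_le ov (e, false)
    have h2 := F.outerCount_le ov (e, true)
    have hk' := hk
    rw [edgeCount] at hk
    -- The ranks split into a possible outer token at the start, the stationary tuple, and a
    -- possible outer token at the end.
    by_cases hl : k < F.outerCount ov (e, false)
    · obtain ⟨i, hi⟩ := F.exists_outer ov (o := (e, false)) (by omega)
      obtain ⟨h3, h4⟩ := F.slot_of_outer ov hi
      refine ⟨i, h3, h4.trans ?_⟩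
      simp only [outerRank, Bool.false_eq_true, if_false]
      omega
    · by_cases hr : k < F.outerCount ov (e, false) + (F.onEdge e).length
      · refine ⟨(F.onEdge e).get ⟨k - F.outerCount ov (e, false), by omega⟩, ?_⟩
        rw [F.slotOf_eq (c := .inl ⟨e, ⟨k - F.outerCount ov (e, false), by omega⟩⟩) rfl]
        refine ⟨rfl, ?_⟩
        simp only [slotRank]
        omega
      · obtain ⟨i, hi⟩ := F.exists_outer ov (o := (e, true)) (by omega)
        obtain ⟨h3, h4⟩ := F.slot_of_outer ov hi
        refine ⟨i, h3, h4.trans ?_⟩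
        simp only [outerRank, if_true, edgeCount]
        omega

open Classical in
/-- The gaps at the ends of the edges of a configuration in the cube of a face. -/
noncomputable def toGap (o : G.OrientedEdge) : ℝ :=
  if (F.moving o).isSome then F.gap s o else if (F.outer ov o).isSome then 0 else 1

theorem outer_of_toGap_lt {o : G.OrientedEdge} (h : F.toGap s ov o < 1) :
    ∃ i, F.outer ov o = some i := by
  unfold toGap at h
  split_ifs at h with h1 h2
  · obtain ⟨i, hi⟩ := Option.isSome_iff_exists.1 h1
    exact ⟨i, F.outer_of_moving ov hi⟩
  · exact Option.isSome_iff_exists.1 h2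
  · exact absurd h (lt_irrefl _)

/-- The exclusion rules of a face allow one moving or resting token per vertex, and a resting token
is assigned only to the end chosen by `ov`. -/
theorem head_injOn_outer {o o' : G.OrientedEdge} {i j : Fin n} (h : F.outer ov o = some i)
    (h' : F.outer ov o' = some j) (ho : G.head o = G.head o') : o = o' := by
  rcases F.of_outer ov h with h1 | ⟨-, h1, h2⟩ <;> rcases F.of_outer ov h' with h3 | ⟨-, h3, h4⟩
  · exact F.moving_unique o o' (by rw [h1]; rfl) (by rw [h3]; rfl) ho
  · have := F.atVertex_eq_none o (by rw [h1]; rfl)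
    rw [ho, h4] at this
    exact absurd this (by simp)
  · have := F.atVertex_eq_none o' (by rw [h3]; rfl)
    rw [← ho, h2] at this
    exact absurd this (by simp)
  · rw [h1, ho, ← h3]

theorem isGap_toGap (hov : ∀ v, G.head (ov v) = v) :
    IsGap G (F.toArr ov hov) (F.toGap s ov) where
  nonneg o := by
    unfold toGap
    split_ifs
    exacts [F.gap_nonneg s o, le_rfl, zero_le_one]
  le_one o := by
    unfold toGap
    split_ifs with h
    · rw [gap, dif_pos h]
      linarith [(s ⟨o, h⟩).2.1]
    · exact zero_le_one
    · exact le_rfl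
  branched o h := by
    obtain ⟨i, hi⟩ := F.outer_of_toGap_lt s ov h
    rcases F.of_outer ov hi with h1 | ⟨-, -, h2⟩
    · exact F.moving_branched o (by rw [h1]; rfl)
    · exact F.atVertex_branched _ (by rw [h2]; rfl)
  unique o o' h h' ho := by
    obtain ⟨i, hi⟩ := F.outer_of_toGap_lt s ov h
    obtain ⟨j, hj⟩ := F.outer_of_toGap_lt s ov h'
    exact F.head_injOn_outer ov hi hj ho
  count_pos o h := by
    obtain ⟨i, hi⟩ := F.outer_of_toGap_lt s ov h
    exact F.edgeCount_pos ov hi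
  two_le e h h' := by
    obtain ⟨i, hi⟩ := F.outer_of_toGap_lt s ov h
    obtain ⟨j, hj⟩ := F.outer_of_toGap_lt s ov h'
    have h1 := F.outerCount_eq_one ov hi
    have h2 := F.outerCount_eq_one ov hj
    change 2 ≤ F.edgeCount ov e
    rw [edgeCount]
    omega

/-- Counting a vertex token on the edge chosen by `ov` adds one token but reduces the end gap from
`1` to `0`, so the spacing on that edge is unchanged. -/
theorem margin_eq_toGap (o : G.OrientedEdge) :
    F.margin s o = F.toGap s ov o + F.outerCount ov o := by
  unfold margin toGap
  split_ifs with h1 h2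
  · obtain ⟨i, hi⟩ := Option.isSome_iff_exists.1 h1
    rw [F.outerCount_eq_one ov (F.outer_of_moving ov hi), Nat.cast_one]
  · simp [outerCount, h2]
  · simp [outerCount, h2]

theorem units_eq_total (hov : ∀ v, G.head (ov v) = v) (e : E) :
    F.units s e = (F.toArr ov hov).total (F.toGap s ov) e := by
  have h : ((F.toArr ov hov).count e : ℝ) =
      F.outerCount ov (e, false) + (F.onEdge e).length + F.outerCount ov (e, true) := by
    change ((F.edgeCount ov e : ℕ) : ℝ) = _
    rw [edgeCount]
    push_cast
    rfl
  rw [units, F.margin_eq_toGap s ov, F.margin_eq_toGap s ov, Arr.total, h]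
  ring

theorem chart_place_toArr (hov : ∀ v, G.head (ov v) = v) (i : Fin n) :
    G.chart ((F.toArr ov hov).place (F.toGap s ov) i) = F.slotPoint s (F.slotOf i) := by
  have h := F.isGap_toGap s ov hov
  have hl := F.label_slotOf i
  have hfrom : ∀ o, F.outer ov o = some i →
      (edist o.2 ((F.toArr ov hov).place (F.toGap s ov) i).2 : ℝ) =
        F.toGap s ov o / F.units s o.1 := by
    rintro ⟨e, b⟩ ho
    obtain ⟨h1, h2⟩ := F.slot_of_outer ov ho
    have h4 : (F.toArr ov hov).edge i = e := h1
    have h5 : (F.toArr ov hov).rank i = F.outerRank ov (e, b) := h2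
    have h6 : (F.toArr ov hov).rankFrom b i = 0 := by
      rw [Arr.rankFrom, h4, h5]
      cases b
      · simp [outerRank]
      · simp only [outerRank, if_true]
        exact Nat.sub_self _
    rw [h.edist_place, h6, h4, Nat.cast_zero, add_zero, F.units_eq_total s ov hov]
  have hedge : (F.toArr ov hov).edge i = F.slotEdge ov (F.slotOf i) := rfl
  have hrank : (F.toArr ov hov).rank i = F.slotRank ov (F.slotOf i) := rfl
  have hp := h.chart_place i
  rw [hedge, hrank] at hp
  generalize F.slotOf i = c at hl hedge hrank hp
  rcases c with ⟨e, k⟩ | v | ⟨e, b⟩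
  · rw [hp, slotEdge, slotRank, slotPoint, F.margin_eq_toGap s ov, ← F.units_eq_total s ov hov]
    congr 2
    push_cast
    ring
  · have h1 := F.outer_of_vertex ov hov hl
    have h2 := hfrom _ h1
    have h3 : ¬ (F.moving (ov v)).isSome := fun hc => by
      have h4 := F.atVertex_eq_none _ hc
      rw [hov, show F.atVertex v = some i from hl] at h4
      exact absurd h4 (by simp)
    have h5 : F.toGap s ov (ov v) = 0 := by
      rw [toGap, if_neg h3, if_pos (by rw [h1]; rfl)]
    rw [h5, zero_div] at h2
    rw [eq_endOf_of_edist (o := ov v) hedge (Subtype.ext h2), chart_endOf, hov]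
    rfl
  · have h1 := hfrom _ (F.outer_of_moving ov hl)
    have h2 : (F.moving (e, b)).isSome := Option.isSome_iff_exists.2 ⟨i, hl⟩
    rw [toGap, if_pos h2] at h1
    rw [chart, Arr.place_fst, hedge]
    cases b
    · change G.edgePoint e _ = G.edgePoint e (F.gap s (e, false) / F.units s e)
      rw [← h1]
      rfl
    · change G.edgePoint e _ = G.edgePoint e (1 - F.gap s (e, true) / F.units s e)
      rw [← h1]
      simp [edist]

end Face

/-- The lifts of points of the cube complex are fixed by `Lift.spread`. -/
theorem exists_lift_of_mem [Fintype E] (hV : ∀ v, ∃ o, G.head o = v) {x : Conf n G.Point}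
    (hx : x ∈ G.cubeComplex n) : ∃ z : G.Lift n, z.conf = x ∧ z.spread = z := by
  obtain ⟨F, s, rfl⟩ := hx
  choose ov hov using hV
  exact ⟨(F.isGap_toGap s ov hov).lift, Subtype.ext (funext (F.chart_place_toArr s ov hov)),
    IsGap.spread_lift _⟩

end CellGraph

/-! ### Transport from the retracted to the given configuration -/

namespace CellGraph

variable {V E : Type*} {G : CellGraph V E} {n : ℕ}

open Classical in
/-- The largest coordinate according to `t` among the tokens that are to the left of `p`
according to `y`. -/
noncomputable def below (y t : Fin n → E × unitInterval) (p : E × unitInterval) : unitInterval :=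
  Finset.univ.sup fun j => if (y j).1 = p.1 ∧ (y j).2 < p.2 then (t j).2 else 0

open Classical in
/-- The smallest coordinate according to `t` among the tokens that are to the right of `p`
according to `y`. -/
noncomputable def above (y t : Fin n → E × unitInterval) (p : E × unitInterval) : unitInterval :=
  Finset.univ.inf fun j => if (y j).1 = p.1 ∧ p.2 < (y j).2 then (t j).2 else 1

section BelowAbove

variable (y t : Fin n → E × unitInterval) (p : E × unitInterval)

theorem below_self_le : below y y p ≤ p.2 := by
  refine Finset.sup_le fun j _ => ?_
  split_ifs with h
  · exact h.2.le
  · exact unitInterval.nonneg'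

theorem le_above_self : p.2 ≤ above y y p := by
  refine Finset.le_inf fun j _ => ?_
  split_ifs with h
  · exact h.2.le
  · exact unitInterval.le_one'

theorem below_self_lt (h : 0 < p.2) : below y y p < p.2 := by
  refine (Finset.sup_lt_iff h).2 fun j _ => ?_
  split_ifs with hj
  · exact hj.2
  · exact h

theorem lt_above_self (h : p.2 < 1) : p.2 < above y y p := by
  refine (Finset.lt_inf_iff h).2 fun j _ => ?_
  split_ifs with hj
  · exact hj.2
  · exact h

/-- Every point of `[0,1]` differs from one of its ends, which makes one of the two inequalities
strict, even if `p` is itself a token. -/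
theorem below_self_lt_above_self : below y y p < above y y p := by
  rcases (show p.2 ≤ 1 from unitInterval.le_one').lt_or_eq with h | h
  · exact (below_self_le y p).trans_lt (lt_above_self y p h)
  · exact (below_self_lt y p (h ▸ zero_lt_one)).trans_le (le_above_self y p)

variable {y t p}

theorem le_below {j : Fin n} (h1 : (y j).1 = p.1) (h2 : (y j).2 < p.2) : (t j).2 ≤ below y t p := by
  classical
  refine le_trans ?_ (Finset.le_sup (Finset.mem_univ j))
  simp [h1, h2]

theorem above_le {j : Fin n} (h1 : (y j).1 = p.1) (h2 : p.2 < (y j).2) : above y t p ≤ (t j).2 := by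
  classical
  refine (Finset.inf_le (Finset.mem_univ j)).trans ?_
  simp [h1, h2]

theorem below_eq_zero (h : p.2 = 0) : below y t p = 0 := by
  refine le_antisymm (Finset.sup_le fun j _ => ?_) unitInterval.nonneg'
  rw [if_neg]
  rw [h]
  exact fun hc => absurd hc.2 (not_lt.2 unitInterval.nonneg')

theorem above_eq_one (h : p.2 = 1) : above y t p = 1 := by
  refine le_antisymm unitInterval.le_one' (Finset.le_inf fun j _ => ?_)
  rw [if_neg]
  rw [h]
  exact fun hc => absurd hc.2 (not_lt.2 unitInterval.le_one')

end BelowAbove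

namespace Lift

variable [Fintype E] (z : G.Lift n)

/-- The value at `p` of the map that is affine between consecutive tokens and takes the tokens of
the retracted configuration to the tokens of the given configuration. -/
noncomputable def transport (p : E × unitInterval) : E × unitInterval :=
  (p.1, projIcc 0 1 zero_le_one (below z.spread.1 z.1 p +
    (above z.spread.1 z.1 p - below z.spread.1 z.1 p) *
      ((p.2 - below z.spread.1 z.spread.1 p) /
        (above z.spread.1 z.spread.1 p - below z.spread.1 z.spread.1 p))))

/-- Fixing the ends makes the transport compatible with the gluing of the edges. -/
theorem transport_endOf (o : G.OrientedEdge) : z.transport (endOf o) = endOf o := by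
  obtain ⟨e, b⟩ := o
  refine Prod.ext rfl ?_
  cases b
  · have h : (endOf (e, false)).2 = 0 := rfl
    simp only [transport]
    rw [below_eq_zero h, below_eq_zero h, h]
    simp
  · have h : (endOf (e, true)).2 = 1 := rfl
    have h1 : below z.spread.1 z.spread.1 (endOf (e, true)) < 1 :=
      below_self_lt _ _ (h ▸ zero_lt_one)
    have h2 : (below z.spread.1 z.spread.1 (endOf (e, true)) : ℝ) < 1 := h1
    simp only [transport]
    rw [above_eq_one h, above_eq_one h, h, Icc.coe_one, div_self (by linarith)]
    simp

theorem transport_eq_self (hz : z.spread = z) (p : E × unitInterval) : z.transport p = p := by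
  refine Prod.ext rfl ?_
  have h1 : (below z.1 z.1 p : ℝ) < above z.1 z.1 p := below_self_lt_above_self z.1 p
  simp only [transport, hz]
  rw [mul_div_cancel₀ _ (by linarith), add_sub_cancel, projIcc_val]

/-- Ambiguous tokens stay at the ends of edges before and after `spread`, where they only contribute
the default values `0` to the supremum and `1` to the infimum. -/
theorem transport_congr {z z' : G.Lift n}
    (hfb : ∀ o, G.IsFree (G.head o) ∨ G.IsBranched (G.head o)) (h : z.conf = z'.conf)
    (p : E × unitInterval) : z.transport p = z'.transport p := by
  classical
  have key : ∀ (w w' : G.Lift n), (w' = w ∨ w' = w.spread) → ∀ (j : Fin n) (o : E × Bool),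
      w.1 j = endOf o → G.IsBranched (G.head o) →
      (if (w.spread.1 j).1 = p.1 ∧ (w.spread.1 j).2 < p.2 then (w'.1 j).2 else 0) = 0 ∧
      (if (w.spread.1 j).1 = p.1 ∧ p.2 < (w.spread.1 j).2 then (w'.1 j).2 else 1) = 1 := by
    intro w w' hw j o hj hb
    have h1 := w.spread_eq_of_endOf hj hb
    have h2 : w'.1 j = endOf o := by
      rcases hw with rfl | rfl
      · exact hj
      · exact h1.trans hj
    rw [h1, h2, hj]
    rcases edist_endOf_eq false o with h0 | h0
    · have h0 : (endOf o).2 = 0 := h0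
      simp [h0]
    · have h0 : (endOf o).2 = 1 := h0
      simp [h0, not_lt.2 unitInterval.le_one']
  have hb : ∀ (w w' : G.Lift n), ((w = z ∧ w' = z') ∨ (w = z.spread ∧ w' = z'.spread)) →
      below z.spread.1 w.1 p = below z'.spread.1 w'.1 p ∧
      above z.spread.1 w.1 p = above z'.spread.1 w'.1 p := by
    intro w w' hw
    refine ⟨Finset.sup_congr rfl fun j _ => ?_, Finset.inf_congr rfl fun j _ => ?_⟩ <;>
    · by_cases hj : z.1 j = z'.1 j
      · rw [spread_congr hfb h hj]
        rcases hw with ⟨rfl, rfl⟩ | ⟨rfl, rfl⟩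
        · rw [hj]
        · rw [spread_congr hfb h hj]
      · obtain ⟨o, o', h1, h2, h3, h4⟩ := exists_endOf_of_ne hfb h hj
        have k1 := key z w (by tauto) j o h1 h4
        have k2 := key z' w' (by tauto) j o' h2 (h3 ▸ h4)
        first | rw [k1.1, k2.1] | rw [k1.2, k2.2]
  obtain ⟨h1, h2⟩ := hb z z' (.inl ⟨rfl, rfl⟩)
  obtain ⟨h3, h4⟩ := hb z.spread z'.spread (.inr ⟨rfl, rfl⟩)
  simp only [transport]
  rw [h1, h2, h3, h4]

theorem chart_transport_congr {z z' : G.Lift n}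
    (hfb : ∀ o, G.IsFree (G.head o) ∨ G.IsBranched (G.head o)) (h : z.conf = z'.conf)
    {p p' : E × unitInterval} (hp : G.chart p = G.chart p') :
    G.chart (z.transport p) = G.chart (z'.transport p') := by
  rcases G.chart_eq_chart hp with rfl | ⟨o, o', rfl, rfl, -⟩
  · rw [transport_congr hfb h]
  · rw [transport_endOf, transport_endOf, hp]

/-- The transported point avoids all tokens, provided that the given point is not between a token
at a free vertex and that vertex. -/
theorem chart_transport_ne (hfb : ∀ o, G.IsFree (G.head o) ∨ G.IsBranched (G.head o))
    {p : E × unitInterval} (hp : ∀ i, G.chart p ≠ G.chart (z.spread.1 i))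
    (htrap : ∀ o, G.IsFree (G.head o) → ∀ i, z.1 i = endOf o → p.1 = o.1 →
      ¬ edist o.2 p.2 < edist o.2 (z.spread.1 i).2) (i : Fin n) :
    G.chart (z.transport p) ≠ G.chart (z.1 i) := by
  intro hc
  rcases eq_endOf_or_interior p with ⟨b, hb⟩ | hint
  -- The point is a fixed vertex. At a free vertex it would lie behind the retracted token, which is
  -- a trap; at a branched vertex the token has not moved and already violates `hp`.
  · rw [hb, transport_endOf] at hc
    obtain ⟨o', h2, h3⟩ : ∃ o', z.1 i = endOf o' ∧ G.head (p.1, b) = G.head o' := by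
      rcases G.chart_eq_chart hc with h | ⟨o, o', h1, h2, h3⟩
      · exact ⟨_, h.symm, rfl⟩
      · exact ⟨o', h2, endOf_injective h1 ▸ h3⟩
    rcases hfb (p.1, b) with hf | hbr
    · have := hf.eq_of_head rfl h3.symm
      subst this
      refine htrap (p.1, b) hf i h2 rfl ?_
      have h0 : edist b p.2 = 0 := by
        have := edist_endOf (p.1, b)
        rwa [← hb] at this
      simp only
      rw [h0]
      refine unitInterval.pos_iff_ne_zero.2 fun h1 => ?_
      have h2 : z.spread.1 i = endOf (p.1, b) :=
        eq_endOf_of_edist (by rw [spread_fst, h2]; rfl) h1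
      exact hf.not_isBranched (z.of_spread_eq_endOf h2).1
    · refine hp i ?_
      rw [z.spread_eq_of_endOf h2 (h3 ▸ hbr), ← hc, ← hb]
  · have hs0 : 0 < p.2 := hint.1
    have hs1 : p.2 < 1 := hint.2
    have hy1 : (below z.spread.1 z.spread.1 p : ℝ) < p.2 := below_self_lt _ p hs0
    have hy2 : (p.2 : ℝ) < above z.spread.1 z.spread.1 p := lt_above_self _ p hs1
    -- A token that retracts to the left of `p` but comes from the right end must have been at a
    -- free vertex, with `p` trapped behind it.
    have hlt1 : ∀ j, (z.1 j).1 = p.1 → (z.spread.1 j).2 < p.2 → (z.1 j).2 < 1 := by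
      intro j h1 h2
      by_contra hj
      have hj : z.1 j = endOf (p.1, true) :=
        Prod.ext h1 (le_antisymm unitInterval.le_one' (not_lt.1 hj))
      rcases hfb (p.1, true) with hf | hbr
      · exact htrap _ hf j hj rfl (unitInterval.symm_lt_symm.2 h2)
      · rw [z.spread_eq_of_endOf hj hbr, hj] at h2
        exact absurd h2 (not_lt.2 unitInterval.le_one')
    have hlt0 : ∀ j, (z.1 j).1 = p.1 → p.2 < (z.spread.1 j).2 → 0 < (z.1 j).2 := by
      intro j h1 h2
      by_contra hj
      have hj : z.1 j = endOf (p.1, false) :=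
        Prod.ext h1 (le_antisymm (not_lt.1 hj) unitInterval.nonneg')
      rcases hfb (p.1, false) with hf | hbr
      · exact htrap _ hf j hj rfl h2
      · rw [z.spread_eq_of_endOf hj hbr, hj] at h2
        exact absurd h2 (not_lt.2 unitInterval.nonneg')
    -- Without a trap the target interval is nondegenerate, so the image of `p` is strictly between
    -- consecutive tokens or ends and meets no token.
    have hab : below z.spread.1 z.1 p < above z.spread.1 z.1 p := by
      classical
      have h0 : (0 : unitInterval) < above z.spread.1 z.1 p := by
        refine (Finset.lt_inf_iff zero_lt_one).2 fun k _ => ?_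
        split_ifs with hk
        · exact hlt0 k hk.1 hk.2
        · exact zero_lt_one
      refine (Finset.sup_lt_iff h0).2 fun j _ => ?_
      split_ifs with hj
      · refine (Finset.lt_inf_iff (hlt1 j hj.1 hj.2)).2 fun k _ => ?_
        split_ifs with hk
        · exact (z.spread_lt_iff (hj.1.trans hk.1.symm)).1 (hj.2.trans hk.2)
        · exact hlt1 j hj.1 hj.2
      · exact h0
    have hab' : (below z.spread.1 z.1 p : ℝ) < above z.spread.1 z.1 p := hab
    set l : ℝ := (p.2 - below z.spread.1 z.spread.1 p) /
        (above z.spread.1 z.spread.1 p - below z.spread.1 z.spread.1 p) with hl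
    have hl0 : 0 < l := div_pos (by linarith) (by linarith)
    have hl1 : l < 1 := (div_lt_one (by linarith)).2 (by linarith)
    have hv1 : (below z.spread.1 z.1 p : ℝ) < below z.spread.1 z.1 p +
        (above z.spread.1 z.1 p - below z.spread.1 z.1 p) * l := by
      have := mul_pos (sub_pos.2 hab') hl0
      linarith
    have hv2 : below z.spread.1 z.1 p +
        (above z.spread.1 z.1 p - below z.spread.1 z.1 p) * l < above z.spread.1 z.1 p := by
      have := mul_lt_of_lt_one_right (sub_pos.2 hab') hl1
      linarith
    have hb0 := (below z.spread.1 z.1 p).2.1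
    have ha1 := (above z.spread.1 z.1 p).2.2
    have hT : ((z.transport p).2 : ℝ) = below z.spread.1 z.1 p +
        (above z.spread.1 z.1 p - below z.spread.1 z.1 p) * l := by
      simp only [transport]
      rw [← hl, projIcc_of_mem _ ⟨by linarith, by linarith⟩]
    have hzi := G.chart_eq_of_interior (p := z.transport p)
      ⟨by rw [hT]; linarith, by rw [hT]; linarith⟩ hc
    have he : (z.spread.1 i).1 = p.1 := by
      rw [spread_fst, ← hzi]
      rfl
    rw [hzi] at hT
    rcases lt_trichotomy (z.spread.1 i).2 p.2 with h | h | h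
    · have : ((z.1 i).2 : ℝ) ≤ below z.spread.1 z.1 p := le_below he h
      linarith
    · exact hp i (congrArg G.chart (Prod.ext he h).symm)
    · have : (above z.spread.1 z.1 p : ℝ) ≤ (z.1 i).2 := above_le he h
      linarith

section Continuity

variable [TopologicalSpace E] [DiscreteTopology E]

theorem continuous_spread_token (i : Fin n) : Continuous fun z : G.Lift n => z.spread.1 i :=
  (continuous_token i).comp continuous_spread

/-- The transport is continuous where it is applied to points that are not tokens. -/
theorem continuous_transport (S : Set (G.Lift n × (E × unitInterval)))
    (hS : ∀ w ∈ S, ∀ i, w.1.spread.1 i ≠ w.2) :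
    Continuous fun w : S => w.1.1.transport w.1.2 := by
  classical
  have hp : Continuous fun w : S => w.1.2 := continuous_snd.comp continuous_subtype_val
  have hp2 : Continuous fun w : S => w.1.2.2 := continuous_snd.comp hp
  have hy : ∀ j, Continuous fun w : S => w.1.1.spread.1 j := fun j =>
    (continuous_spread_token j).comp (continuous_fst.comp continuous_subtype_val)
  have hy2 : ∀ j, Continuous fun w : S => (w.1.1.spread.1 j).2 := fun j =>
    continuous_snd.comp (hy j)
  have ht2 : ∀ j, Continuous fun w : S => (w.1.1.1 j).2 := fun j =>
    continuous_snd.comp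
      ((continuous_token j).comp (continuous_fst.comp continuous_subtype_val))
  have hfst : ∀ j, IsClopen {w : S | (w.1.1.spread.1 j).1 = w.1.2.1} := fun j =>
    (isClopen_discrete {q : E × E | q.1 = q.2}).preimage
      ((continuous_fst.comp (hy j)).prodMk (continuous_fst.comp hp))
  have hne : ∀ (w : S) (j : Fin n), (w.1.1.spread.1 j).1 = w.1.2.1 →
      (w.1.1.spread.1 j).2 ≠ w.1.2.2 := fun w j h h' => hS w.1 w.2 j (Prod.ext h h')
  have hlt : ∀ j, IsClopen
      {w : S | (w.1.1.spread.1 j).1 = w.1.2.1 ∧ (w.1.1.spread.1 j).2 < w.1.2.2} := by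
    intro j
    have ho : IsOpen {w : S | (w.1.1.spread.1 j).2 < w.1.2.2} := isOpen_lt (hy2 j) hp2
    have hc : IsClosed {w : S | (w.1.1.spread.1 j).2 ≤ w.1.2.2} := isClosed_le (hy2 j) hp2
    refine ⟨?_, (hfst j).2.inter ho⟩
    convert (hfst j).1.inter hc using 1
    ext w
    exact and_congr_right fun h => ⟨le_of_lt, fun h' => lt_of_le_of_ne h' (hne w j h)⟩
  have hgt : ∀ j, IsClopen
      {w : S | (w.1.1.spread.1 j).1 = w.1.2.1 ∧ w.1.2.2 < (w.1.1.spread.1 j).2} := by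
    intro j
    have ho : IsOpen {w : S | w.1.2.2 < (w.1.1.spread.1 j).2} := isOpen_lt hp2 (hy2 j)
    have hc : IsClosed {w : S | w.1.2.2 ≤ (w.1.1.spread.1 j).2} := isClosed_le hp2 (hy2 j)
    refine ⟨?_, (hfst j).2.inter ho⟩
    convert (hfst j).1.inter hc using 1
    ext w
    exact and_congr_right fun h => ⟨le_of_lt, fun h' => lt_of_le_of_ne h' (hne w j h).symm⟩
  have hbt : Continuous fun w : S => (below w.1.1.spread.1 w.1.1.1 w.1.2 : ℝ) :=
    continuous_subtype_val.comp (Continuous.finset_sup_apply fun j _ =>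
      continuous_ite_of_isClopen (hlt j) (ht2 j) continuous_const)
  have hby : Continuous fun w : S => (below w.1.1.spread.1 w.1.1.spread.1 w.1.2 : ℝ) :=
    continuous_subtype_val.comp (Continuous.finset_sup_apply fun j _ =>
      continuous_ite_of_isClopen (hlt j) (hy2 j) continuous_const)
  have hat : Continuous fun w : S => (above w.1.1.spread.1 w.1.1.1 w.1.2 : ℝ) :=
    continuous_subtype_val.comp (Continuous.finset_inf_apply fun j _ =>
      continuous_ite_of_isClopen (hgt j) (ht2 j) continuous_const)
  have hay : Continuous fun w : S => (above w.1.1.spread.1 w.1.1.spread.1 w.1.2 : ℝ) :=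
    continuous_subtype_val.comp (Continuous.finset_inf_apply fun j _ =>
      continuous_ite_of_isClopen (hgt j) (hy2 j) continuous_const)
  have hs : Continuous fun w : S => (w.1.2.2 : ℝ) := continuous_subtype_val.comp hp2
  refine (continuous_fst.comp hp).prodMk (continuous_projIcc.comp ?_)
  refine hbt.add ((hat.sub hbt).mul ((hs.sub hby).div (hay.sub hby) fun w => ?_))
  have : (below w.1.1.spread.1 w.1.1.spread.1 w.1.2 : ℝ) <
    above w.1.1.spread.1 w.1.1.spread.1 w.1.2 := below_self_lt_above_self _ _
  linarith

end Continuity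

end Lift

/-! ### The retraction and the extension formula -/

section Retraction

variable [Fintype E] (hV : ∀ v, ∃ o, G.head o = v)

/-- The retraction of the configuration space to the cube complex. -/
noncomputable def retract (x : Conf n G.Point) : Conf n G.Point :=
  (Lift.conf_surjective hV x).choose.spread.conf

theorem retract_mem (x : Conf n G.Point) : retract hV x ∈ G.cubeComplex n :=
  Lift.conf_spread_mem _

theorem retract_conf (hfb : ∀ o, G.IsFree (G.head o) ∨ G.IsBranched (G.head o)) (z : G.Lift n) :
    retract hV z.conf = z.spread.conf :=
  Lift.conf_spread_congr hfb (Lift.conf_surjective hV z.conf).choose_spec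

theorem retract_eq_self (hfb : ∀ o, G.IsFree (G.head o) ∨ G.IsBranched (G.head o))
    {x : Conf n G.Point} (hx : x ∈ G.cubeComplex n) : retract hV x = x := by
  obtain ⟨z, rfl, hz⟩ := exists_lift_of_mem hV hx
  rw [retract_conf hV hfb, hz]

variable [TopologicalSpace E] [DiscreteTopology E]

theorem continuous_retract (hfb : ∀ o, G.IsFree (G.head o) ∨ G.IsBranched (G.head o)) :
    Continuous (retract hV : Conf n G.Point → _) := by
  refine (Lift.isQuotientMap_conf hV).continuous_iff.2 ?_
  have : retract hV ∘ Lift.conf = fun z : G.Lift n => z.spread.conf :=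
    funext (retract_conf hV hfb)
  rw [this]
  exact Lift.isProperMap_conf.continuous.comp Lift.continuous_spread

/-- An identifying function on the cube complex extends if it never takes a value between a token
on a free edge and the free vertex of that edge. -/
theorem extendsToConf_of_not_trapped (hV : ∀ v, ∃ o, G.head o = v)
    (hfb : ∀ o, G.IsFree (G.head o) ∨ G.IsBranched (G.head o))
    {f : G.cubeComplex n → G.Point} (hf : IsIdentifyingOn (G.cubeComplex n) f)
    (htrap : ∀ (z : G.Lift n) (o : G.OrientedEdge) (i : Fin n) (p : E × unitInterval),
      G.IsFree (G.head o) → z.1 i = endOf o → p.1 = o.1 → f ⟨_, z.conf_spread_mem⟩ = G.chart p →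
      ¬ edist o.2 p.2 < edist o.2 (z.spread.1 i).2) :
    ExtendsToConf (G.cubeComplex n) f := by
  -- Away from the retracted tokens it is locally constant which tokens bound the interval
  -- containing the point, so transport is continuous on `S`.
  let S : Set (Conf n G.Point × G.Point) := {w | ∀ i, w.2 ≠ (retract hV w.1).1 i}
  let lift (x : Conf n G.Point) : G.Lift n := (Lift.conf_surjective hV x).choose
  have hlift (x) : (lift x).conf = x := (Lift.conf_surjective hV x).choose_spec
  let coord (y : G.Point) : E × unitInterval := (G.chart_surjective hV y).choose
  have hcoord (y) : G.chart (coord y) = y := (G.chart_surjective hV y).choose_spec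
  let Φ : S → G.Point := fun w => G.chart ((lift w.1.1).transport (coord w.1.2))
  have hΦ : Continuous Φ := by
    refine continuous_of_lift hV S Φ ?_
    have h1 := Lift.continuous_transport (G := G) (n := n)
      (Prod.map Lift.conf G.chart ⁻¹' S) fun w hw i hc => hw i (by
        simp only [Prod.map_fst, Prod.map_snd]
        rw [retract_conf hV hfb, ← hc]
        rfl)
    convert G.continuous_chart.comp h1 using 1
    funext w
    exact Lift.chart_transport_congr hfb (hlift _) (hcoord _)
  have hmem (x : Conf n G.Point) : (x, f ⟨retract hV x, retract_mem hV x⟩) ∈ S :=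
    fun i => hf.2 _ i
  have hr : Continuous fun x : Conf n G.Point => f ⟨retract hV x, retract_mem hV x⟩ :=
    hf.1.comp ((continuous_retract hV hfb).subtype_mk _)
  have hval (z : G.Lift n) (p : E × unitInterval)
      (hp : G.chart p = f ⟨retract hV z.conf, retract_mem hV z.conf⟩) :
      Φ ⟨_, hmem z.conf⟩ = G.chart (z.transport p) :=
    Lift.chart_transport_congr hfb (hlift _) ((hcoord _).trans hp.symm)
  refine ⟨fun x => Φ ⟨_, hmem x⟩, ⟨hΦ.comp ((continuous_id.prodMk hr).subtype_mk _), ?_⟩, ?_⟩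
  · intro x i
    obtain ⟨z, rfl⟩ := Lift.conf_surjective hV x
    obtain ⟨p, hp⟩ := G.chart_surjective hV (f ⟨retract hV z.conf, retract_mem hV z.conf⟩)
    simp only
    rw [hval z p hp]
    have hfz : f ⟨_, z.conf_spread_mem⟩ = G.chart p := by
      rw [hp]
      congr 1
      exact Subtype.ext (retract_conf hV hfb z).symm
    refine z.chart_transport_ne hfb (fun j => ?_)
      (fun o ho j hj hpo => htrap z o j p ho hj hpo hfz) i
    rw [← hfz]
    exact hf.2 ⟨_, z.conf_spread_mem⟩ j
  · rintro ⟨x, hx⟩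
    obtain ⟨z, rfl, hz⟩ := exists_lift_of_mem hV hx
    obtain ⟨p, hp⟩ := G.chart_surjective hV (f ⟨retract hV z.conf, retract_mem hV z.conf⟩)
    simp only
    rw [hval z p hp, z.transport_eq_self hz, hp]
    congr 1
    exact Subtype.ext (retract_eq_self hV hfb hx)

end Retraction

end CellGraph

/-! ### Free edges and the necessity of extendability -/

namespace CellGraph

variable {V E : Type*} {G : CellGraph V E} {n : ℕ}

theorem edist_edist (b : Bool) (t : unitInterval) : edist b (edist b t) = t := by
  cases b <;> simp [edist]

open Classical in
/-- The distance from the other end on the free edge `e` with free vertex `G.head (e, b)`, extended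
by `0` to the rest of the graph. -/
noncomputable def edgeCoord (e : E) (b : Bool) : G.Point → ℝ
  | .vertex w => if w = G.head (e, b) then 1 else 0
  | .interior e' t => if e' = e then edist (!b) ⟨t, t.2.1.le, t.2.2.le⟩ else 0

section EdgeCoord

variable {e : E} {b : Bool}

open Classical in
-- By freeness only the end `(e, b)` sees the value `1`. The extension by `0` matches at the other
-- end of `e`, which makes the coordinate continuous on the graph.
theorem edgeCoord_chart (hf : G.IsFree (G.head (e, b))) (p : E × unitInterval) :
    edgeCoord e b (G.chart p) = if p.1 = e then (edist (!b) p.2 : ℝ) else 0 := by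
  rcases eq_endOf_or_interior p with ⟨b', hb⟩ | hi
  · have h1 : edgeCoord e b (G.chart p) = if G.head (p.1, b') = G.head (e, b) then 1 else 0 := by
      conv_lhs => rw [hb]
      rw [chart_endOf]
      rfl
    rw [h1]
    by_cases h : G.head (p.1, b') = G.head (e, b)
    · rw [if_pos h]
      have h2 := hf.eq_of_head h rfl
      rw [hb, h2, if_pos (by simp), edist_not_endOf]
      rfl
    · rw [if_neg h]
      split_ifs with he
      · have hbb : b' = !b := by
          by_contra hc
          exact h (by rw [he, Bool.not_eq_not.1 hc])
        have h3 := edist_endOf (p.1, b')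
        rw [← hb, hbb] at h3
        rw [h3]
        rfl
      · rfl
  · rw [chart_interior _ hi]
    rfl

theorem continuous_edgeCoord (hf : G.IsFree (G.head (e, b))) :
    Continuous (edgeCoord e b : G.Point → ℝ) := by
  classical
  refine G.continuous_point_iff.2 fun e' => ?_
  have : (fun t : unitInterval => edgeCoord e b (G.edgePoint e' t)) =
      fun t => if e' = e then (edist (!b) t : ℝ) else 0 :=
    funext fun t => edgeCoord_chart hf (e', t)
  rw [this]
  exact Continuous.if_const _ (continuous_subtype_val.comp (continuous_edist _)) continuous_const

theorem edgeCoord_le_one (y : G.Point) : edgeCoord e b y ≤ 1 := by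
  rcases y with w | ⟨e', t⟩ <;> simp only [edgeCoord] <;> split_ifs
  · exact le_rfl
  · exact zero_le_one
  · exact (edist _ _).2.2
  · exact zero_le_one

theorem eq_chart_of_edgeCoord_pos (hV : ∀ v, ∃ o, G.head o = v) (hf : G.IsFree (G.head (e, b)))
    {y : G.Point} (hy : 0 < edgeCoord e b y) :
    ∃ t : unitInterval, y = G.chart (e, t) ∧ (edist (!b) t : ℝ) = edgeCoord e b y := by
  classical
  obtain ⟨⟨e', t⟩, rfl⟩ := G.chart_surjective hV y
  rw [edgeCoord_chart hf] at hy ⊢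
  split_ifs at hy ⊢ with h
  · obtain rfl : e' = e := h
    exact ⟨t, rfl, rfl⟩
  · exact absurd hy (lt_irrefl _)

theorem chart_mem_closedEdge (e : E) (t : unitInterval) : G.chart (e, t) ∈ G.closedEdge e :=
  ⟨t, t.2, rfl⟩

theorem isClosed_closedEdge (e : E) : IsClosed (G.closedEdge e) := by
  let _ : TopologicalSpace E := ⊥
  have : DiscreteTopology E := ⟨rfl⟩
  have h : G.closedEdge e = G.chart '' {p | p.1 = e} := by
    ext y
    constructor
    · rintro ⟨t, ht, rfl⟩
      exact ⟨(e, ⟨t, ht⟩), rfl, rfl⟩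
    · rintro ⟨⟨e', t⟩, rfl, rfl⟩
      exact chart_mem_closedEdge _ t
  rw [h]
  exact G.isClosedMap_chart _ ((isClosed_discrete {e}).preimage continuous_fst)

end EdgeCoord

theorem isEndpoint_iff {v : V} {e : E} : G.IsEndpoint v e ↔ ∃ b, G.head (e, b) = v := by
  simp [IsEndpoint, head]

/-- A vertex of the cube complex that occupies the branched vertex of a free edge and has no token
on that edge: the other tokens are not on the edge. -/
theorem Face.vertexConf_ne_chart {e : E} {b : Bool} {F : G.Face n} (hF : F.dim = 0) [Finite E]
    (hu : G.IsFree (G.head (e, b))) {i j : Fin n} (hi : F.atVertex (G.head (e, !b)) = some i)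
    (he : F.onEdge e = []) (hij : j ≠ i) (t : unitInterval) :
    F.vertexConf.1 j ≠ G.chart (e, t) := by
  have hmov : ∀ o, F.moving o = none := by
    intro o
    by_contra hc
    have h1 : (F.moving o).isSome := Option.isSome_iff_ne_none.2 hc
    have : Nonempty {o : G.OrientedEdge // (F.moving o).isSome} := ⟨⟨o, h1⟩⟩
    exact (Nat.card_pos (α := {o : G.OrientedEdge // (F.moving o).isSome})).ne' hF
  have hl := F.label_slotOf j
  change F.slotPoint _ (F.slotOf j) ≠ _
  generalize F.slotOf j = c at hl
  rcases c with ⟨e', k⟩ | v | o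
  · obtain ⟨h1, h2⟩ := F.slotPoint_inl (fun _ => 0) ⟨e', k⟩
    rw [h2]
    rcases eq_endOf_or_interior (e, t) with ⟨b', hb⟩ | hint
    · rw [hb, chart_endOf]
      simp
    · rw [chart_interior _ hint]
      intro hc
      simp only [Point.interior.injEq] at hc
      obtain ⟨rfl, -⟩ := hc
      have := k.2
      simp [he] at this
  · intro hc
    rcases eq_endOf_or_interior (e, t) with ⟨b', hb⟩ | hint
    · rw [hb, chart_endOf] at hc
      simp only [Face.slotPoint, Point.vertex.injEq] at hc
      have hl : F.atVertex v = some j := hl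
      by_cases hbb : b' = b
      · subst hbb
        have := F.atVertex_branched v (by rw [hl]; rfl)
        exact hu.not_isBranched (hc ▸ this)
      · have : b' = !b := by
          by_contra h
          exact hbb (Bool.not_eq_not.1 h)
        subst this
        rw [hc] at hl
        exact hij (Option.some_inj.1 (hl.symm.trans hi))
    · rw [chart_interior _ hint] at hc
      cases hc
  · have hl : F.moving o = some j := hl
    rw [hmov] at hl
    cases hl

/-- Restrictions of identifying functions on the configuration space are extendable. -/
theorem isExtendable_of_extendsToConf [Finite E] (hV : ∀ v, ∃ o, G.head o = v)
    {A : Set (Conf n G.Point)} (hA : G.zeroSkeleton n ⊆ A)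
    {f : A → G.Point} (hf : ExtendsToConf A f) : IsExtendable A hA f := by
  classical
  rintro ⟨e, u, v, F, hF, hue, hu, hve, hv, hFv, hFe, hfe⟩
  obtain ⟨b, rfl⟩ := isEndpoint_iff.1 hue
  obtain ⟨b', rfl⟩ := isEndpoint_iff.1 hve
  have hb' : b' = !b := by
    by_contra hc
    rw [Bool.not_eq_not.1 hc] at hv
    exact hu.not_isBranched hv
  subst hb'
  obtain ⟨i, hi⟩ := Option.isSome_iff_exists.1 hFv
  obtain ⟨g, ⟨hgc, hgi⟩, hgf⟩ := hf
  -- The token at the branched vertex travels along `P` to the free vertex; no other token is on the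
  -- closed edge.
  let P (t : unitInterval) : G.Point := G.chart (e, edist (!b) t)
  have hP0 : P 0 = F.vertexConf.1 i := by
    have h1 : F.vertexConf.1 i = .vertex (G.head (e, !b)) := by
      change F.slotPoint _ (F.slotOf i) = _
      rw [F.slotOf_eq (c := .inr (.inl _)) hi]
      rfl
    rw [h1, ← chart_endOf]
    change G.chart _ = _
    congr 1
    exact eq_endOf_of_edist rfl (edist_edist _ _)
  have hinj (t : unitInterval) : Function.Injective (Function.update F.vertexConf.1 i (P t)) := by
    intro j k hjk
    by_cases hj : j = i <;> by_cases hk : k = i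
    · rw [hj, hk]
    · subst hj
      rw [Function.update_self, Function.update_of_ne hk] at hjk
      exact absurd hjk.symm (Face.vertexConf_ne_chart hF hu hi hFe hk _)
    · subst hk
      rw [Function.update_self, Function.update_of_ne hj] at hjk
      exact absurd hjk (Face.vertexConf_ne_chart hF hu hi hFe hj _)
    · rw [Function.update_of_ne hj, Function.update_of_ne hk] at hjk
      exact F.vertexConf.2 hjk
  let x (t : unitInterval) : Conf n G.Point := ⟨_, hinj t⟩
  have hPc : Continuous P := (G.continuous_edgePoint e).comp (continuous_edist _)
  have hx : Continuous x := Continuous.subtype_mk (continuous_const.update i hPc) _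
  have hx0 : x 0 = F.vertexConf := Subtype.ext (by
    change Function.update _ _ _ = _
    rw [hP0, Function.update_eq_self])
  -- This is the lead of the value over the travelling token. It is positive at the start, since the
  -- value is on `e` but not at the branched vertex, and at most `0` at the end.
  have hφ : Continuous fun t : unitInterval => edgeCoord e b (g (x t)) - t :=
    ((continuous_edgeCoord hu).comp (hgc.comp hx)).sub continuous_subtype_val
  have hxi (t : unitInterval) : g (x t) ≠ P t := by
    have := hgi (x t) i
    rwa [show (x t).1 i = P t from Function.update_self ..] at this
  obtain ⟨t0, ht0, hft0⟩ := hfe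
  have hg0 : g (x 0) = G.chart (e, ⟨t0, ht0⟩) := by
    rw [hx0, hgf ⟨F.vertexConf, hA ⟨F, hF, rfl⟩⟩, ← hft0]
    rfl
  have h0 : 0 < edgeCoord e b (g (x 0)) := by
    rw [hg0, edgeCoord_chart hu, if_pos rfl]
    refine unitInterval.pos_iff_ne_zero.2 fun hc => hxi 0 ?_
    rw [hg0]
    change _ = G.chart _
    congr 1
    refine Prod.ext rfl (edist_injective (!b) ?_)
    rw [edist_edist]
    exact hc
  obtain ⟨t, ht⟩ : (0 : ℝ) ∈ range fun t : unitInterval => edgeCoord e b (g (x t)) - t := by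
    refine mem_range_of_exists_le_of_exists_ge hφ ⟨1, ?_⟩ ⟨0, ?_⟩
    · have := edgeCoord_le_one (e := e) (b := b) (g (x 1))
      simp only [Icc.coe_one]
      linarith
    · simp only [Icc.coe_zero]
      linarith
  have ht : edgeCoord e b (g (x t)) = t := sub_eq_zero.1 ht
  -- Coordinate `0` does not locate a point on `e`, so a collision can be concluded only for
  -- positive `t`.
  rcases eq_or_ne t 0 with rfl | htne
  · rw [ht] at h0
    exact lt_irrefl _ h0
  · have htpos : (0 : ℝ) < t := unitInterval.pos_iff_ne_zero.2 htne
    obtain ⟨t', h1, h2⟩ := eq_chart_of_edgeCoord_pos hV hu (ht.symm ▸ htpos)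
    refine hxi t ?_
    rw [h1]
    change _ = G.chart _
    congr 1
    refine Prod.ext rfl (edist_injective (!b) ?_)
    rw [edist_edist]
    exact Subtype.ext (h2.trans ht)

/-! ### Sufficiency: emptying a free edge -/

section Trap

variable {A : Arr E n} {γ : G.OrientedEdge → ℝ}

theorem isGap_one (G : CellGraph V E) (A : Arr E n) : IsGap G A fun _ => 1 where
  nonneg _ := zero_le_one
  le_one _ := le_rfl
  branched _ h := absurd h (lt_irrefl _)
  unique _ _ h := absurd h (lt_irrefl _)
  count_pos _ h := absurd h (lt_irrefl _)
  two_le _ h := absurd h (lt_irrefl _)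

/-- Interpolation between given gaps and gaps of full size. -/
def interp (γ : G.OrientedEdge → ℝ) (t : unitInterval) (o : G.OrientedEdge) : ℝ :=
  1 - t * (1 - γ o)

theorem interp_zero (γ : G.OrientedEdge → ℝ) : interp γ 0 = fun _ => 1 := by
  funext o
  simp [interp]

theorem interp_one (γ : G.OrientedEdge → ℝ) : interp γ 1 = γ := by
  funext o
  simp [interp]

/-- Interpolating with full gaps shortens a gap only where `γ` is already short, so all conditions
are inherited. -/
theorem IsGap.interp (h : IsGap G A γ) (t : unitInterval) : IsGap G A (interp γ t) := by
  have hlt : ∀ o, CellGraph.interp γ t o < 1 → γ o < 1 := by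
    intro o ho
    by_contra hc
    have h1 : γ o = 1 := le_antisymm (h.le_one o) (not_lt.1 hc)
    simp [CellGraph.interp, h1] at ho
  refine ⟨fun o => ?_, fun o => ?_, fun o ho => h.branched o (hlt o ho),
    fun o o' ho ho' => h.unique o o' (hlt o ho) (hlt o' ho'),
    fun o ho => h.count_pos o (hlt o ho), fun e he he' => h.two_le e (hlt _ he) (hlt _ he')⟩
  · have h1 := mul_le_one₀ t.2.2 (sub_nonneg.2 (h.le_one o)) (by linarith [h.nonneg o])
    unfold CellGraph.interp
    linarith
  · have h1 := mul_nonneg t.2.1 (sub_nonneg.2 (h.le_one o))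
    unfold CellGraph.interp
    linarith

theorem continuous_interp (γ : G.OrientedEdge → ℝ) (o : G.OrientedEdge) :
    Continuous fun t : unitInterval => interp γ t o := by
  unfold interp
  fun_prop

theorem IsGap.continuous_interp_lift [TopologicalSpace E] (h : IsGap G A γ) :
    Continuous fun t : unitInterval => (h.interp t).lift := by
  refine Continuous.subtype_mk (continuous_pi fun i => ?_) _
  refine continuous_const.prodMk (continuous_projIcc.comp ?_)
  refine Continuous.div ((continuous_interp γ _).add continuous_const) ?_
    fun t => ((h.interp t).total_pos _).ne'
  exact (((continuous_interp γ _).add (continuous_interp γ _)).add continuous_const).sub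
    continuous_const

variable {f : G.cubeComplex n → G.Point} {e : E} {b : Bool}

/-- A positive coordinate determines the point on `e`, so equality would be a collision with the
token `l`. -/
theorem IsGap.edgeCoord_ne (hV : ∀ v, ∃ o, G.head o = v) (hu : G.IsFree (G.head (e, b)))
    (hf : IsIdentifyingOn (G.cubeComplex n) f) (h : IsGap G A γ) {l : Fin n} (hl : A.edge l = e)
    (hpos : 0 < edist (!b) (h.lift.1 l).2) :
    edgeCoord e b (f ⟨_, h.conf_lift_mem⟩) ≠ edist (!b) (h.lift.1 l).2 := by
  intro hc
  have hpos' : (0 : ℝ) < edist (!b) (h.lift.1 l).2 := hpos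
  obtain ⟨t, h1, h2⟩ := eq_chart_of_edgeCoord_pos hV hu (hc.symm ▸ hpos')
  refine hf.2 ⟨_, h.conf_lift_mem⟩ l (h1.trans ?_)
  change _ = G.chart (h.lift.1 l)
  congr 1
  exact Prod.ext hl.symm (edist_injective (!b) (Subtype.ext (h2.trans hc)))

theorem IsGap.edist_interp_pos (h : IsGap G A γ) {t : unitInterval} (ht : t < 1) (c : Bool)
    (l : Fin n) : 0 < edist c ((h.interp t).lift.1 l).2 := by
  have ht' : (t : ℝ) < 1 := ht
  have h1 : 0 < CellGraph.interp γ t (A.edge l, c) := by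
    have h2 := mul_le_of_le_one_right t.2.1 (show 1 - γ (A.edge l, c) ≤ 1 by
      linarith [h.nonneg (A.edge l, c)])
    unfold CellGraph.interp
    linarith
  have h3 : (0 : ℝ) < edist c ((h.interp t).lift.1 l).2 := by
    rw [(h.interp t).edist_lift]
    have := (h.interp t).total_pos (A.edge l)
    positivity
  exact h3

open Classical in
/-- The gaps for which exactly one token is at a vertex, namely at the head of `o`. -/
noncomputable def closedGap (o : E × Bool) (o' : E × Bool) : ℝ := if o' = o then 0 else 1

theorem closedGap_self (o : E × Bool) : closedGap o o = 0 := if_pos rfl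

theorem closedGap_of_ne {o o' : E × Bool} (h : o' ≠ o) : closedGap o o' = 1 := if_neg h

theorem closedGap_eq (o o' : E × Bool) : closedGap o o' = 0 ∨ closedGap o o' = 1 := by
  unfold closedGap
  split_ifs <;> simp

theorem isGap_closedGap {o : G.OrientedEdge} (hb : G.IsBranched (G.head o))
    (hA : 0 < A.count o.1) : IsGap G A (closedGap o) := by
  have hlt : ∀ o', closedGap o o' < 1 → o' = o := by
    intro o' h
    by_contra hc
    rw [closedGap_of_ne hc] at h
    exact lt_irrefl _ h
  refine ⟨fun o' => ?_, fun o' => ?_, fun o' h => hlt o' h ▸ hb,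
    fun o1 o2 h1 h2 _ => (hlt _ h1).trans (hlt _ h2).symm, fun o' h => hlt o' h ▸ hA,
    fun e' h1 h2 => ?_⟩
  · rcases closedGap_eq o o' with h | h <;> rw [h]
    exact zero_le_one
  · rcases closedGap_eq o o' with h | h <;> rw [h]
    exact zero_le_one
  · have := (hlt _ h1).trans (hlt _ h2).symm
    simp at this

variable [Fintype E]

/-- Whether the value of an identifying function is between the token `l` and the free vertex of
its edge does not depend on the sizes of the gaps. -/
theorem IsGap.trapped_iff (hV : ∀ v, ∃ o, G.head o = v) (hu : G.IsFree (G.head (e, b)))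
    (hf : IsIdentifyingOn (G.cubeComplex n) f) (h : IsGap G A γ) {l : Fin n} (hl : A.edge l = e)
    (hpos : 0 < edist (!b) (h.lift.1 l).2) :
    (edist (!b) (h.lift.1 l).2 : ℝ) < edgeCoord e b (f ⟨_, h.conf_lift_mem⟩) ↔
    (edist (!b) ((isGap_one G A).lift.1 l).2 : ℝ) <
      edgeCoord e b (f ⟨_, (isGap_one G A).conf_lift_mem⟩) := by
  let _ : TopologicalSpace E := ⊥
  have : DiscreteTopology E := ⟨rfl⟩
  -- The membership proof is an argument so that equal lifts at the two ends of the interpolation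
  -- can be substituted for each other.
  let val (z : G.Lift n) (hz : z.conf ∈ G.cubeComplex n) : ℝ :=
    edgeCoord e b (f ⟨_, hz⟩) - edist (!b) (z.1 l).2
  have hval {z z' : G.Lift n} (hzz' : z = z') (hz : z.conf ∈ G.cubeComplex n)
      (hz' : z'.conf ∈ G.cubeComplex n) : val z hz = val z' hz' := by
    subst hzz'
    rfl
  let φ (t : unitInterval) : ℝ := val _ (h.interp t).conf_lift_mem
  have hφ : Continuous φ := by
    refine Continuous.sub ((continuous_edgeCoord hu).comp (hf.1.comp
      (Continuous.subtype_mk (Lift.isProperMap_conf.continuous.comp h.continuous_interp_lift) _)))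
      (continuous_subtype_val.comp ((Lift.continuous_edist_token _ l).comp
        h.continuous_interp_lift))
  have h1 : φ 1 = edgeCoord e b (f ⟨_, h.conf_lift_mem⟩) - edist (!b) (h.lift.1 l).2 :=
    hval (Subtype.ext (congrArg A.place (interp_one γ))) _ _
  have h0 : φ 0 = edgeCoord e b (f ⟨_, (isGap_one G A).conf_lift_mem⟩) -
      edist (!b) ((isGap_one G A).lift.1 l).2 :=
    hval (Subtype.ext (congrArg A.place (interp_zero γ))) _ _
  -- A zero would be a collision with `l`. For `t < 1` all gaps are positive and `l` is off the
  -- branched end; at `t = 1` this is the hypothesis `hpos`.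
  have hne : (0 : ℝ) ∉ range φ := by
    rintro ⟨t, ht⟩
    rcases (show t ≤ 1 from unitInterval.le_one').lt_or_eq with h2 | rfl
    · exact (h.interp t).edgeCoord_ne hV hu hf hl (h.edist_interp_pos h2 _ l) (sub_eq_zero.1 ht)
    · rw [h1] at ht
      exact h.edgeCoord_ne hV hu hf hl hpos (sub_eq_zero.1 ht)
  refine (sub_pos.symm.trans (iff_of_eq (congrArg (0 < ·) h1.symm))).trans
    (Iff.trans ?_ ((iff_of_eq (congrArg (0 < ·) h0)).trans sub_pos))
  constructor
  · intro h2
    by_contra hc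
    exact hne (mem_range_of_exists_le_of_exists_ge hφ ⟨0, not_lt.1 hc⟩ ⟨1, h2.le⟩)
  · intro h2
    by_contra hc
    exact hne (mem_range_of_exists_le_of_exists_ge hφ ⟨1, not_lt.1 hc⟩ ⟨0, h2.le⟩)

/-- If an extendable identifying function took a value beyond the last token of a free edge, then
the tokens could be moved out of the edge one by one, and the value would stay on the edge. -/
theorem not_trapped_one (hV : ∀ v, ∃ o, G.head o = v)
    (hfb : ∀ o, G.IsFree (G.head o) ∨ G.IsBranched (G.head o))
    (hu : G.IsFree (G.head (e, b))) (hv : G.IsBranched (G.head (e, !b)))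
    (hf : IsIdentifyingOn (G.cubeComplex n) f)
    (hext : IsExtendable (G.cubeComplex n) (G.zeroSkeleton_subset n) f) (A : Arr E n) (l : Fin n)
    (hl : A.edge l = e) (hr : A.rankFrom b l = 0) :
    ¬ (edist (!b) ((isGap_one G A).lift.1 l).2 : ℝ) <
      edgeCoord e b (f ⟨_, (isGap_one G A).conf_lift_mem⟩) := by
  classical
  induction hm : A.count e using Nat.strong_induction_on generalizing A with
  | _ m ih =>
  intro htrap
  have hlt : A.rank l < A.count e := hl ▸ A.rank_lt l
  have hrn := A.rankFrom_not b l
  rw [hr, hl, hm] at hrn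
  -- The token nearest to the branched vertex is moved there, all other end gaps remain full.
  have h := isGap_closedGap (G := G) (A := A) (o := (e, !b)) hv (by simp only; omega)
  by_cases hm1 : m = 1
  -- Here `l` itself reaches the branched vertex, where `trapped_iff` no longer applies. The value
  -- is on `e` for `t < 1`, and at `t = 1` because the closed edge is closed.
  · have hmem : ∀ t : unitInterval, f ⟨_, (h.interp t).conf_lift_mem⟩ ∈ G.closedEdge e := by
      let _ : TopologicalSpace E := ⊥
      have : DiscreteTopology E := ⟨rfl⟩
      have hc : Continuous fun t : unitInterval =>
          f ⟨_, (h.interp t).conf_lift_mem⟩ := hf.1.comp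
        (Continuous.subtype_mk (Lift.isProperMap_conf.continuous.comp h.continuous_interp_lift) _)
      have hcl : IsClosed {t : unitInterval | f ⟨_, (h.interp t).conf_lift_mem⟩ ∈
          G.closedEdge e} := (isClosed_closedEdge e).preimage hc
      have hsub : Iio 1 ⊆ {t : unitInterval | f ⟨_, (h.interp t).conf_lift_mem⟩ ∈
          G.closedEdge e} := by
        intro t ht
        have hp := h.edist_interp_pos ht (!b) l
        have h1 := ((h.interp t).trapped_iff hV hu hf hl hp).2 htrap
        have hp' : (0 : ℝ) < edist (!b) ((h.interp t).lift.1 l).2 := hp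
        obtain ⟨s, hs, -⟩ := eq_chart_of_edgeCoord_pos hV hu (hp'.trans h1)
        rw [mem_ofPred_eq, hs]
        exact chart_mem_closedEdge e s
      have hcc := hcl.closure_subset_iff.2 hsub
      have hne : (Iio (1 : unitInterval)).Nonempty := ⟨0, mem_Iio.2 zero_lt_one⟩
      exact fun t => hcc (closure_Iio' hne ▸ show t ∈ Iic 1 from unitInterval.le_one')
    have h01 := closedGap_eq (e, !b)
    refine hext ⟨e, G.head (e, b), G.head (e, !b), h.face, h.dim_face h01,
      isEndpoint_iff.2 ⟨_, rfl⟩, hu, isEndpoint_iff.2 ⟨_, rfl⟩, hv, ?_, ?_, ?_⟩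
    · refine Option.isSome_iff_exists.2 ⟨l, h.vertexToken_eq_some.2 ⟨(e, !b), rfl,
        closedGap_self _, A.first_eq_some.2 ⟨hl, ?_⟩⟩⟩
      simp only
      omega
    · refine List.eq_nil_of_length_eq_zero ((IsGap.length_inner A _ e).trans ?_)
      have : IsGap.slack (closedGap (e, !b)) (e, !b) = 1 := by
        simp [IsGap.slack, closedGap_self]
      cases b <;> simp only [Bool.not_false, Bool.not_true] at this ⊢ <;> omega
    · convert hmem 1 using 3
      rw [h.vertexConf_face h01]
      congr! 2
      exact (interp_one _).symm
  · obtain ⟨i, hi, hir⟩ := A.rankFrom_surj (!b) (e := e) (k := 0) (by omega)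
    have hil : i ≠ l := by
      rintro rfl
      omega
    have hzi : h.lift.1 i = endOf (e, !b) := by
      refine eq_endOf_of_edist hi (Subtype.ext ?_)
      refine (h.edist_lift (!b) i).trans ?_
      rw [hi, hir, closedGap_self]
      simp
    have hpos : 0 < edist (!b) (h.lift.1 l).2 := by
      have h1 : (0 : ℝ) < edist (!b) (h.lift.1 l).2 := by
        have h2 : (0 : ℝ) < A.rankFrom (!b) l := by
          exact_mod_cast (by omega : 0 < A.rankFrom (!b) l)
        rw [h.edist_lift, hl, closedGap_self, zero_add]
        exact div_pos h2 (h.total_pos e)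
      exact h1
    have htrap' := (h.trapped_iff hV hu hf hl hpos).2 htrap
    -- Another end at the branched vertex; it is not on `e`, whose other end is the free vertex.
    obtain ⟨o, ho, hone⟩ := hv.exists_ne (e, !b)
    have hoe : o.1 ≠ e := by
      intro hc
      have h1 : o = (e, b) := by
        refine Prod.ext hc ?_
        by_contra hob
        refine hone (Prod.ext hc ?_)
        by_contra hob'
        exact hob (Bool.not_eq_not.1 hob')
      rw [h1] at ho
      exact hu.head_flip_ne ho.symm
    have hchart : G.chart ∘ Function.update h.lift.1 i (endOf o) = G.chart ∘ h.lift.1 := by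
      funext j
      by_cases hj : j = i
      · subst hj
        simp only [Function.comp_apply, Function.update_self]
        rw [hzi, chart_endOf, chart_endOf, ho]
      · simp only [Function.comp_apply, Function.update_of_ne hj]
    -- The same configuration, with the token at the branched vertex recorded on `o`. This lowers
    -- the count on `e` but leaves `l` the token nearest to the free vertex.
    let z : G.Lift n := ⟨Function.update h.lift.1 i (endOf o), hchart ▸ h.lift.2⟩
    have hzconf : h.lift.conf = z.conf := Subtype.ext hchart.symm
    have hz : z.spread = z := Lift.spread_eq_of_conf_eq hfb hzconf h.spread_lift
    have hzne : ∀ j, j ≠ i → z.1 j = h.lift.1 j := fun j hj => Function.update_of_ne hj _ _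
    have hzi' : z.1 i = endOf o := Function.update_self ..
    have hze : ∀ j, (z.1 j).1 = e → j ≠ i := by
      rintro j hj rfl
      rw [hzi'] at hj
      exact hoe hj
    have hzl : (z.1 l).1 = e := by
      rw [hzne l hil.symm]
      exact hl
    have hlift : z.isGap_gap.lift = z := hz
    have hcount : z.arr.count e < m := by
      have h1 : h.lift.arr.count e = m := by rw [h.arr_lift, hm]
      rw [← h1]
      change z.tokenCount e < h.lift.tokenCount e
      rw [Lift.tokenCount, Lift.tokenCount]
      refine Finset.card_lt_card ⟨fun j hj => ?_, fun hs => ?_⟩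
      · simp only [Finset.mem_filter, Finset.mem_univ, true_and] at hj ⊢
        rwa [← hzne j (hze j hj)]
      · have h2 := hs (Finset.mem_filter.2 ⟨Finset.mem_univ i, hi⟩)
        simp only [Finset.mem_filter, Finset.mem_univ, true_and] at h2
        exact hze i h2 rfl
    have hrank : z.arr.rankFrom b l = 0 := by
      by_contra hc
      have h1 := z.arr.rankFrom_not b l
      obtain ⟨j, hj, hjr⟩ := z.arr.rankFrom_surj b (e := z.arr.edge l) (k := 0) (by omega)
      have h2 := (z.rankFrom_lt_iff b hj).1 (by omega)
      have hje : (z.1 j).1 = e := hj.trans hzl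
      have hji := hze j hje
      rw [hzne j hji] at h2 hje
      rw [hzne l hil.symm] at h2
      have h3 := (h.edist_place_lt b (hje.trans hl.symm)).1 h2
      omega
    refine ih _ hcount z.arr hzl hrank rfl
      ((z.isGap_gap.trapped_iff hV hu hf hzl ?_).1 ?_)
    · rw [hlift, hzne l hil.symm]
      exact hpos
    · convert htrap' using 3
      · rw [hlift, hzne l hil.symm]
      · congr 1
        rw [hlift, hzconf]

end Trap

/-- Extendable identifying functions on the cube complex extend to the configuration space. -/
theorem extendsToConf_of_isExtendable [Fintype E] [ConnectedSpace G.Point]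
    (hdeg : ∀ v, G.degree v ≠ 2) (hb : ∃ v, G.IsBranched v)
    {f : G.cubeComplex n → G.Point} (hf : IsIdentifyingOn (G.cubeComplex n) f)
    (hext : IsExtendable (G.cubeComplex n) (G.zeroSkeleton_subset n) f) :
    ExtendsToConf (G.cubeComplex n) f := by
  have hV (v : V) : ∃ o, G.head o = v := exists_head_of_degree (degree_ne_zero hb v)
  have hfb := isFree_or_isBranched hdeg
  let _ : TopologicalSpace E := ⊥
  have : DiscreteTopology E := ⟨rfl⟩
  refine extendsToConf_of_not_trapped hV hfb hf ?_
  rintro z ⟨e, b⟩ i ⟨e', t⟩ hu hi he hfp hlt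
  obtain rfl : e' = e := he
  have hv := hu.isBranched_flip hdeg hb
  have hie : z.arr.edge i = e' := congrArg Prod.fst hi
  refine not_trapped_one hV hfb hu hv hf hext z.arr i hie (z.rankFrom_eq_zero_of_endOf hi)
    ((z.isGap_gap.trapped_iff hV hu hf hie ?_).1 ?_)
  -- If `spread` put the token at the branched end, it would have been there before, but it is at
  -- the free end.
  · refine unitInterval.pos_iff_ne_zero.2 fun h0 => ?_
    have h1 := (z.of_spread_eq_endOf (o := (e', !b)) (eq_endOf_of_edist hie h0)).2
    have := endOf_injective (hi.symm.trans h1)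
    simp at this
  · classical
    have h1 : edgeCoord e' b (f ⟨_, z.conf_spread_mem⟩) = edist (!b) t := by
      rw [hfp, edgeCoord_chart hu, if_pos rfl]
    have h2 : (edist b t : ℝ) < edist b (z.spread.1 i).2 := hlt
    refine lt_of_lt_of_eq ?_ h1.symm
    rw [coe_edist_not, coe_edist_not]
    change 1 - (edist b (z.spread.1 i).2 : ℝ) < _
    linarith

end CellGraph

theorem mainTheorem6 {V E : Type*} [Finite V] [Finite E] (G : CellGraph V E)
    [ConnectedSpace G.Point] (hdeg : ∀ v, G.degree v ≠ 2) (hbranched : ∃ v, G.IsBranched v)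
    (n : ℕ) :
    (∀ f : G.cubeComplex n → G.Point, IsIdentifyingOn (G.cubeComplex n) f →
      (ExtendsToConf (G.cubeComplex n) f ↔
        CellGraph.IsExtendable (G.cubeComplex n) (G.zeroSkeleton_subset n) f)) ∧
    (∀ (A : Set (Conf n G.Point)) (h0 : G.zeroSkeleton n ⊆ A), A ⊆ G.cubeComplex n →
      ∀ f : A → G.Point, IsIdentifyingOn A f → ExtendsToConf A f →
        CellGraph.IsExtendable A h0 f) ∧
    ((∀ v, ¬ G.IsFree v) →
      ∀ f : G.cubeComplex n → G.Point, IsIdentifyingOn (G.cubeComplex n) f →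
        ExtendsToConf (G.cubeComplex n) f) := by
  have := Fintype.ofFinite E
  have hV (v : V) : ∃ o, G.head o = v :=
    CellGraph.exists_head_of_degree (CellGraph.degree_ne_zero hbranched v)
  refine ⟨fun f hf => ⟨fun h => CellGraph.isExtendable_of_extendsToConf hV _ h,
    fun h => CellGraph.extendsToConf_of_isExtendable hdeg hbranched hf h⟩,
    fun A h0 _ f _ h => CellGraph.isExtendable_of_extendsToConf hV h0 h,
    fun hfree f hf => CellGraph.extendsToConf_of_isExtendable hdeg hbranched hf ?_⟩
  rintro ⟨e, u, v, F, hF, -, hu, -⟩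
  exact hfree u hu
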